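/- Let $n\ge 1$ and let $$L=(-1)^n\frac{d^{2n}}{dx^{2n}}+\sum_{j=0}^{n-1}\frac{d^j}{dx^j}\,p_j(x)\,\frac{d^j}{dx^j},$$ where $p_0,\dots,p_{n-1}$ are real-valued and $\pi$-periodic on $\mathbb R$, $p_j$ has $j$ derivatives (for $j\ge1$, $p_j\in C^{j-1}$ with $p_j^{(j-1)}$ locally absolutely continuous), and $\int_0^\pi|p_j^{(j)}|\,dx<\infty$ for every $j$. For $\mu\in\mathbb C$ let $u_1(\cdot,\mu),\dots,u_{2n}(\cdot,\mu)$ be the solutions of $Ly=\mu y$ with $u_k^{(j)}(0,\mu)=\delta_{k-1,j}$, $0\le j\le 2n-1$, let $U(\mu)=\big(u_k^{(j-1)}(\pi,\mu)\big)_{k,j=1}^{2n}$ be the monodromy matrix, and let $\Delta(\mu,\rho)=\det(U(\mu)-\rho I)$. Let $\omega_1,\dots,\omega_{2n}$ be all the $2n$-th roots of $(-1)^n$. Then there are functions $\rho_1,\dots,\rho_{2n}:\mathbb R\to\mathbb C$, continuous on $\mathbb R$, such that $\Delta(\mu,\rho_k(\mu))=0$ for all $\mu\in\mathbb R$ and all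 $k$, and $$|\rho_k(\mu)|=e^{\operatorname{Re}\omega_k\,\lambda\pi}(1+o(1)),\qquad \mu=\lambda^{2n},\ \lambda\to+\infty .$$ Moreover, there is a set $D\subset\mathbb R$ with only finitely many points in each bounded interval such that at every $\mu\in\mathbb R\setminus D$ the numbers $\rho_1(\mu),\dots,\rho_{2n}(\mu)$ are pairwise distinct and all $\rho_k$ are analytic at $\mu$, while at every $\mu\in D$ some two of the $\rho_k(\mu)$ coincide. Up to finitely many points, $D$ is grouped in pairs asymptotically close to $$\mathcal N=\Big\{\,s\,m^{2n}(\operatorname{Im}\zeta)^{-2n}\;:\; s\in\{1,-1\},\ \zeta^{2n}=s(-1)^n,\ \operatorname{Im}\zeta>0,\ m=1,2,\dots\Big\}$$ in the following sense. Put $r(x)=\operatorname{sgn}(x)\,|x|^{1/(2n)}$. To all $(s,\zeta,m)$ as above one can assign pairs of real numbers $\{a_{s,\zeta,m},b_{s,\zeta,m}\}$ (possibly $a_{s,\zeta,m}=b_{s,\zeta,m}$) with $$r(a_{s,\zeta,m})-r\big(s\,m^{2n}(\operatorname{Im}\zeta)^{-2n}\big)\to0,\qquad r(b_{s,\zeta,m})-r\big(s\,m^{2n}(\operatorname{Im}\zeta)^{-2n}\big)\to0\qquad(m\to\infty)$$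 such that $D$ is the union of a finite set and of the pairs $\{a_{s,\zeta,m},b_{s,\zeta,m}\}$ with $(s,\zeta,m)$ in some set of indices. -/

import Mathlib

open Filter Topology MeasureTheory

noncomputable section

namespace PeriodicOperator

/-- `f` has `m` derivatives in the Carathéodory sense: for `m ≥ 1`, `f` is of class `C^(m-1)` and
`f^(m-1)` is absolutely continuous on every compact interval. No condition for `m = 0`. -/
def HasACDerivs {E : Type*} [NormedAddCommGroup E] [NormedSpace ℝ E] (m : ℕ) (f : ℝ → E) : Prop :=
  match m with
  | 0 => True
  | k + 1 => ContDiff ℝ (k : ℕ∞) f ∧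
      ∀ a b : ℝ, AbsolutelyContinuousOnInterval (iteratedDeriv k f) a b

/-- Admissible coefficients `p_0, …, p_{n-1}`: real valued, `π`-periodic, `p_j` has `j` derivatives
and `∫_0^π |p_j^(j)| < ∞`. -/
structure IsAdmissible (n : ℕ) (p : Fin n → ℝ → ℝ) : Prop where
  periodic : ∀ j : Fin n, Function.Periodic (p j) Real.pi
  acDerivs : ∀ j : Fin n, HasACDerivs (j : ℕ) (p j)
  integrable : ∀ j : Fin n, IntervalIntegrable (iteratedDeriv (j : ℕ) (p j)) volume 0 Real.pi

/-- The differential expression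
`L y = (-1)^n y^(2n) + ∑_{j<n} (d/dx)^j (p_j (d/dx)^j y)`. -/
def L (n : ℕ) (p : Fin n → ℝ → ℝ) (y : ℝ → ℂ) (x : ℝ) : ℂ :=
  (-1) ^ n * iteratedDeriv (2 * n) y x +
    ∑ j : Fin n, iteratedDeriv (j : ℕ) (fun t => (p j t : ℂ) * iteratedDeriv (j : ℕ) y t) x

/-- `y` is a (Carathéodory) solution on the real line of `L y = μ y`. -/
def IsSolution (n : ℕ) (p : Fin n → ℝ → ℝ) (μ : ℂ) (y : ℝ → ℂ) : Prop :=
  HasACDerivs (2 * n) y ∧ ∀ᵐ x : ℝ, L n p y x = μ * y x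

/-- The solution `u_{k+1}(·, μ)` of the fundamental system: the solution of `L y = μ y` with
`y^(j)(0) = δ_{kj}` for `0 ≤ j < 2n` (indices counted from `0`). -/
def fundamentalSolution (n : ℕ) (p : Fin n → ℝ → ℝ) (k : Fin (2 * n)) (μ : ℂ) : ℝ → ℂ :=
  Classical.epsilon fun y : ℝ → ℂ => IsSolution n p μ y ∧
    ∀ j : Fin (2 * n), iteratedDeriv (j : ℕ) y 0 = if j = k then 1 else 0

/-- The monodromy matrix `U(μ)`, with entries `u_k^(j)(π, μ)`. -/
def monodromy (n : ℕ) (p : Fin n → ℝ → ℝ) (μ : ℂ) : Matrix (Fin (2 * n)) (Fin (2 * n)) ℂ :=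
  Matrix.of fun k j => iteratedDeriv (j : ℕ) (fundamentalSolution n p k μ) Real.pi

/-- The characteristic function `Δ(μ, ρ) = det (U(μ) - ρ I)`. -/
def charDet (n : ℕ) (p : Fin n → ℝ → ℝ) (μ ρ : ℂ) : ℂ :=
  (monodromy n p μ - ρ • (1 : Matrix (Fin (2 * n)) (Fin (2 * n)) ℂ)).det

/-- The signed root `sgn(x) |x|^(1/(2n))` of a real number: the coordinate `λ` in which points of
the `μ`-axis are compared. -/
def signedRoot (n : ℕ) (x : ℝ) : ℝ :=
  Real.sign x * |x| ^ (1 / (2 * n : ℝ))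

/-- The pairs (sign, root): `s = ±1` and `ζ` in the open upper half-plane with
`ζ^(2n) = s (-1)^n`. Up to conjugation, `e^(ζ r x)` are the non-monotone exponential solutions of
`(-1)^n y^(2n) = s r^(2n) y`. -/
def resonances (n : ℕ) : Set (ℝ × ℂ) :=
  {q | (q.1 = 1 ∨ q.1 = -1) ∧ q.2 ^ (2 * n) = (q.1 : ℂ) * (-1) ^ n ∧ 0 < q.2.im}

/-- The model points `s m^(2n) (Im ζ)^(-2n)`. -/
def modelPoint (n : ℕ) (q : ℝ × ℂ) (m : ℕ) : ℝ :=
  q.1 * (m : ℝ) ^ (2 * n) / q.2.im ^ (2 * n)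

/-- `D` consists, up to finitely many points, of pairs of points (the two may coincide), at most one
pair `{a q m, b q m}` for each index `(q, m)` of a model point; both members of the pair are
asymptotically close to the model point as `m → ∞`, in the coordinate `signedRoot`. -/
def InPairsCloseToModel (n : ℕ) (D : Set ℝ) : Prop :=
  ∃ (F : Set ℝ) (M : Set ((ℝ × ℂ) × ℕ)) (a b : ℝ × ℂ → ℕ → ℝ),
    F.Finite ∧
    (∀ i ∈ M, i.1 ∈ resonances n ∧ 1 ≤ i.2) ∧
    (∀ q ∈ resonances n,
      Tendsto (fun m => signedRoot n (a q m) - signedRoot n (modelPoint n q m)) atTop (𝓝 0) ∧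
      Tendsto (fun m => signedRoot n (b q m) - signedRoot n (modelPoint n q m)) atTop (𝓝 0)) ∧
    D = F ∪ ⋃ i ∈ M, {a i.1 i.2, b i.1 i.2}

end PeriodicOperator

end

/-!
Write `μ = κ z^(2n)` with `κ = ±1`, and let `ω_1, …, ω_{2n}` be the roots of `ω^(2n) = κ (-1)^n`.

**Asymptotics of the monodromy matrix.** The equation `L y = μ y` is a first order system for
`(y, y', …, y^(2n-1))` with locally integrable coefficients, whose fundamental matrix is entire in
`μ`. In the basis of the exponentials `e^(z ω_j x)` it becomes `w' = (z diag ω + R) w` with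
`R = O(1 / |z|)` in `L¹(0, π)`, because `L` has no term of order `2n - 1`. Variation of constants,
with each component prescribed at the end of the interval from which its kernel is bounded, shows
that for `Re z` large and `|Im z| ≤ 1` the monodromy matrix is similar to `(1 + E) diag (e^(z ω_j π))`
with `E` small (`exists_charDet_eq_det`). The error is multiplicative, which matters since the
exponentials are of very different sizes.

**Multipliers at real points.** A Gershgorin theorem with relative radii and a homotopy argument
(`exists_eigenvalues_near`) place the multipliers in discs about the `e^(l ω_j π)`, `z = l` real. All
`ω_j` are unimodular, so two discs can meet only if they belong to a conjugate pair `ζ`, `conj ζ`,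
and only if `sin (l π Im ζ)` is small. Hence for large `l` double multipliers occur only for `l` near
some `m / Im ζ`, with a value near `(-1)^m e^(l π Re ζ)` (`exists_multipliers_near`). The eigenvalues
of a continuous path of matrices have continuous enumerations (`exists_continuous_eigenvalues`); for
large `μ` a continuous branch cannot pass from one annulus of moduli to another, which gives the
labelling by growth (`exists_continuous_multipliers`).

**At most two double points near a model point.** Near `z = m / β`, `β = Im ζ`, put `z = m / β + t`
and `ρ = σ (-1)^m e^(π z Re ζ)`. Dividing the columns of the characteristic determinant by their sizes
turns it into `σ² - 2 cos (β π t) σ + 1 + g(t, σ)`, where `g` is holomorphic and tends to zero as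
`m → ∞` (`exists_norm_charDet_sub_le`). If `(t_i, σ_i)` were double roots for three real parameters
`t_0 < t_1 < t_2`, then, with `σ` frozen at `σ_1`, the function would vanish at `t_1` and be at most a
small multiple of `(t - t_1)²` at `t_0` and `t_2`, which contradicts the convexity of `-2 cos`
(`not_three_double_roots`). No symmetry of the multipliers is used.

**The exceptional set.** `D` is the set of real `μ` for which `Δ(μ, ·)` has a double root. Off `D` the
multipliers are simple and analytic by the implicit function theorem. The discriminant of `Δ(μ, ·)` is
an entire function of `μ` whose real zeros form `D`; it is not identically zero because the large points of
`D` are countably many. So `D` is locally finite, and its large points form the pairs above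
(`inPairsCloseToModel_isDoubleMultiplier`).
-/

namespace PeriodicOperator

/-! ### Absolutely continuous functions -/

section AbsolutelyContinuous

variable {E F : Type*} [NormedAddCommGroup E] [NormedAddCommGroup F]

theorem ac_of_dist_le {f : ℝ → E} {g : ℝ → F} {a b C : ℝ}
    (hg : AbsolutelyContinuousOnInterval g a b)
    (h : ∀ x ∈ Set.uIcc a b, ∀ y ∈ Set.uIcc a b, dist (f x) (f y) ≤ C * dist (g x) (g y)) :
    AbsolutelyContinuousOnInterval f a b := by
  rw [absolutelyContinuousOnInterval_iff] at hg ⊢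
  intro ε hε
  have hC : 0 < |C| + 1 := by positivity
  obtain ⟨δ, hδ, H⟩ := hg (ε / (|C| + 1)) (by positivity)
  refine ⟨δ, hδ, fun I hI hs => ?_⟩
  have h2 := H I hI hs
  rw [lt_div_iff₀ hC] at h2
  refine lt_of_le_of_lt ?_ h2
  rw [Finset.sum_mul]
  refine Finset.sum_le_sum fun i hi => ?_
  have h3 := h _ (hI.1 i hi).1 _ (hI.1 i hi).2
  have h4 : C ≤ |C| + 1 := by linarith [le_abs_self C]
  nlinarith [dist_nonneg (x := g (I.2 i).1) (y := g (I.2 i).2)]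

theorem ac_const (c : F) (a b : ℝ) : AbsolutelyContinuousOnInterval (fun _ => c) a b :=
  (LipschitzWith.const c).lipschitzOnWith.absolutelyContinuousOnInterval

theorem ac_sum {ι : Type*} (s : Finset ι) {f : ι → ℝ → F} {a b : ℝ}
    (h : ∀ i ∈ s, AbsolutelyContinuousOnInterval (f i) a b) :
    AbsolutelyContinuousOnInterval (fun x => ∑ i ∈ s, f i x) a b := by
  classical
  induction s using Finset.induction_on with
  | empty => simpa using ac_const (0 : F) a b
  | insert i s hi ih =>
    simp only [Finset.sum_insert hi]
    exact (h i (by simp)).fun_add (ih fun j hj => h j (by simp [hj]))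

variable [NormedSpace ℝ F]

theorem ac_primitive {f : ℝ → F} {a b c : ℝ} (h : IntervalIntegrable f volume a b)
    (hc : c ∈ Set.uIcc a b) :
    AbsolutelyContinuousOnInterval (fun x => ∫ t in c..x, f t) a b := by
  refine ac_of_dist_le (C := 1) (h.norm.absolutelyContinuousOnInterval_intervalIntegral hc) ?_
  intro x hx y hy
  have hI : ∀ {u v}, u ∈ Set.uIcc a b → v ∈ Set.uIcc a b → IntervalIntegrable f volume u v :=
    fun hu hv => h.mono_set (Set.uIcc_subset_uIcc hu hv)
  rw [dist_eq_norm, dist_eq_norm, intervalIntegral.integral_interval_sub_left (hI hc hx) (hI hc hy),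
    intervalIntegral.integral_interval_sub_left (hI hc hx).norm (hI hc hy).norm, one_mul]
  exact intervalIntegral.norm_integral_le_abs_integral_norm

/-- The fundamental theorem of calculus for an absolutely continuous vector-valued function whose
almost everywhere derivative is known. -/
theorem ac_integral_eq_sub [CompleteSpace F] {f f' : ℝ → F} {a b : ℝ}
    (hf : AbsolutelyContinuousOnInterval f a b) (hi : IntervalIntegrable f' volume a b)
    (hd : ∀ᵐ x, x ∈ Set.uIcc a b → HasDerivAt f (f' x) x) :
    ∫ t in a..b, f' t = f b - f a := by
  have hg : AbsolutelyContinuousOnInterval (fun x => f x - ∫ t in a..x, f' t) a b :=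
    hf.fun_sub (ac_primitive hi Set.left_mem_uIcc)
  obtain ⟨C, hC⟩ := hg.const_of_ae_hasDerivAt_zero (by
    filter_upwards [hd, hi.ae_hasDerivAt_integral] with x h1 h2 hx
    simpa using (h1 hx).fun_sub (h2 hx a Set.left_mem_uIcc))
  have h1 := hC a Set.left_mem_uIcc
  have h2 := hC b Set.right_mem_uIcc
  simp only [intervalIntegral.integral_same, sub_zero] at h1
  rw [h1, ← h2]; abel

theorem ac_mul {f g : ℝ → ℂ} {a b : ℝ} (hf : AbsolutelyContinuousOnInterval f a b)
    (hg : AbsolutelyContinuousOnInterval g a b) :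
    AbsolutelyContinuousOnInterval (fun x => f x * g x) a b := hf.fun_smul hg

theorem ac_cexp (c : ℂ) (a b : ℝ) :
    AbsolutelyContinuousOnInterval (fun x : ℝ => Complex.exp (c * x)) a b := by
  refine ContDiffOn.absolutelyContinuousOnInterval (ContDiff.contDiffOn ?_)
  exact Complex.contDiff_exp.comp (contDiff_const.mul Complex.ofRealCLM.contDiff)

/-- Weighted integrals of a locally integrable `φ ≥ 0` against the exponential of its own primitive
are controlled by the weight; this makes the integral operators below contractions. -/
theorem abs_integral_mul_exp_primitive_le {φ : ℝ → ℝ} (hφ : ∀ x, 0 ≤ φ x)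
    (hi : ∀ a b, IntervalIntegrable φ volume a b) {K : ℝ} (hK : 0 < K) (x : ℝ) :
    |∫ t in (0 : ℝ)..x, φ t * Real.exp (K * |∫ s in (0 : ℝ)..t, φ s|)| ≤
      Real.exp (K * |∫ s in (0 : ℝ)..x, φ s|) / K := by
  set Φ : ℝ → ℝ := fun x => ∫ s in (0 : ℝ)..x, φ s with hΦ
  -- the sign of `Φ` is constant on the interval of integration
  obtain ⟨σ, hσ, hs⟩ : ∃ σ : ℝ, |σ| = 1 ∧ ∀ t ∈ Set.uIcc 0 x, |Φ t| = σ * Φ t := by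
    rcases le_total 0 x with hx | hx
    · refine ⟨1, by simp, fun t ht => ?_⟩
      rw [Set.uIcc_of_le hx] at ht
      rw [one_mul, abs_of_nonneg (intervalIntegral.integral_nonneg ht.1 fun s _ => hφ s)]
    · refine ⟨-1, by simp, fun t ht => ?_⟩
      rw [Set.uIcc_of_ge hx] at ht
      have : 0 ≤ ∫ s in t..0, φ s := intervalIntegral.integral_nonneg ht.2 fun s _ => hφ s
      rw [intervalIntegral.integral_symm] at this
      rw [abs_of_nonpos (by simp only [hΦ]; linarith)]; ring
  have hac : AbsolutelyContinuousOnInterval Φ 0 x := ac_primitive (hi 0 x) Set.left_mem_uIcc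
  have hΦc : Continuous Φ := intervalIntegral.continuous_primitive hi 0
  have hexp : AbsolutelyContinuousOnInterval (fun t => Real.exp (K * σ * Φ t)) 0 x := by
    obtain ⟨M, hM⟩ := hac.exists_bound
    have hL : ∃ L, LipschitzOnWith L Real.exp (Set.Icc (-(|K * σ| * M)) (|K * σ| * M)) :=
      Real.contDiff_exp.contDiffOn.exists_lipschitzOnWith (n := 1) one_ne_zero
        (convex_Icc _ _) isCompact_Icc
    obtain ⟨L, hL⟩ := hL
    refine ac_of_dist_le (C := L * |K * σ|) hac fun u hu v hv => ?_
    have hb : ∀ u ∈ Set.uIcc 0 x, K * σ * Φ u ∈ Set.Icc (-(|K * σ| * M)) (|K * σ| * M) := by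
      intro u hu
      refine Set.mem_Icc.2 (abs_le.1 ?_)
      rw [abs_mul]
      exact mul_le_mul_of_nonneg_left (hM u hu) (abs_nonneg _)
    refine (hL.dist_le_mul _ (hb u hu) _ (hb v hv)).trans ?_
    rw [Real.dist_eq, ← mul_sub, abs_mul, Real.dist_eq, mul_assoc]
  have hint : IntervalIntegrable (fun t => φ t * Real.exp (K * σ * Φ t)) volume 0 x :=
    (hi 0 x).mul_continuousOn (by fun_prop)
  have hftc := ac_integral_eq_sub hexp (hint.const_mul (K * σ)) (by
    filter_upwards [(hi 0 x).ae_hasDerivAt_integral] with t ht hx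
    have := ((ht hx 0 Set.left_mem_uIcc).const_mul (K * σ)).exp
    exact this.congr_deriv (by simp only [hΦ]; ring))
  rw [intervalIntegral.integral_const_mul] at hftc
  have hcongr : ∫ t in (0 : ℝ)..x, φ t * Real.exp (K * |Φ t|)
      = ∫ t in (0 : ℝ)..x, φ t * Real.exp (K * σ * Φ t) :=
    intervalIntegral.integral_congr fun t ht => by simp only [hs t ht, mul_assoc]
  rw [hcongr, le_div_iff₀ hK]
  have h0 : Φ 0 = 0 := by simp [hΦ]
  have h1 : |K * σ * ∫ t in (0 : ℝ)..x, φ t * Real.exp (K * σ * Φ t)|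
      = |∫ t in (0 : ℝ)..x, φ t * Real.exp (K * σ * Φ t)| * K := by
    rw [abs_mul, abs_mul, hσ, abs_of_pos hK]; ring
  rw [← h1, hftc, h0, mul_zero, Real.exp_zero, hs x Set.right_mem_uIcc, ← mul_assoc]
  have h2 : 1 ≤ Real.exp (K * σ * Φ x) := by
    rw [Real.one_le_exp_iff, mul_assoc, ← hs x Set.right_mem_uIcc]
    positivity
  rw [abs_of_nonneg (by linarith)]; linarith

end AbsolutelyContinuous

/-! ### Linear systems with locally integrable coefficients -/

section LinearSystem

variable {ι : Type*} [Fintype ι]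

/-- `Y` is a Carathéodory solution of the linear system `Y' = A Y` on the interval with endpoints
`a` and `b`. -/
def SolvesOn (A : ℝ → Matrix ι ι ℂ) (a b : ℝ) (Y : ℝ → ι → ℂ) : Prop :=
  ∀ i, AbsolutelyContinuousOnInterval (fun x => Y x i) a b ∧
    ∀ᵐ x, x ∈ Set.uIcc a b → HasDerivAt (fun x => Y x i) ((A x).mulVec (Y x) i) x

/-- All entries of the matrix function `A` are integrable on every compact interval. -/
def LocInt (A : ℝ → Matrix ι ι ℂ) : Prop :=
  ∀ i j a b, IntervalIntegrable (fun t => A t i j) volume a b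

theorem LocInt.mulVec {A : ℝ → Matrix ι ι ℂ} (hA : LocInt A) {Y : ℝ → ι → ℂ} {a b : ℝ}
    (hY : ∀ i, ContinuousOn (fun x => Y x i) (Set.uIcc a b)) (i : ι) :
    IntervalIntegrable (fun t => (A t).mulVec (Y t) i) volume a b := by
  simp only [Matrix.mulVec, dotProduct]
  simpa only [Finset.sum_fn] using IntervalIntegrable.sum (μ := volume) (a := a) (b := b)
    Finset.univ (f := fun j t => A t i j * Y t j) fun j _ => (hA i j a b).mul_continuousOn (hY j)

/-- The sum of the absolute values of the entries of a matrix. -/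
noncomputable def entrySum (M : Matrix ι ι ℂ) : ℝ := ∑ i, ∑ j, ‖M i j‖

theorem entrySum_nonneg (M : Matrix ι ι ℂ) : 0 ≤ entrySum M :=
  Finset.sum_nonneg fun _ _ => Finset.sum_nonneg fun _ _ => norm_nonneg _

theorem norm_mulVec_le_entrySum (M : Matrix ι ι ℂ) (v : ι → ℂ) (i : ι) {C : ℝ}
    (hv : ∀ j, ‖v j‖ ≤ C) : ‖M.mulVec v i‖ ≤ entrySum M * C := by
  rw [Matrix.mulVec, dotProduct]
  calc ‖∑ j, M i j * v j‖ ≤ ∑ j, ‖M i j‖ * C :=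
        norm_sum_le_of_le _ fun j _ => by
          rw [norm_mul]; exact mul_le_mul_of_nonneg_left (hv j) (norm_nonneg _)
    _ = (∑ j, ‖M i j‖) * C := by rw [Finset.sum_mul]
    _ ≤ entrySum M * C := by
        refine mul_le_mul_of_nonneg_right ?_ ((norm_nonneg _).trans (hv i))
        exact Finset.single_le_sum (f := fun i => ∑ j, ‖M i j‖)
          (fun _ _ => Finset.sum_nonneg fun _ _ => norm_nonneg _) (Finset.mem_univ i)

theorem LocInt.intervalIntegrable_entrySum {A : ℝ → Matrix ι ι ℂ} (hA : LocInt A) (a b : ℝ) :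
    IntervalIntegrable (fun t => entrySum (A t)) volume a b := by
  simp only [entrySum]
  simpa only [Finset.sum_fn] using IntervalIntegrable.sum (μ := volume) (a := a) (b := b)
    Finset.univ (f := fun i t => ∑ j, ‖A t i j‖) fun i _ => by
      simpa only [Finset.sum_fn] using IntervalIntegrable.sum (μ := volume) (a := a) (b := b)
        Finset.univ (f := fun j t => ‖A t i j‖) fun j _ => (hA i j a b).norm

end LinearSystem

section Existence

variable {ι : Type*} [Fintype ι]

open scoped BoundedContinuousFunction

theorem LocInt.integrand {B : ℝ → Matrix ι ι ℂ} (hB : LocInt B) {w : ℝ → ℝ} (hw : Continuous w)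
    {f : ℝ → ι → ℂ} (hf : Continuous f) (i : ι) (a b : ℝ) :
    IntervalIntegrable (fun t => (w t : ℂ) * (B t).mulVec (f t) i) volume a b :=
  (hB.mulVec (fun i => ((continuous_apply i).comp hf).continuousOn) i).continuousOn_mul
    (by fun_prop)

theorem norm_weighted_primitive_le {φ w : ℝ → ℝ} {K : ℝ} (hK : 0 < K)
    (hφ : ∀ a b, IntervalIntegrable φ volume a b) (hw : Continuous w) (hw0 : ∀ x, 0 < w x)
    (hwφ : ∀ x, |∫ t in (0 : ℝ)..x, φ t * w t| ≤ w x / K)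
    {B : ℝ → Matrix ι ι ℂ} (hBφ : ∀ t, entrySum (B t) ≤ φ t) (f : ℝ →ᵇ (ι → ℂ)) (x : ℝ) :
    ‖fun i => ((w x)⁻¹ : ℂ) * ∫ t in (0 : ℝ)..x, (w t : ℂ) * (B t).mulVec (f t) i‖
      ≤ K⁻¹ * ‖f‖ := by
  refine (pi_norm_le_iff_of_nonneg (by positivity)).2 fun i => ?_
  have h1 : ‖∫ t in (0 : ℝ)..x, (w t : ℂ) * (B t).mulVec (f t) i‖ ≤ w x / K * ‖f‖ := by
    calc ‖∫ t in (0 : ℝ)..x, (w t : ℂ) * (B t).mulVec (f t) i‖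
        ≤ |∫ t in (0 : ℝ)..x, φ t * w t * ‖f‖| := by
          refine intervalIntegral.norm_integral_le_abs_of_norm_le (ae_of_all _ fun t => ?_)
            (((hφ 0 x).mul_continuousOn hw.continuousOn).mul_const _)
          rw [norm_mul, Complex.norm_real, Real.norm_of_nonneg (hw0 t).le]
          have := norm_mulVec_le_entrySum (B t) (f t) i
            (fun j => (norm_le_pi_norm (f t) j).trans (f.norm_coe_le_norm t))
          have h3 := mul_le_mul_of_nonneg_right (hBφ t) (norm_nonneg f)
          have h4 := mul_le_mul_of_nonneg_left (this.trans h3) (hw0 t).le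
          linarith
      _ = |∫ t in (0 : ℝ)..x, φ t * w t| * ‖f‖ := by
          rw [intervalIntegral.integral_mul_const, abs_mul, abs_norm]
      _ ≤ _ := mul_le_mul_of_nonneg_right (hwφ x) (norm_nonneg _)
  rw [norm_mul, norm_inv, Complex.norm_real, Real.norm_of_nonneg (hw0 x).le,
    inv_mul_le_iff₀ (hw0 x)]
  refine h1.trans (le_of_eq ?_)
  ring

/-- The Volterra operator `f ↦ w⁻¹ ∫₀ˣ w B f` on bounded continuous functions; in the weighted
unknown `w f` it is integration against `B`. -/
noncomputable def volterra (φ w : ℝ → ℝ) (K : ℝ) (hK : 0 < K)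
    (hφ : ∀ a b, IntervalIntegrable φ volume a b) (hw : Continuous w) (hw0 : ∀ x, 0 < w x)
    (hwφ : ∀ x, |∫ t in (0 : ℝ)..x, φ t * w t| ≤ w x / K)
    (B : ℝ → Matrix ι ι ℂ) (hB : LocInt B) (hBφ : ∀ t, entrySum (B t) ≤ φ t) :
    (ℝ →ᵇ (ι → ℂ)) →L[ℂ] (ℝ →ᵇ (ι → ℂ)) :=
  LinearMap.mkContinuous
    { toFun := fun f => BoundedContinuousFunction.ofNormedAddCommGroup
        (fun x i => ((w x)⁻¹ : ℂ) * ∫ t in (0 : ℝ)..x, (w t : ℂ) * (B t).mulVec (f t) i)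
        (continuous_pi fun i => by
          refine Continuous.mul (Continuous.inv₀ (by fun_prop) fun x => ?_)
            (intervalIntegral.continuous_primitive (fun a b => hB.integrand hw f.continuous i a b) 0)
          exact_mod_cast (hw0 x).ne')
        (K⁻¹ * ‖f‖) (norm_weighted_primitive_le hK hφ hw hw0 hwφ hBφ f)
      map_add' := fun f g => by
        ext x i
        simp only [BoundedContinuousFunction.coe_ofNormedAddCommGroup,
          BoundedContinuousFunction.coe_add, Pi.add_apply, Matrix.mulVec_add, mul_add]
        rw [intervalIntegral.integral_add (hB.integrand hw f.continuous i 0 x)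
          (hB.integrand hw g.continuous i 0 x), mul_add]
      map_smul' := fun c f => by
        ext x i
        simp only [BoundedContinuousFunction.coe_ofNormedAddCommGroup,
          BoundedContinuousFunction.coe_smul, Pi.smul_apply, Matrix.mulVec_smul, smul_eq_mul,
          RingHom.id_apply]
        simp only [mul_left_comm _ c, intervalIntegral.integral_const_mul] }
    K⁻¹ fun f => by
      refine (BoundedContinuousFunction.norm_le (by positivity)).2 fun x => ?_
      exact norm_weighted_primitive_le hK hφ hw hw0 hwφ hBφ f x

theorem norm_volterra_le {φ w : ℝ → ℝ} {K : ℝ} (hK : 0 < K)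
    (hφ : ∀ a b, IntervalIntegrable φ volume a b) (hw : Continuous w) (hw0 : ∀ x, 0 < w x)
    (hwφ : ∀ x, |∫ t in (0 : ℝ)..x, φ t * w t| ≤ w x / K)
    {B : ℝ → Matrix ι ι ℂ} (hB : LocInt B) (hBφ : ∀ t, entrySum (B t) ≤ φ t) :
    ‖volterra φ w K hK hφ hw hw0 hwφ B hB hBφ‖ ≤ K⁻¹ := by
  refine ContinuousLinearMap.opNorm_le_bound _ (by positivity) fun f => ?_
  refine (BoundedContinuousFunction.norm_le (by positivity)).2 fun x => ?_
  exact norm_weighted_primitive_le hK hφ hw hw0 hwφ hBφ f x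

theorem solvesOn_of_integral_eq {A : ℝ → Matrix ι ι ℂ} (hA : LocInt A) {Y : ℝ → ι → ℂ}
    (hY : Continuous Y) {y0 : ι → ℂ}
    (h : ∀ x i, Y x i = y0 i + ∫ t in (0 : ℝ)..x, (A t).mulVec (Y t) i) (a b : ℝ) :
    SolvesOn A a b Y := by
  have hint : ∀ i a b, IntervalIntegrable (fun t => (A t).mulVec (Y t) i) volume a b :=
    fun i a b => hA.mulVec (fun i => ((continuous_apply i).comp hY).continuousOn) i
  intro i
  have e : (fun x => Y x i) = fun x => y0 i + ∫ t in (0 : ℝ)..x, (A t).mulVec (Y t) i :=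
    funext fun x => h x i
  have h0 : (0 : ℝ) ∈ Set.uIcc (min (min a b) 0) (max (max a b) 0) := by
    rw [Set.uIcc_of_le (by simp)]; simp
  have hsub : Set.uIcc a b ⊆ Set.uIcc (min (min a b) 0) (max (max a b) 0) := by
    rw [Set.uIcc_of_le (a := min (min a b) 0) (by simp), Set.uIcc]
    exact Set.Icc_subset_Icc (min_le_left _ _) (le_max_left _ _)
  rw [e]
  constructor
  · exact ((ac_const _ _ _).fun_add (ac_primitive (hint i _ _) h0)).mono hsub
  · filter_upwards [(hint i _ _).ae_hasDerivAt_integral] with x hx hxab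
    exact (hx (hsub hxab) 0 h0).const_add _

/-- The fixed point of an affine contraction depending holomorphically on a parameter is
holomorphic. -/
theorem exists_analytic_fixedPoint {X : Type*} [NormedAddCommGroup X] [NormedSpace ℂ X]
    [CompleteSpace X] (T₀ T₁ : X →L[ℂ] X) {R : ℝ} (hR : 0 < R)
    (hT₀ : ‖T₀‖ ≤ (2 * (1 + R))⁻¹) (hT₁ : ‖T₁‖ ≤ (2 * (1 + R))⁻¹) (g : X) :
    ∃ f : ℂ → X, ∀ μ, ‖μ‖ < R → f μ = g + (T₀ (f μ) + μ • T₁ (f μ)) ∧ DifferentiableAt ℂ f μ := by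
  have hnorm : ∀ μ : ℂ, ‖μ‖ < R → ‖T₀ + μ • T₁‖ < 1 := by
    intro μ hμ
    calc ‖T₀ + μ • T₁‖ ≤ (2 * (1 + R))⁻¹ + R * (2 * (1 + R))⁻¹ := by
          refine (norm_add_le _ _).trans (add_le_add hT₀ ?_)
          rw [norm_smul]
          exact mul_le_mul hμ.le hT₁ (norm_nonneg _) hR.le
      _ = 1 / 2 := by field_simp
      _ < 1 := by norm_num
  have hunit : ∀ μ : ℂ, ‖μ‖ < R → IsUnit (1 - (T₀ + μ • T₁)) := fun μ hμ =>
    isUnit_one_sub_of_norm_lt_one (hnorm μ hμ)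
  refine ⟨fun μ => Ring.inverse (1 - (T₀ + μ • T₁)) g, fun μ hμ => ⟨?_, ?_⟩⟩
  · have h := Ring.mul_inverse_cancel _ (hunit μ hμ)
    have h2 := congrArg (fun S : X →L[ℂ] X => S g) h
    simp only [mul_apply_eq_comp, sub_apply,
      one_apply_eq_self, add_apply,
      smul_apply] at h2
    rw [sub_eq_iff_eq_add] at h2
    exact h2
  · obtain ⟨u, hu⟩ := hunit μ hμ
    have h1 : DifferentiableAt ℂ (Ring.inverse : (X →L[ℂ] X) → _) (1 - (T₀ + μ • T₁)) := by
      rw [← hu]; exact differentiableAt_inverse ⟨u, rfl⟩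
    have h2 : DifferentiableAt ℂ (fun μ : ℂ => 1 - (T₀ + μ • T₁)) μ := by fun_prop
    exact (h1.comp μ h2).clm_apply (differentiableAt_const g)

theorem exists_analytic_solution (A₀ A₁ : ℝ → Matrix ι ι ℂ) (h₀ : LocInt A₀) (h₁ : LocInt A₁)
    {R : ℝ} (hR : 0 < R) (y₀ : ι → ℂ) :
    ∃ Y : ℂ → ℝ → ι → ℂ,
      (∀ μ, ‖μ‖ < R → Y μ 0 = y₀ ∧ ∀ a b, SolvesOn (fun t => A₀ t + μ • A₁ t) a b (Y μ)) ∧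
      ∀ x i, DifferentiableOn ℂ (fun μ => Y μ x i) (Metric.ball 0 R) := by
  set φ : ℝ → ℝ := fun t => entrySum (A₀ t) + entrySum (A₁ t) with hφdef
  have hφ0 : ∀ t, 0 ≤ φ t := fun t => add_nonneg (entrySum_nonneg _) (entrySum_nonneg _)
  have hφi : ∀ a b, IntervalIntegrable φ volume a b := fun a b =>
    (h₀.intervalIntegrable_entrySum a b).add (h₁.intervalIntegrable_entrySum a b)
  set K : ℝ := 2 * (1 + R) with hKdef
  have hK : 0 < K := by positivity
  set w : ℝ → ℝ := fun x => Real.exp (K * |∫ s in (0 : ℝ)..x, φ s|) with hwdef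
  have hwc : Continuous w :=
    Real.continuous_exp.comp
      (continuous_const.mul (intervalIntegral.continuous_primitive hφi 0).abs)
  have hw0 : ∀ x, 0 < w x := fun x => Real.exp_pos _
  have hwφ : ∀ x, |∫ t in (0 : ℝ)..x, φ t * w t| ≤ w x / K := fun x =>
    abs_integral_mul_exp_primitive_le hφ0 hφi hK x
  set T₀ := volterra φ w K hK hφi hwc hw0 hwφ A₀ h₀
    (fun t => le_add_of_nonneg_right (entrySum_nonneg _)) with hT₀
  set T₁ := volterra φ w K hK hφi hwc hw0 hwφ A₁ h₁
    (fun t => le_add_of_nonneg_left (entrySum_nonneg _)) with hT₁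
  have n₀ : ‖T₀‖ ≤ K⁻¹ := norm_volterra_le ..
  have n₁ : ‖T₁‖ ≤ K⁻¹ := norm_volterra_le ..
  set g : ℝ →ᵇ (ι → ℂ) := BoundedContinuousFunction.ofNormedAddCommGroup
    (fun x => ((w x)⁻¹ : ℂ) • y₀)
    (((Complex.continuous_ofReal.comp hwc).inv₀ fun x => by
      simpa using (hw0 x).ne').smul continuous_const) ‖y₀‖ (fun x => by
        rw [norm_smul, norm_inv, Complex.norm_real, Real.norm_of_nonneg (hw0 x).le]
        refine mul_le_of_le_one_left (norm_nonneg _) (inv_le_one_of_one_le₀ ?_)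
        exact Real.one_le_exp (by positivity)) with hg
  obtain ⟨f, hf⟩ := exists_analytic_fixedPoint T₀ T₁ hR n₀ n₁ g
  refine ⟨fun μ x i => (w x : ℂ) * f μ x i, fun μ hμ => ?_, fun x i μ hμ => ?_⟩
  · have hA : LocInt (fun t => A₀ t + μ • A₁ t) := fun i j a b => by
      simpa using (h₀ i j a b).add ((h₁ i j a b).const_mul μ)
    have hc : Continuous fun x i => (w x : ℂ) * f μ x i := by
      have := (f μ).continuous
      fun_prop
    have key : ∀ x i, (w x : ℂ) * f μ x i = y₀ i +
        ∫ t in (0 : ℝ)..x, (A₀ t + μ • A₁ t).mulVec (fun i => (w t : ℂ) * f μ t i) i := by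
      intro x i
      have hwx : (w x : ℂ) ≠ 0 := by exact_mod_cast (hw0 x).ne'
      have e1 : (f μ) x i = ((w x)⁻¹ : ℂ) * y₀ i +
          (((w x)⁻¹ : ℂ) * (∫ t in (0 : ℝ)..x, (w t : ℂ) * (A₀ t).mulVec (f μ t) i) +
            μ * (((w x)⁻¹ : ℂ) * ∫ t in (0 : ℝ)..x, (w t : ℂ) * (A₁ t).mulVec (f μ t) i)) := by
        conv_lhs => rw [(hf μ hμ).1]
        rfl
      have e2 : ∀ t, (A₀ t + μ • A₁ t).mulVec (fun i => (w t : ℂ) * f μ t i) i =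
          (w t : ℂ) * (A₀ t).mulVec (f μ t) i + μ * ((w t : ℂ) * (A₁ t).mulVec (f μ t) i) := by
        intro t
        have : (fun i => (w t : ℂ) * f μ t i) = (w t : ℂ) • f μ t := rfl
        rw [this, Matrix.mulVec_smul, Matrix.add_mulVec, Matrix.smul_mulVec]
        simp only [Pi.smul_apply, Pi.add_apply, smul_eq_mul]
        ring
      simp only [e2]
      rw [intervalIntegral.integral_add (h₀.integrand hwc (f μ).continuous i 0 x)
        ((h₁.integrand hwc (f μ).continuous i 0 x).const_mul μ),
        intervalIntegral.integral_const_mul, e1]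
      field_simp
    refine ⟨?_, solvesOn_of_integral_eq hA hc key⟩
    ext i
    have := key 0 i
    simpa using this
  · rw [mem_ball_zero_iff] at hμ
    have h1 : DifferentiableAt ℂ (fun μ => f μ x i) μ := by
      have h2 := ((ContinuousLinearMap.proj (R := ℂ) (φ := fun _ : ι => ℂ) i).comp
        (BoundedContinuousFunction.evalCLM ℂ x)).differentiableAt.comp μ (hf μ hμ).2
      exact h2
    exact (h1.const_mul _).differentiableWithinAt

end Existence

section FundamentalMatrix

theorem LocInt.add_smul {ι : Type*} {A₀ A₁ : ℝ → Matrix ι ι ℂ} (h₀ : LocInt A₀) (h₁ : LocInt A₁) (μ : ℂ) :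
    LocInt (fun t => A₀ t + μ • A₁ t) := fun i j a b => by
  simpa using (h₀ i j a b).add ((h₁ i j a b).const_mul μ)

variable {ι : Type*} [Fintype ι]

theorem SolvesOn.mono {A : ℝ → Matrix ι ι ℂ} {Y : ℝ → ι → ℂ} {a b c d : ℝ}
    (h : SolvesOn A a b Y) (hs : Set.uIcc c d ⊆ Set.uIcc a b) : SolvesOn A c d Y := fun i =>
  ⟨(h i).1.mono hs, (h i).2.mono fun _ hx hxs => hx (hs hxs)⟩

/-- A constant linear change of the unknown which intertwines the coefficient matrices. -/
theorem SolvesOn.linear {A A' : ℝ → Matrix ι ι ℂ} {Y : ℝ → ι → ℂ} {a b : ℝ}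
    (h : SolvesOn A a b Y) (M : Matrix ι ι ℂ) (hM : ∀ t, M * A t = A' t * M) :
    SolvesOn A' a b (fun x => M.mulVec (Y x)) := by
  intro i
  constructor
  · exact ac_sum _ fun j _ => (h j).1.const_smul (M i j)
  · have h2 : ∀ᵐ x, ∀ j, x ∈ Set.uIcc a b →
        HasDerivAt (fun x => Y x j) ((A x).mulVec (Y x) j) x := ae_all_iff.2 fun j => (h j).2
    filter_upwards [h2] with x hx hxs
    have h3 : HasDerivAt (fun x => ∑ j, M i j * Y x j) (∑ j, M i j * (A x).mulVec (Y x) j) x :=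
      HasDerivAt.fun_sum fun j _ => (hx j hxs).const_mul (M i j)
    have e : (A' x).mulVec (M.mulVec (Y x)) i = ∑ j, M i j * (A x).mulVec (Y x) j := by
      rw [Matrix.mulVec_mulVec, ← hM, ← Matrix.mulVec_mulVec]; rfl
    rw [e]; exact h3

/-- Solutions of a system and of its adjoint system have constant pairing. -/
theorem SolvesOn.dotProduct_adjoint {A : ℝ → Matrix ι ι ℂ} {Y Z : ℝ → ι → ℂ} {a b : ℝ}
    (hY : SolvesOn A a b Y) (hZ : SolvesOn (fun t => -(A t).transpose) a b Z) :
    ∑ i, Z b i * Y b i = ∑ i, Z a i * Y a i := by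
  have hac : AbsolutelyContinuousOnInterval (fun x => ∑ i, Z x i * Y x i) a b :=
    ac_sum _ fun i _ => ac_mul (hZ i).1 (hY i).1
  have h1 : ∀ᵐ x, ∀ j, x ∈ Set.uIcc a b →
    HasDerivAt (fun x => Y x j) ((A x).mulVec (Y x) j) x := ae_all_iff.2 fun j => (hY j).2
  have h2 : ∀ᵐ x, ∀ j, x ∈ Set.uIcc a b →
    HasDerivAt (fun x => Z x j) ((-(A x).transpose).mulVec (Z x) j) x :=
    ae_all_iff.2 fun j => (hZ j).2
  obtain ⟨C, hC⟩ := hac.const_of_ae_hasDerivAt_zero (by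
    filter_upwards [h1, h2] with x h1 h2 hx
    have h3 : HasDerivAt (fun x => ∑ i, Z x i * Y x i)
        (∑ i, ((-(A x).transpose).mulVec (Z x) i * Y x i + Z x i * (A x).mulVec (Y x) i)) x :=
      HasDerivAt.fun_sum fun j _ => (h2 j hx).mul (h1 j hx)
    refine h3.congr_deriv ?_
    rw [Finset.sum_add_distrib]
    have e : ∑ i, (-(A x).transpose).mulVec (Z x) i * Y x i
        = - ∑ i, Z x i * (A x).mulVec (Y x) i := by
      have := Matrix.dotProduct_mulVec (Z x) (A x) (Y x)
      rw [Matrix.neg_mulVec, Matrix.mulVec_transpose]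
      simp only [dotProduct] at this
      simp [this]
    rw [e]; ring)
  rw [hC b Set.right_mem_uIcc, hC a Set.left_mem_uIcc]

variable [DecidableEq ι]

theorem exists_matrix_solution {A : ℝ → Matrix ι ι ℂ} (hA : LocInt A) :
    ∃ Φ : ℝ → Matrix ι ι ℂ, Φ 0 = 1 ∧ ∀ j a b, SolvesOn A a b (fun x i => Φ x i j) := by
  have h := fun j : ι => exists_analytic_solution A 0 hA
    (fun i j a b => by simp) one_pos (Pi.single j 1)
  choose Y hY _ using h
  refine ⟨fun x => Matrix.of fun i j => Y j 0 x i, ?_, fun j a b => ?_⟩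
  · ext i j
    have := congrFun ((hY j 0 (by simp)).1) i
    simp [this, Matrix.one_apply, Pi.single_apply]
  · simpa using (hY j 0 (by simp)).2 a b

/-- A solution matrix which is the identity at `0` propagates every solution. -/
theorem SolvesOn.eq_mulVec {A : ℝ → Matrix ι ι ℂ} (hA : LocInt A) {Φ : ℝ → Matrix ι ι ℂ}
    (hΦ0 : Φ 0 = 1) {b : ℝ} (hΦ : ∀ j, SolvesOn A 0 b (fun x i => Φ x i j)) {Y : ℝ → ι → ℂ}
    (hY : SolvesOn A 0 b Y) : Y b = (Φ b).mulVec (Y 0) := by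
  have hA' : LocInt (fun t => -(A t).transpose) := fun i j a b => by
    exact (hA j i a b).neg
  obtain ⟨Ψ, hΨ0, hΨ⟩ := exists_matrix_solution hA'
  have key : ∀ {Y : ℝ → ι → ℂ}, SolvesOn A 0 b Y → (Ψ b).transpose.mulVec (Y b) = Y 0 := by
    intro Y hY
    ext j
    have := hY.dotProduct_adjoint (hΨ j 0 b)
    rw [hΨ0] at this
    simpa [Matrix.mulVec, dotProduct, Matrix.one_apply] using this
  have h1 : (Ψ b).transpose * Φ b = 1 := by
    ext i j
    have h2 := congrFun (key (hΦ j)) i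
    rw [← hΦ0]
    simpa [Matrix.mulVec, dotProduct, Matrix.mul_apply] using h2
  have h2 : Φ b * (Ψ b).transpose = 1 := mul_eq_one_comm.1 h1
  rw [← key hY, Matrix.mulVec_mulVec, h2, Matrix.one_mulVec]

/-- The fundamental matrix of a linear system which depends linearly on a parameter is an entire
function of the parameter. -/
theorem exists_fundamentalMatrix {A₀ A₁ : ℝ → Matrix ι ι ℂ} (h₀ : LocInt A₀) (h₁ : LocInt A₁) :
    ∃ Φ : ℂ → ℝ → Matrix ι ι ℂ, (∀ μ, Φ μ 0 = 1) ∧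
      (∀ μ j a b, SolvesOn (fun t => A₀ t + μ • A₁ t) a b (fun x i => Φ μ x i j)) ∧
      ∀ x i j, Differentiable ℂ (fun μ => Φ μ x i j) := by
  choose Φ hΦ0 hΦ using fun μ : ℂ => exists_matrix_solution (h₀.add_smul h₁ μ)
  refine ⟨Φ, hΦ0, hΦ, fun x i j μ => ?_⟩
  obtain ⟨Y, hY, hYd⟩ := exists_analytic_solution A₀ A₁ h₀ h₁
    (R := ‖μ‖ + 1) (by positivity) (Pi.single j 1)
  have hb : Metric.ball (0 : ℂ) (‖μ‖ + 1) ∈ 𝓝 μ :=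
    Metric.isOpen_ball.mem_nhds (by simp)
  refine ((hYd x i).differentiableAt hb).congr_of_eventuallyEq ?_
  filter_upwards [hb] with ν hν
  rw [mem_ball_zero_iff] at hν
  have := SolvesOn.eq_mulVec (h₀.add_smul h₁ ν) (hΦ0 ν) (fun j => hΦ ν j 0 x)
    ((hY ν hν).2 0 x)
  rw [this, (hY ν hν).1]
  simp

end FundamentalMatrix

/-! ### Reduction of the differential expression to a first order system -/

section Reduction

theorem hasACDerivs_iff {E : Type*} [NormedAddCommGroup E] [NormedSpace ℝ E] {m : ℕ} (hm : 0 < m)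
    (f : ℝ → E) : HasACDerivs m f ↔ ContDiff ℝ ((m - 1 : ℕ) : ℕ∞) f ∧
      ∀ a b : ℝ, AbsolutelyContinuousOnInterval (iteratedDeriv (m - 1) f) a b := by
  obtain ⟨k, rfl⟩ : ∃ k, m = k + 1 := ⟨m - 1, by omega⟩
  rfl

theorem ae_differentiableAt_of_ac {E : Type*} [NormedAddCommGroup E] [NormedSpace ℝ E]
    [FiniteDimensional ℝ E] {f : ℝ → E} (hf : ∀ a b, AbsolutelyContinuousOnInterval f a b) :
    ∀ᵐ x, DifferentiableAt ℝ f x := by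
  have h : ∀ᵐ x : ℝ, ∀ m : ℕ, x ∈ Set.uIcc (-(m : ℝ)) m → DifferentiableAt ℝ f x :=
    ae_all_iff.2 fun m => (hf _ _).boundedVariationOn.ae_differentiableAt_of_mem_uIcc
  filter_upwards [h] with x hx
  obtain ⟨m, hm⟩ := exists_nat_ge |x|
  refine hx m ?_
  rw [Set.uIcc_of_le (by linarith [abs_nonneg x])]
  exact ⟨by linarith [neg_abs_le x], by linarith [le_abs_self x]⟩

/-- The Leibniz rule at a point where the derivatives of highest order merely exist. -/
theorem iteratedDeriv_mul_of_differentiableAt {f g : ℝ → ℂ} {k : ℕ} (hf : ContDiff ℝ k f)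
    (hg : ContDiff ℝ k g) {x : ℝ} (hfx : DifferentiableAt ℝ (iteratedDeriv k f) x)
    (hgx : DifferentiableAt ℝ (iteratedDeriv k g) x) :
    iteratedDeriv (k + 1) (fun t => f t * g t) x =
      ∑ i ∈ Finset.range (k + 2),
        ((k + 1).choose i : ℂ) * (iteratedDeriv i f x * iteratedDeriv (k + 1 - i) g x) := by
  have e : iteratedDeriv k (fun t => f t * g t) = fun y => ∑ ij ∈ Finset.HasAntidiagonal.antidiagonal k,
      (k.choose ij.1 : ℂ) * (iteratedDeriv ij.1 f y * iteratedDeriv ij.2 g y) := by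
    ext y
    have := iteratedDeriv_mul (x := y) hf.contDiffAt hg.contDiffAt
    rw [show (fun t => f t * g t) = f * g from rfl, this,
      Finset.Nat.sum_antidiagonal_eq_sum_range_succ_mk]
    exact Finset.sum_congr rfl fun i _ => by simp only [mul_assoc]
  have hd : ∀ {h : ℝ → ℂ}, ContDiff ℝ k h → DifferentiableAt ℝ (iteratedDeriv k h) x →
      ∀ i ≤ k, HasDerivAt (iteratedDeriv i h) (iteratedDeriv (i + 1) h x) x := by
    intro h hh hx i hi
    rw [iteratedDeriv_succ]
    rcases hi.lt_or_eq with hi | rfl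
    · exact (hh.differentiable_iteratedDeriv i (by exact_mod_cast hi) x).hasDerivAt
    · exact hx.hasDerivAt
  have hs : HasDerivAt (iteratedDeriv k (fun t => f t * g t))
      (∑ ij ∈ Finset.HasAntidiagonal.antidiagonal k, (k.choose ij.1 : ℂ) *
        (iteratedDeriv (ij.1 + 1) f x * iteratedDeriv ij.2 g x +
          iteratedDeriv ij.1 f x * iteratedDeriv (ij.2 + 1) g x)) x := by
    rw [e]
    refine HasDerivAt.fun_sum fun ij hij => ?_
    rw [Finset.HasAntidiagonal.mem_antidiagonal] at hij
    exact ((hd hf hfx _ (by omega)).mul (hd hg hgx _ (by omega))).const_mul _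
  rw [iteratedDeriv_succ, hs.deriv]
  have h1 := Finset.sum_antidiagonal_choose_succ_mul
    (fun i j => iteratedDeriv i f x * iteratedDeriv j g x) k
  rw [Finset.Nat.sum_antidiagonal_eq_sum_range_succ_mk] at h1
  rw [h1, ← Finset.sum_add_distrib]
  refine Finset.sum_congr rfl fun ij hij => ?_
  rw [Finset.HasAntidiagonal.mem_antidiagonal] at hij
  rw [Nat.choose_symm_of_eq_add (n := k) (a := ij.2) (b := ij.1) (by omega)]
  ring

theorem iteratedDeriv_ofReal {p : ℝ → ℝ} {k : ℕ} (hp : ContDiff ℝ k p) :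
    iteratedDeriv k (fun t => (p t : ℂ)) = fun t => ((iteratedDeriv k p t : ℝ) : ℂ) := by
  induction k with
  | zero => simp
  | succ k ih =>
    have hk : ContDiff ℝ k p := hp.of_le (by exact_mod_cast k.le_succ)
    rw [iteratedDeriv_succ, ih hk]
    ext t
    rw [iteratedDeriv_succ]
    exact ((hp.differentiable_iteratedDeriv k (by exact_mod_cast k.lt_succ_self)
      t).hasDerivAt.ofReal_comp).deriv

theorem iteratedDeriv_add (y : ℝ → ℂ) (i j : ℕ) :
    iteratedDeriv i (iteratedDeriv j y) = iteratedDeriv (i + j) y := by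
  rw [iteratedDeriv_eq_iterate, iteratedDeriv_eq_iterate, iteratedDeriv_eq_iterate,
    Function.iterate_add_apply]

variable {n : ℕ} {p : Fin n → ℝ → ℝ}

theorem ae_iteratedDeriv_coeff_mul (hp : IsAdmissible n p) (j : Fin n) {y : ℝ → ℂ}
    (hy : ContDiff ℝ ((2 * n - 1 : ℕ) : ℕ∞) y) :
    ∀ᵐ x, iteratedDeriv (j : ℕ) (fun t => (p j t : ℂ) * iteratedDeriv (j : ℕ) y t) x =
      ∑ i ∈ Finset.range ((j : ℕ) + 1), (((j : ℕ).choose i : ℕ) : ℂ) *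
        (((iteratedDeriv i (p j) x : ℝ) : ℂ) * iteratedDeriv (2 * (j : ℕ) - i) y x) := by
  have hj := j.2
  rcases Nat.eq_zero_or_pos (j : ℕ) with h0 | h0
  · filter_upwards with x
    simp [h0]
  · obtain ⟨hc, hac⟩ := (hasACDerivs_iff h0 _).1 (hp.acDerivs j)
    obtain ⟨k, hk⟩ : ∃ k, (j : ℕ) = k + 1 := ⟨j - 1, by omega⟩
    rw [hk] at hc hac ⊢
    rw [Nat.add_sub_cancel] at hc hac
    filter_upwards [ae_differentiableAt_of_ac hac] with x hx
    have hc' : ContDiff ℝ k (p j) := by exact_mod_cast hc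
    have hf : ContDiff ℝ k (fun t => (p j t : ℂ)) := Complex.ofRealCLM.contDiff.comp hc'
    have hg : ContDiff ℝ (k + 1 : ℕ) (iteratedDeriv (k + 1) y) := by
      rw [contDiff_nat_iff_iteratedDeriv]
      refine ⟨fun m hm => ?_, fun m hm => ?_⟩ <;> rw [iteratedDeriv_add]
      · exact hy.continuous_iteratedDeriv _ (by exact_mod_cast (by omega))
      · exact hy.differentiable_iteratedDeriv _ (by exact_mod_cast (by omega))
    have hfx : HasDerivAt (iteratedDeriv k (fun t => (p j t : ℂ)))
        ((iteratedDeriv (k + 1) (p j) x : ℝ) : ℂ) x := by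
      rw [iteratedDeriv_ofReal hc', iteratedDeriv_succ]
      exact hx.hasDerivAt.ofReal_comp
    rw [iteratedDeriv_mul_of_differentiableAt hf (hg.of_le (by exact_mod_cast k.le_succ))
      hfx.differentiableAt (hg.differentiable_iteratedDeriv k (by exact_mod_cast k.lt_succ_self) x)]
    refine Finset.sum_congr rfl fun i hi => ?_
    rw [Finset.mem_range] at hi
    congr 2
    · rcases Nat.lt_or_ge i (k + 1) with h | h
      · rw [iteratedDeriv_ofReal (hc'.of_le (by exact_mod_cast (by omega)))]
      · obtain rfl : i = k + 1 := by omega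
        rw [← hfx.deriv, ← iteratedDeriv_succ]
    · rw [iteratedDeriv_add]
      congr 1
      omega

/-- The coefficient of `y^(k)` in the expanded lower order part of `L y`. -/
noncomputable def lowerCoeff (n : ℕ) (p : Fin n → ℝ → ℝ) (t : ℝ) (k : ℕ) : ℂ :=
  ∑ j : Fin n, ∑ i ∈ Finset.range ((j : ℕ) + 1), if 2 * (j : ℕ) - i = k then
    (((j : ℕ).choose i : ℕ) : ℂ) * ((iteratedDeriv i (p j) t : ℝ) : ℂ) else 0

/-- The order of the lower order part of `L` is at most `2n - 2`. -/
theorem lowerCoeff_eq_zero {t : ℝ} {k : ℕ} (hk : 2 * n - 1 ≤ k) : lowerCoeff n p t k = 0 := by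
  refine Finset.sum_eq_zero fun j _ => Finset.sum_eq_zero fun i _ => if_neg ?_
  have := j.2
  omega

theorem sum_lowerCoeff_mul (t : ℝ) (Y : ℕ → ℂ) :
    ∑ k : Fin (2 * n), lowerCoeff n p t k * Y k =
      ∑ j : Fin n, ∑ i ∈ Finset.range ((j : ℕ) + 1), (((j : ℕ).choose i : ℕ) : ℂ) *
        (((iteratedDeriv i (p j) t : ℝ) : ℂ) * Y (2 * (j : ℕ) - i)) := by
  rw [Fin.sum_univ_eq_sum_range (fun k => lowerCoeff n p t k * Y k)]
  simp only [lowerCoeff, Finset.sum_mul]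
  rw [Finset.sum_comm]
  refine Finset.sum_congr rfl fun j _ => ?_
  rw [Finset.sum_comm]
  refine Finset.sum_congr rfl fun i _ => ?_
  simp only [ite_mul, zero_mul]
  rw [Finset.sum_ite_eq, if_pos (Finset.mem_range.2 (by have := j.2; omega)), mul_assoc]

theorem ae_L_eq (hp : IsAdmissible n p) {y : ℝ → ℂ}
    (hy : ContDiff ℝ ((2 * n - 1 : ℕ) : ℕ∞) y) :
    ∀ᵐ x, L n p y x = (-1) ^ n * iteratedDeriv (2 * n) y x +
      ∑ k : Fin (2 * n), lowerCoeff n p x k * iteratedDeriv (k : ℕ) y x := by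
  filter_upwards [ae_all_iff.2 fun j => ae_iteratedDeriv_coeff_mul hp j hy] with x hx
  rw [L, sum_lowerCoeff_mul x (fun k => iteratedDeriv k y x)]
  congr 1
  exact Finset.sum_congr rfl fun j _ => hx j

theorem intervalIntegrable_iteratedDeriv_coeff (hp : IsAdmissible n p) (j : Fin n) {i : ℕ}
    (hi : i ≤ j) (a b : ℝ) : IntervalIntegrable (iteratedDeriv i (p j)) volume a b := by
  rcases hi.lt_or_eq with hi | rfl
  · obtain ⟨hc, -⟩ := (hasACDerivs_iff (by omega) _).1 (hp.acDerivs j)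
    exact (hc.continuous_iteratedDeriv i
      (by exact_mod_cast (by omega : i ≤ (j : ℕ) - 1))).intervalIntegrable a b
  · have hper : Function.Periodic (iteratedDeriv (j : ℕ) (p j)) Real.pi := by
      intro x
      have h := iteratedDeriv_comp_add_const (j : ℕ) (p j) Real.pi
      have h2 : (fun z => p j (z + Real.pi)) = p j := funext (hp.periodic j)
      rw [h2] at h
      exact (congrFun h x).symm
    exact hper.intervalIntegrable₀ Real.pi_ne_zero (hp.integrable j) a b

theorem intervalIntegrable_lowerCoeff (hp : IsAdmissible n p) (k : ℕ) (a b : ℝ) :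
    IntervalIntegrable (fun t => lowerCoeff n p t k) volume a b := by
  simp only [lowerCoeff]
  simpa only [Finset.sum_fn] using IntervalIntegrable.sum (μ := volume) (a := a) (b := b)
    Finset.univ (f := fun (j : Fin n) t => ∑ i ∈ Finset.range ((j : ℕ) + 1),
      if 2 * (j : ℕ) - i = k then
        (((j : ℕ).choose i : ℕ) : ℂ) * ((iteratedDeriv i (p j) t : ℝ) : ℂ) else 0) fun j _ => by
      simpa only [Finset.sum_fn] using IntervalIntegrable.sum (μ := volume) (a := a) (b := b)
        (Finset.range ((j : ℕ) + 1)) (f := fun i t => if 2 * (j : ℕ) - i = k then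
          (((j : ℕ).choose i : ℕ) : ℂ) * ((iteratedDeriv i (p j) t : ℝ) : ℂ) else 0)
          fun i hi => by
        rw [Finset.mem_range] at hi
        split_ifs
        · have h := intervalIntegrable_iteratedDeriv_coeff hp j (by omega : i ≤ j) a b
          exact IntervalIntegrable.const_mul ⟨h.1.ofReal, h.2.ofReal⟩ _
        · simp

end Reduction

section Monodromy

variable {n : ℕ} {p : Fin n → ℝ → ℝ}

/-- The part of the companion matrix of `L y = μ y` which does not depend on `μ`. -/
noncomputable def companion (n : ℕ) (p : Fin n → ℝ → ℝ) (t : ℝ) :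
    Matrix (Fin (2 * n)) (Fin (2 * n)) ℂ :=
  Matrix.of fun i j => if (i : ℕ) + 1 < 2 * n then (if (j : ℕ) = i + 1 then 1 else 0)
    else -((-1) ^ n * lowerCoeff n p t j)

/-- The coefficient of `μ` in the companion matrix of `L y = μ y`. -/
noncomputable def companionParam (n : ℕ) : Matrix (Fin (2 * n)) (Fin (2 * n)) ℂ :=
  Matrix.of fun i j => if (i : ℕ) + 1 < 2 * n then 0 else if (j : ℕ) = 0 then (-1) ^ n else 0

theorem companion_mulVec (hn : 1 ≤ n) (t : ℝ) (μ : ℂ) (Y : ℕ → ℂ) (i : Fin (2 * n)) :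
    (companion n p t + μ • companionParam n).mulVec (fun k => Y k) i =
      if (i : ℕ) + 1 < 2 * n then Y (i + 1)
      else (-1) ^ n * (μ * Y 0 - ∑ k : Fin (2 * n), lowerCoeff n p t k * Y k) := by
  simp only [Matrix.mulVec, dotProduct, Matrix.add_apply, Matrix.smul_apply, companion,
    companionParam, Matrix.of_apply, smul_eq_mul]
  split_ifs with h
  · simp only [mul_zero, add_zero, ite_mul, one_mul, zero_mul]
    rw [Fin.sum_univ_eq_sum_range (fun k => if k = (i : ℕ) + 1 then Y k else 0),
      Finset.sum_ite_eq', if_pos (Finset.mem_range.2 h)]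
  · simp only [add_mul, Finset.sum_add_distrib, mul_ite, mul_zero, ite_mul, zero_mul]
    rw [Fin.sum_univ_eq_sum_range (fun k => if k = 0 then μ * (-1) ^ n * Y k else 0),
      Finset.sum_ite_eq', if_pos (Finset.mem_range.2 (by omega))]
    simp only [neg_mul, Finset.sum_neg_distrib, mul_assoc, ← Finset.mul_sum]
    ring

theorem locInt_companion (hp : IsAdmissible n p) : LocInt (companion n p) := by
  intro i j a b
  simp only [companion, Matrix.of_apply]
  split_ifs
  · simp
  · simp
  · exact ((intervalIntegrable_lowerCoeff hp j a b).const_mul _).neg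

theorem locInt_const {ι : Type*} (M : Matrix ι ι ℂ) : LocInt (fun _ => M) := fun i j a b => by
  simp

/-- The vector of derivatives of a solution of `L y = μ y` solves the companion system. -/
theorem IsSolution.solvesOn (hn : 1 ≤ n) (hp : IsAdmissible n p) {μ : ℂ} {y : ℝ → ℂ}
    (h : IsSolution n p μ y) (a b : ℝ) :
    SolvesOn (fun t => companion n p t + μ • companionParam n) a b
      (fun x i => iteratedDeriv (i : ℕ) y x) := by
  obtain ⟨hc, hac⟩ := (hasACDerivs_iff (by omega) _).1 h.1
  intro i
  have hi := i.2
  rcases Nat.lt_or_ge ((i : ℕ) + 1) (2 * n) with h1 | h1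
  · have hd : ContDiff ℝ 1 (iteratedDeriv (i : ℕ) y) := by
      rw [show (1 : WithTop ℕ∞) = ((1 : ℕ) : WithTop ℕ∞) by simp, contDiff_nat_iff_iteratedDeriv]
      refine ⟨fun m hm => ?_, fun m hm => ?_⟩ <;> rw [iteratedDeriv_add]
      · exact hc.continuous_iteratedDeriv _ (by exact_mod_cast (by omega))
      · exact hc.differentiable_iteratedDeriv _ (by exact_mod_cast (by omega))
    refine ⟨hd.contDiffOn.absolutelyContinuousOnInterval, ?_⟩
    filter_upwards with x _
    rw [companion_mulVec hn x μ (fun k => iteratedDeriv k y x), if_pos h1, iteratedDeriv_succ]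
    exact (hd.differentiable one_ne_zero x).hasDerivAt
  · have e : (i : ℕ) = 2 * n - 1 := by omega
    refine ⟨by simpa only [e] using hac a b, ?_⟩
    filter_upwards [ae_differentiableAt_of_ac hac, ae_L_eq hp hc, h.2] with x hx hL hy _
    rw [companion_mulVec hn x μ (fun k => iteratedDeriv k y x), if_neg (by omega)]
    have h2 : iteratedDeriv (2 * n) y x = (-1) ^ n * (μ * y x -
        ∑ k : Fin (2 * n), lowerCoeff n p x k * iteratedDeriv (k : ℕ) y x) := by
      rw [← hy, hL, add_sub_cancel_right, ← mul_assoc, ← mul_pow]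
      simp
    rw [iteratedDeriv_zero, ← h2, e]
    rw [show 2 * n = 2 * n - 1 + 1 by omega, iteratedDeriv_succ, Nat.add_sub_cancel]
    exact hx.hasDerivAt

theorem hasDerivAt_of_ac {E : Type*} [NormedAddCommGroup E] [NormedSpace ℝ E]
    [CompleteSpace E] {f f' : ℝ → E} (hf : ∀ a b, AbsolutelyContinuousOnInterval f a b)
    (hf' : Continuous f') (hd : ∀ᵐ x, HasDerivAt f (f' x) x) (x : ℝ) : HasDerivAt f (f' x) x := by
  have e : f = fun x => f 0 + ∫ t in (0 : ℝ)..x, f' t := by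
    ext x
    rw [ac_integral_eq_sub (hf 0 x) (hf'.intervalIntegrable _ _) (hd.mono fun _ h _ => h)]
    abel
  rw [e]
  exact (hf'.integral_hasStrictDerivAt 0 x).hasDerivAt.const_add _

/-- The first component of a global solution of the companion system solves `L y = μ y`. -/
theorem isSolution_of_solvesOn (hn : 1 ≤ n) (hp : IsAdmissible n p) {μ : ℂ} {Y : ℝ → ℕ → ℂ}
    (h : ∀ a b, SolvesOn (fun t => companion n p t + μ • companionParam n) a b
      (fun x (i : Fin (2 * n)) => Y x i)) :
    IsSolution n p μ (fun x => Y x 0) ∧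
      ∀ i < 2 * n, iteratedDeriv i (fun x => Y x 0) = fun x => Y x i := by
  have hac : ∀ i < 2 * n, ∀ a b, AbsolutelyContinuousOnInterval (fun x => Y x i) a b :=
    fun i hi a b => (h a b ⟨i, hi⟩).1
  have hc : ∀ i < 2 * n, Continuous (fun x => Y x i) := by
    intro i hi
    refine continuous_iff_continuousAt.2 fun x => ?_
    refine ((hac i hi (x - 1) (x + 1)).continuousOn).continuousAt ?_
    rw [Set.uIcc_of_le (by linarith)]
    exact Icc_mem_nhds (by linarith) (by linarith)
  have hae : ∀ i (hi : i < 2 * n), ∀ᵐ x, HasDerivAt (fun x => Y x i)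
      ((companion n p x + μ • companionParam n).mulVec (fun k : Fin (2 * n) => Y x k) ⟨i, hi⟩) x := by
    intro i hi
    have h1 : ∀ᵐ x : ℝ, ∀ m : ℕ, x ∈ Set.uIcc (-(m : ℝ)) m → HasDerivAt (fun x => Y x i)
      ((companion n p x + μ • companionParam n).mulVec (fun k : Fin (2 * n) => Y x k) ⟨i, hi⟩) x :=
      ae_all_iff.2 fun m => (h _ _ ⟨i, hi⟩).2
    filter_upwards [h1] with x hx
    obtain ⟨m, hm⟩ := exists_nat_ge |x|
    refine hx m ?_
    rw [Set.uIcc_of_le (by linarith [abs_nonneg x])]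
    exact ⟨by linarith [neg_abs_le x], by linarith [le_abs_self x]⟩
  have hd : ∀ i, i + 1 < 2 * n → ∀ x, HasDerivAt (fun x => Y x i) (Y x (i + 1)) x := by
    intro i hi
    refine hasDerivAt_of_ac (hac i (by omega)) (hc (i + 1) hi) ?_
    filter_upwards [hae i (by omega)] with x hx
    rwa [companion_mulVec hn x μ (Y x), if_pos hi] at hx
  have hit : ∀ i < 2 * n, iteratedDeriv i (fun x => Y x 0) = fun x => Y x i := by
    intro i
    induction i with
    | zero => intro _; simp
    | succ i ih =>
      intro hi
      rw [iteratedDeriv_succ, ih (by omega)]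
      exact funext fun x => (hd i hi x).deriv
  have hcd : ContDiff ℝ ((2 * n - 1 : ℕ) : ℕ∞) (fun x => Y x 0) := by
    have : ContDiff ℝ (2 * n - 1 : ℕ) (fun x => Y x 0) := by
      rw [contDiff_nat_iff_iteratedDeriv]
      refine ⟨fun m hm => ?_, fun m hm => ?_⟩ <;> rw [hit m (by omega)]
      · exact hc m (by omega)
      · exact fun x => (hd m (by omega) x).differentiableAt
    exact_mod_cast this
  refine ⟨⟨(hasACDerivs_iff (by omega) _).2 ⟨hcd, fun a b => ?_⟩, ?_⟩, hit⟩
  · rw [hit _ (by omega)]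
    exact hac _ (by omega) a b
  · filter_upwards [ae_L_eq hp hcd, hae (2 * n - 1) (by omega)] with x hL hx
    rw [companion_mulVec hn x μ (Y x), if_neg (by simp only; omega)] at hx
    have e : iteratedDeriv (2 * n) (fun x => Y x 0) x = (-1) ^ n *
        (μ * Y x 0 - ∑ k : Fin (2 * n), lowerCoeff n p x k * Y x k) := by
      rw [← hx.deriv, show 2 * n = 2 * n - 1 + 1 by omega, iteratedDeriv_succ, Nat.add_sub_cancel,
        hit _ (by omega)]
    have e2 : ∑ k : Fin (2 * n), lowerCoeff n p x k * iteratedDeriv (k : ℕ) (fun x => Y x 0) x =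
        ∑ k : Fin (2 * n), lowerCoeff n p x k * Y x k :=
      Finset.sum_congr rfl fun k _ => by rw [hit k k.2]
    rw [hL, e, e2, ← mul_assoc, ← mul_pow]
    simp

/-- The transposed monodromy matrix is the value at `π` of the fundamental matrix of the companion
system; its entries are entire functions of `μ`. -/
theorem exists_fundamentalMatrix_companion (hn : 1 ≤ n) (hp : IsAdmissible n p) :
    ∃ Φ : ℂ → ℝ → Matrix (Fin (2 * n)) (Fin (2 * n)) ℂ, (∀ μ, Φ μ 0 = 1) ∧
      (∀ μ j a b, SolvesOn (fun t => companion n p t + μ • companionParam n) a b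
        (fun x i => Φ μ x i j)) ∧
      (∀ x i j, Differentiable ℂ (fun μ => Φ μ x i j)) ∧
      ∀ μ, monodromy n p μ = (Φ μ Real.pi).transpose := by
  have hA := locInt_companion hp
  have hA₁ : LocInt (fun _ : ℝ => companionParam n) := locInt_const _
  obtain ⟨Φ, h0, h1, h2⟩ := exists_fundamentalMatrix hA hA₁
  refine ⟨Φ, h0, h1, h2, fun μ => ?_⟩
  ext k j
  have hex : ∃ y, IsSolution n p μ y ∧
      ∀ j : Fin (2 * n), iteratedDeriv (j : ℕ) y 0 = if j = k then 1 else 0 := by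
    obtain ⟨hs, hi⟩ := isSolution_of_solvesOn hn hp (μ := μ)
      (Y := fun x i => if hi : i < 2 * n then Φ μ x ⟨i, hi⟩ k else 0)
      (fun a b => by simpa using h1 μ k a b)
    refine ⟨_, hs, fun j => ?_⟩
    rw [hi j j.2]
    simp [h0, Matrix.one_apply]
  have hu := Classical.epsilon_spec hex
  have h3 := SolvesOn.eq_mulVec (hA.add_smul hA₁ μ) (h0 μ) (fun j => h1 μ j 0 Real.pi)
    (hu.1.solvesOn hn hp 0 Real.pi)
  have h4 := congrFun h3 j
  simp only [hu.2] at h4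
  simp only [monodromy, Matrix.of_apply, Matrix.transpose_apply]
  rw [fundamentalSolution]
  rw [h4]
  simp [Matrix.mulVec, dotProduct]

end Monodromy

/-! ### Perturbed diagonal systems -/

section Dichotomy

variable {ι : Type*} [Fintype ι]

theorem SolvesOn.mulVec_const {A : ℝ → Matrix ι ι ℂ} {Φ : ℝ → Matrix ι ι ℂ} {a b : ℝ}
    (h : ∀ j, SolvesOn A a b (fun x i => Φ x i j)) (v : ι → ℂ) :
    SolvesOn A a b (fun x => (Φ x).mulVec v) := by
  intro i
  have e : (fun x => (Φ x).mulVec v i) = fun x => ∑ j, v j • Φ x i j := by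
    ext x; simp [Matrix.mulVec, dotProduct, mul_comm]
  constructor
  · rw [e]
    exact ac_sum _ fun j _ => (h j i).1.const_smul (v j)
  · have h2 : ∀ᵐ x, ∀ j, x ∈ Set.uIcc a b → HasDerivAt (fun x => Φ x i j)
        ((A x).mulVec (fun i => Φ x i j) i) x := ae_all_iff.2 fun j => (h j i).2
    filter_upwards [h2] with x hx hxs
    rw [e]
    have h3 : HasDerivAt (fun x => ∑ j, v j • Φ x i j)
        (∑ j, v j • (A x).mulVec (fun i => Φ x i j) i) x :=
      HasDerivAt.fun_sum fun j _ => (hx j hxs).const_smul (v j)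
    refine h3.congr_deriv ?_
    rw [Matrix.mulVec_mulVec]
    simp only [Matrix.mulVec, dotProduct, Matrix.mul_apply, smul_eq_mul]
    exact Finset.sum_congr rfl fun j _ => by ring

variable [DecidableEq ι]

/-- Variation of constants for one component of a perturbed diagonal system, started at a point `c`
chosen so that the kernel is bounded. -/
theorem norm_sub_exp_mul_le {d : ι → ℂ} {R : ℝ → Matrix ι ι ℂ} (hR : LocInt R) {b C S : ℝ}
    (hC : 0 ≤ C) {w : ℝ → ι → ℂ}
    (hw : SolvesOn (fun t => Matrix.diagonal d + R t) 0 b w) (κ : ℂ)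
    (hS : ∀ t ∈ Set.Icc 0 b, ∀ j, ‖Complex.exp (-κ * t) * w t j‖ ≤ S) {x c : ℝ}
    (hx : x ∈ Set.Icc 0 b) (hc : c ∈ Set.Icc 0 b) (j : ι)
    (hker : ∀ t ∈ Set.uIcc c x, ‖Complex.exp ((d j - κ) * (x - t))‖ ≤ C) :
    ‖Complex.exp (-κ * x) * w x j -
      Complex.exp ((d j - κ) * (x - c)) * (Complex.exp (-κ * c) * w c j)‖ ≤
      C * S * ∫ t in (0 : ℝ)..b, entrySum (R t) := by
  have hb : (0 : ℝ) ≤ b := hx.1.trans hx.2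
  have hsub : Set.uIcc c x ⊆ Set.uIcc 0 b := by
    rw [Set.uIcc_of_le hb]; exact Set.uIcc_subset_Icc hc hx
  have hS0 : 0 ≤ S := (norm_nonneg _).trans (hS x hx j)
  have hwc : ∀ j, ContinuousOn (fun x => w x j) (Set.uIcc c x) := fun j =>
    ((hw j).1.continuousOn).mono hsub
  have hint : IntervalIntegrable (fun t => (R t).mulVec (w t) j) volume c x := hR.mulVec hwc j
  have hint2 : IntervalIntegrable (fun t : ℝ => Complex.exp (-d j * t) * (R t).mulVec (w t) j)
      volume c x := hint.continuousOn_mul (by fun_prop)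
  have hftc := ac_integral_eq_sub (a := c) (b := x)
    (ac_mul (ac_cexp (-d j) c x) ((hw j).1.mono hsub)) hint2 (by
      filter_upwards [(hw j).2] with t ht htx
      have h1 : HasDerivAt (fun t : ℝ => Complex.exp (-d j * t))
          (Complex.exp (-d j * t) * (-d j * 1)) t :=
        ((Complex.ofRealCLM.hasDerivAt (x := t)).const_mul (-d j)).cexp
      refine (h1.mul (ht (hsub htx))).congr_deriv ?_
      rw [Matrix.add_mulVec, Pi.add_apply, Matrix.mulVec_diagonal]
      ring)
  have e : Complex.exp (-κ * x) * w x j -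
      Complex.exp ((d j - κ) * (x - c)) * (Complex.exp (-κ * c) * w c j) =
      ∫ t in c..x, Complex.exp ((d j - κ) * (x - t)) *
        (R t).mulVec (fun i => Complex.exp (-κ * t) * w t i) j := by
    have e1 : ∀ t : ℝ, Complex.exp ((d j - κ) * (x - t)) *
        (R t).mulVec (fun i => Complex.exp (-κ * t) * w t i) j =
        Complex.exp ((d j - κ) * x) * (Complex.exp (-d j * t) * (R t).mulVec (w t) j) := by
      intro t
      rw [show (fun i => Complex.exp (-κ * t) * w t i) = Complex.exp (-κ * t) • w t from rfl,
        Matrix.mulVec_smul, Pi.smul_apply, smul_eq_mul, ← mul_assoc, ← mul_assoc,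
        ← Complex.exp_add, ← Complex.exp_add]
      congr 2; ring
    simp only [e1]
    rw [intervalIntegral.integral_const_mul, hftc, mul_sub (Complex.exp _)]
    simp only [← mul_assoc]
    rw [← Complex.exp_add, ← Complex.exp_add, ← Complex.exp_add]
    congr 3 <;> ring_nf
  rw [e]
  have hRi : IntervalIntegrable (fun t => entrySum (R t)) volume 0 b :=
    hR.intervalIntegrable_entrySum 0 b
  calc ‖∫ t in c..x, Complex.exp ((d j - κ) * (x - t)) *
        (R t).mulVec (fun i => Complex.exp (-κ * t) * w t i) j‖
      ≤ |∫ t in c..x, C * S * entrySum (R t)| := by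
        refine intervalIntegral.norm_integral_le_abs_of_norm_le ?_
          ((hR.intervalIntegrable_entrySum c x).const_mul _)
        refine (ae_restrict_mem measurableSet_uIoc).mono fun t ht => ?_
        have ht' := Set.uIoc_subset_uIcc ht
        have ht2 := hsub ht'
        rw [Set.uIcc_of_le hb] at ht2
        rw [norm_mul]
        have h3 := norm_mulVec_le_entrySum (R t) _ j (hS t ht2)
        calc _ ≤ C * (entrySum (R t) * S) :=
              mul_le_mul (hker t ht') h3 (norm_nonneg _) hC
          _ = _ := by ring
    _ = |C * S * ∫ t in c..x, entrySum (R t)| := by rw [intervalIntegral.integral_const_mul]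
    _ = C * S * |∫ t in c..x, entrySum (R t)| := by
        rw [abs_mul, abs_of_nonneg (mul_nonneg hC hS0)]
    _ ≤ _ := by
        refine mul_le_mul_of_nonneg_left ?_ (mul_nonneg hC hS0)
        have h4 := intervalIntegral.abs_integral_mono_interval (μ := volume)
          (f := fun t => entrySum (R t)) (a := c) (b := x) (c := 0) (d := b)
          (Set.uIoc_subset_uIoc_of_uIcc_subset_uIcc hsub)
          (ae_of_all _ fun t => entrySum_nonneg _) hRi
        rwa [abs_of_nonneg (a := ∫ t in (0 : ℝ)..b, entrySum (R t))
          (intervalIntegral.integral_nonneg hb fun t _ => entrySum_nonneg _)] at h4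

/-- A small integrable perturbation of a diagonal system has solutions close to `e^(d_k x) e_k`. They
are found by prescribing each component at that end of the interval from which the kernel of the
variation of constants formula is bounded. -/
theorem exists_fundamentalMatrix_eq_mul_exp {d : ι → ℂ} {R : ℝ → Matrix ι ι ℂ} (hR : LocInt R)
    {b C : ℝ} (hb : 0 ≤ b) (hC : 0 ≤ C)
    (hdich : ∀ j k, (∀ x ∈ Set.Icc 0 b, ‖Complex.exp ((d j - d k) * x)‖ ≤ C) ∨
      (∀ x ∈ Set.Icc 0 b, ‖Complex.exp (-((d j - d k) * x))‖ ≤ C))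
    (hsmall : C * ∫ t in (0 : ℝ)..b, entrySum (R t) ≤ 1 / 2)
    {Ψ : ℝ → Matrix ι ι ℂ} (hΨ0 : Ψ 0 = 1)
    (hΨ : ∀ j, SolvesOn (fun t => Matrix.diagonal d + R t) 0 b (fun x i => Ψ x i j)) :
    ∃ V₀ V₁ : Matrix ι ι ℂ,
      (∀ i j, ‖V₀ i j‖ ≤ 2 * (C * ∫ t in (0 : ℝ)..b, entrySum (R t))) ∧
      (∀ i j, ‖V₁ i j‖ ≤ 2 * (C * ∫ t in (0 : ℝ)..b, entrySum (R t))) ∧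
      Ψ b * (1 + V₀) = (1 + V₁) * Matrix.diagonal (fun j => Complex.exp (d j * b)) := by
  set ε := ∫ t in (0 : ℝ)..b, entrySum (R t) with hε
  suffices H : ∀ k, ∃ w : ι → ℂ, ∃ v : ι → ℂ, (∀ j, ‖w j - if j = k then 1 else 0‖ ≤ 2 * (C * ε)) ∧
      (∀ j, ‖v j - if j = k then 1 else 0‖ ≤ 2 * (C * ε)) ∧
      (Ψ b).mulVec w = Complex.exp (d k * b) • v by
    choose w v hw hv hwv using H
    refine ⟨Matrix.of (fun i j => w j i) - 1, Matrix.of (fun i j => v j i) - 1, fun i j => ?_,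
      fun i j => ?_, ?_⟩
    · simpa [Matrix.one_apply] using hw j i
    · simpa [Matrix.one_apply] using hv j i
    · rw [add_sub_cancel, add_sub_cancel]
      ext i j
      rw [Matrix.mul_diagonal]
      have := congrFun (hwv j) i
      simp only [Pi.smul_apply, smul_eq_mul] at this
      rw [Matrix.of_apply, mul_comm, ← this]
      rfl
  intro k
  classical
  -- the end at which the component `j` is prescribed: the one from which its kernel stays bounded
  set c : ι → ℝ := fun j =>
    if ∀ x ∈ Set.Icc 0 b, ‖Complex.exp ((d j - d k) * x)‖ ≤ C then 0 else b with hcdef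
  have hcI : ∀ j, c j ∈ Set.Icc 0 b := by
    intro j
    simp only [hcdef]
    split_ifs
    · exact ⟨le_rfl, hb⟩
    · exact ⟨hb, le_rfl⟩
  have hker : ∀ j, ∀ x ∈ Set.Icc 0 b, ∀ t ∈ Set.uIcc (c j) x,
      ‖Complex.exp ((d j - d k) * (x - t))‖ ≤ C := by
    intro j x hx t ht
    simp only [hcdef] at ht
    split_ifs at ht with h
    · rw [Set.uIcc_of_le hx.1] at ht
      have := h (x - t) ⟨by linarith [ht.2], by linarith [ht.1, hx.2]⟩
      simpa using this
    · rw [Set.uIcc_of_ge hx.2] at ht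
      have := ((hdich j k).resolve_left h) (t - x) ⟨by linarith [ht.1], by linarith [ht.2, hx.1]⟩
      rw [← mul_neg] at this
      simpa using this
  set u : (ι → ℂ) → ℝ → ι → ℂ := fun a x j => Complex.exp (-d k * x) * (Ψ x).mulVec a j with hu
  have hu0 : ∀ a, u a 0 = a := by
    intro a; ext j; simp [hu, hΨ0]
  have hsol : ∀ a, SolvesOn (fun t => Matrix.diagonal d + R t) 0 b (fun x => (Ψ x).mulVec a) :=
    fun a => SolvesOn.mulVec_const hΨ a
  have huc : ∀ a, ContinuousOn (u a) (Set.Icc 0 b) := by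
    intro a
    refine continuousOn_pi.2 fun j => ContinuousOn.mul (by fun_prop) ?_
    have := (hsol a j).1.continuousOn
    rwa [Set.uIcc_of_le hb] at this
  have hmax : ∀ a, ∃ S, (∃ x ∈ Set.Icc 0 b, ‖u a x‖ = S) ∧ ∀ x ∈ Set.Icc 0 b, ‖u a x‖ ≤ S := by
    intro a
    obtain ⟨x, hx, hm⟩ := isCompact_Icc.exists_isMaxOn (Set.nonempty_Icc.2 hb) (huc a).norm
    exact ⟨_, ⟨x, hx, rfl⟩, fun y hy => hm hy⟩
  have hest : ∀ a S, (∀ x ∈ Set.Icc 0 b, ‖u a x‖ ≤ S) → ∀ x ∈ Set.Icc 0 b, ∀ j,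
      ‖u a x j - Complex.exp ((d j - d k) * (x - c j)) * u a (c j) j‖ ≤ C * ε * S := by
    intro a S hS x hx j
    have := norm_sub_exp_mul_le hR hC (hsol a) (d k)
      (fun t ht j => (norm_le_pi_norm (u a t) j).trans (hS t ht)) hx (hcI j) j (hker j x hx)
    calc _ ≤ _ := this
      _ = _ := by ring
  let Λ : (ι → ℂ) →ₗ[ℂ] (ι → ℂ) :=
    { toFun := fun a j => (Ψ (c j)).mulVec a j
      map_add' := fun a a' => by ext j; simp [Matrix.mulVec_add]
      map_smul' := fun r a => by ext j; simp [Matrix.mulVec_smul] }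
  have hinj : Function.Injective Λ := by
    rw [← LinearMap.ker_eq_bot, LinearMap.ker_eq_bot']
    intro a ha
    obtain ⟨S, ⟨x, hx, hxS⟩, hS⟩ := hmax a
    have h0 : ∀ j, u a (c j) j = 0 := fun j => by
      have : (Ψ (c j)).mulVec a j = 0 := congrFun ha j
      simp [hu, this]
    have hS0 : 0 ≤ S := hxS ▸ norm_nonneg _
    have h1 : S ≤ C * ε * S := by
      rw [← hxS]
      refine (pi_norm_le_iff_of_nonneg ?_).2 fun j => ?_
      · rw [hxS]
        have : 0 ≤ ε := intervalIntegral.integral_nonneg hb fun t _ => entrySum_nonneg _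
        positivity
      · have := hest a S hS x hx j
        rw [h0 j, mul_zero, sub_zero] at this
        rwa [hxS]
    have h2 : S ≤ 0 := by nlinarith
    have h3 := hS 0 ⟨le_rfl, hb⟩
    rw [hu0] at h3
    exact norm_le_zero_iff.1 (h3.trans h2)
  obtain ⟨a, ha⟩ := (LinearMap.injective_iff_surjective.1 hinj) (Pi.single k 1)
  have hε0 : 0 ≤ ε := intervalIntegral.integral_nonneg hb fun t _ => entrySum_nonneg _
  have hck : c k = 0 := by
    have : ∀ x ∈ Set.Icc 0 b, ‖Complex.exp ((d k - d k) * (x : ℂ))‖ ≤ C := by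
      intro x hx
      rcases hdich k k with h | h
      · exact h x hx
      · simpa using h x hx
    simp only [hcdef]
    rw [if_pos this]
  have hbv : ∀ x : ℝ, ∀ j, Complex.exp ((d j - d k) * (x - c j)) * u a (c j) j =
      if j = k then 1 else 0 := by
    intro x j
    have h1 : (Ψ (c j)).mulVec a j = (Pi.single k 1 : ι → ℂ) j := congrFun ha j
    split_ifs with h
    · subst h
      rw [hck, Pi.single_eq_same] at h1
      simp [hu, h1, hck]
    · simp [hu, h1, h]
  obtain ⟨S, ⟨x₀, hx₀, hxS⟩, hS⟩ := hmax a
  have hS0 : 0 ≤ S := hxS ▸ norm_nonneg _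
  have hclose : ∀ x ∈ Set.Icc 0 b, ∀ j, ‖u a x j - if j = k then 1 else 0‖ ≤ C * ε * S := by
    intro x hx j
    have := hest a S hS x hx j
    rwa [hbv] at this
  have hS2 : S ≤ 2 := by
    have h1 : S ≤ 1 + C * ε * S := by
      rw [← hxS]
      refine (pi_norm_le_iff_of_nonneg (by positivity)).2 fun j => ?_
      have h2 := hclose x₀ hx₀ j
      rw [hxS]
      have h3 := norm_le_norm_add_norm_sub' (u a x₀ j) (if j = k then (1 : ℂ) else 0)
      have h4 : ‖(if j = k then (1 : ℂ) else 0)‖ ≤ 1 := by split_ifs <;> simp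
      linarith
    nlinarith
  have hfin : ∀ x ∈ Set.Icc 0 b, ∀ j, ‖u a x j - if j = k then 1 else 0‖ ≤ 2 * (C * ε) := by
    intro x hx j
    refine (hclose x hx j).trans ?_
    have : 0 ≤ C * ε := by positivity
    nlinarith
  refine ⟨u a 0, u a b, hfin 0 ⟨le_rfl, hb⟩, hfin b ⟨hb, le_rfl⟩, ?_⟩
  rw [hu0]
  ext j
  simp only [hu, Pi.smul_apply, smul_eq_mul]
  rw [← mul_assoc, ← Complex.exp_add]
  simp

end Dichotomy

section Asymptotics

/-- If `Ψ (1 + V₀) = (1 + V₁) D` with `V₀`, `V₁` small, then `Ψ` is similar to `(1 + E) D` with `E`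
small; the factor `1 + E` is the quotient of the two matrices `1 + V₁` and `1 + V₀`. -/
theorem exists_small_quotient {ι : Type*} [Fintype ι] [DecidableEq ι] {δ : ℝ} (hδ : 0 < δ) :
    ∃ η > 0, ∀ V₀ V₁ : Matrix ι ι ℂ, (∀ i j, ‖V₀ i j‖ ≤ η) → (∀ i j, ‖V₁ i j‖ ≤ η) →
      ∃ E : Matrix ι ι ℂ, (∀ i j, ‖E i j‖ ≤ δ) ∧ (1 + V₀) * (1 + E) = 1 + V₁ ∧
        (1 + V₀).det ≠ 0 := by
  let X := (ι → ι → ℂ) × (ι → ι → ℂ)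
  let F : X → Matrix ι ι ℂ := fun v =>
    ((1 + Matrix.of v.1).det)⁻¹ • ((1 + Matrix.of v.1).adjugate * (1 + Matrix.of v.2)) - 1
  have hM : Continuous fun v : X => (1 + Matrix.of v.1 : Matrix ι ι ℂ) :=
    continuous_const.add (continuous_fst : Continuous fun v : X => v.1)
  have hM' : Continuous fun v : X => (1 + Matrix.of v.2 : Matrix ι ι ℂ) :=
    continuous_const.add (continuous_snd : Continuous fun v : X => v.2)
  have hdet : Continuous fun v : X => (1 + Matrix.of v.1 : Matrix ι ι ℂ).det := hM.matrix_det
  have hF : ContinuousAt F 0 := by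
    refine ContinuousAt.sub (ContinuousAt.smul (hdet.continuousAt.inv₀ (by simp)) ?_)
      continuousAt_const
    exact (hM.matrix_adjugate.mul hM').continuousAt
  have hF0 : F 0 = 0 := by simp [F]
  have h1 : ∀ᶠ v in 𝓝 (0 : X), ∀ i j, ‖F v i j‖ < δ := by
    refine eventually_all.2 fun i => eventually_all.2 fun j => ?_
    have hc : ContinuousAt (fun v => ‖F v i j‖) 0 :=
      ((continuous_apply_apply i j).continuousAt.comp hF).norm
    refine hc.eventually_lt continuousAt_const ?_
    simpa [hF0] using hδ
  have h2 : ∀ᶠ v in 𝓝 (0 : X), (1 + Matrix.of v.1 : Matrix ι ι ℂ).det ≠ 0 :=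
    hdet.continuousAt.eventually_ne (by simp)
  obtain ⟨η, hη, hb⟩ := Metric.eventually_nhds_iff.1 (h1.and h2)
  refine ⟨η / 2, by positivity, fun V₀ V₁ hV₀ hV₁ => ?_⟩
  obtain ⟨h3, h4⟩ := hb (y := ((fun i j => V₀ i j, fun i j => V₁ i j) : X)) (by
    rw [dist_zero_right]
    refine lt_of_le_of_lt ?_ (half_lt_self hη)
    refine norm_prod_le_iff.2 ⟨?_, ?_⟩ <;>
      refine (pi_norm_le_iff_of_nonneg (by positivity)).2 fun i =>
        (pi_norm_le_iff_of_nonneg (by positivity)).2 fun j => ?_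
    · exact hV₀ i j
    · exact hV₁ i j)
  have h5 : (1 + V₀).det ≠ 0 := h4
  refine ⟨((1 + V₀).det)⁻¹ • ((1 + V₀).adjugate * (1 + V₁)) - 1, fun i j => (h3 i j).le, ?_, h5⟩
  rw [add_sub_cancel, Matrix.mul_smul, ← mul_assoc, Matrix.mul_adjugate, Matrix.smul_mul, smul_smul,
    inv_mul_cancel₀ h5, one_smul, one_mul]

theorem norm_eq_one_of_pow_eq {n : ℕ} (hn : 1 ≤ n) {κ : ℂ} (hκ : κ = 1 ∨ κ = -1) {w : ℂ}
    (hw : w ^ (2 * n) = κ * (-1) ^ n) : ‖w‖ = 1 := by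
  have h : ‖w‖ ^ (2 * n) = 1 := by
    rw [← norm_pow, hw, norm_mul, norm_pow, norm_neg, norm_one, one_pow, mul_one]
    rcases hκ with rfl | rfl <;> simp
  exact (pow_eq_one_iff_of_nonneg (norm_nonneg _) (by omega)).1 h

/-- Orthogonality of the powers of the roots of `x^N = c`: it inverts their Vandermonde matrix. -/
theorem sum_inv_mul_pow {N : ℕ} (hN : 0 < N) {a b c : ℂ} (ha : a ^ N = c) (hb : b ^ N = c)
    (hc : c ≠ 0) : ∑ j : Fin N, (a ^ (j : ℕ))⁻¹ * b ^ (j : ℕ) = if a = b then (N : ℂ) else 0 := by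
  have ha0 : a ≠ 0 := by
    rintro rfl
    rw [zero_pow hN.ne'] at ha
    exact hc ha.symm
  have e : ∀ j : Fin N, (a ^ (j : ℕ))⁻¹ * b ^ (j : ℕ) = (b / a) ^ (j : ℕ) := fun j => by
    rw [div_pow, div_eq_mul_inv, mul_comm]
  simp only [e]
  rw [Fin.sum_univ_eq_sum_range (fun j => (b / a) ^ j)]
  split_ifs with h
  · subst h
    simp [div_self ha0]
  · have h1 : b / a ≠ 1 := by
      rw [Ne, div_eq_one_iff_eq ha0]
      exact fun h' => h h'.symm
    rw [geom_sum_eq h1, div_pow, ha, hb, div_self hc, sub_self, zero_div]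

variable {n : ℕ} {p : Fin n → ℝ → ℝ}

/-- The exponentials `e^(z ω_j x)` and `e^(z ω_k x)` are comparable up to a constant, in one of the
two directions, uniformly for `z` in a horizontal strip of the right half-plane. -/
theorem norm_exp_dichotomy {a b z : ℂ} (ha : ‖a‖ = 1) (hb : ‖b‖ = 1) (hz : 0 ≤ z.re)
    (hz' : |z.im| ≤ 1) :
    (∀ x ∈ Set.Icc 0 Real.pi, ‖Complex.exp ((z * a - z * b) * x)‖ ≤ Real.exp (2 * Real.pi)) ∨
      (∀ x ∈ Set.Icc 0 Real.pi, ‖Complex.exp (-((z * a - z * b) * x))‖ ≤ Real.exp (2 * Real.pi)) := by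
  have him : |a.im - b.im| ≤ 2 := by
    have h1 := Complex.abs_im_le_norm (a - b)
    rw [Complex.sub_im] at h1
    have h2 := norm_sub_le a b
    rw [ha, hb] at h2
    linarith
  have h3 : |z.im * (a.im - b.im)| ≤ 2 := by
    rw [abs_mul]
    nlinarith [abs_nonneg z.im, abs_nonneg (a.im - b.im)]
  rw [abs_le] at h3
  have hre : ∀ x : ℝ, ((z * a - z * b) * x).re =
      (z.re * (a.re - b.re) - z.im * (a.im - b.im)) * x := by
    intro x
    simp only [Complex.mul_re, Complex.sub_re, Complex.mul_im, Complex.sub_im, Complex.ofReal_re,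
      Complex.ofReal_im]
    ring
  rcases le_total a.re b.re with h | h
  · left
    intro x hx
    rw [Complex.norm_exp, Real.exp_le_exp, hre]
    have h4 : z.re * (a.re - b.re) ≤ 0 := mul_nonpos_of_nonneg_of_nonpos hz (by linarith)
    nlinarith [hx.1, hx.2]
  · right
    intro x hx
    rw [Complex.norm_exp, Real.exp_le_exp, Complex.neg_re, hre]
    have h4 : 0 ≤ z.re * (a.re - b.re) := mul_nonneg hz (by linarith)
    nlinarith [hx.1, hx.2]

/-- Exponential coordinates: a constant change of basis brings the companion system at
`μ = κ z^(2n)` to diagonal form `z ω_j`, up to a perturbation of order `1 / |z|`. The order is `1 / |z|`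
because `L` has no term of order `2n - 1`. -/
theorem exists_exponential_coordinates (hn : 1 ≤ n) (hp : IsAdmissible n p) {κ : ℂ}
    (hκ : κ = 1 ∨ κ = -1) {ω : Fin (2 * n) → ℂ} (hωi : Function.Injective ω)
    (hω : ∀ k, ω k ^ (2 * n) = κ * (-1) ^ n) {z : ℂ} (hzn1 : 1 ≤ ‖z‖) :
    ∃ (B B' : Matrix (Fin (2 * n)) (Fin (2 * n)) ℂ) (R : ℝ → Matrix (Fin (2 * n)) (Fin (2 * n)) ℂ),
      B' * B = 1 ∧ LocInt R ∧
      (∀ t, B' * (companion n p t + (κ * z ^ (2 * n)) • companionParam n) =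
        (Matrix.diagonal (fun j => z * ω j) + R t) * B') ∧
      ∀ t, entrySum (R t) ≤ 2 * n * ‖z‖⁻¹ * ∑ k : Fin (2 * n), ‖lowerCoeff n p t k‖ := by
  have hω1 : ∀ k, ‖ω k‖ = 1 := fun k => norm_eq_one_of_pow_eq hn hκ (hω k)
  have hω0 : ∀ k, ω k ≠ 0 := fun k => by
    rw [← norm_ne_zero_iff, hω1]; exact one_ne_zero
  have hz0 : z ≠ 0 := by
    rw [← norm_ne_zero_iff]; linarith
  set μ := κ * z ^ (2 * n) with hμ
  set Q : ℝ → ℝ := fun t => ∑ k : Fin (2 * n), ‖lowerCoeff n p t k‖ with hQ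
  -- the columns of `B` are the derivatives at `0` of the exponentials `e^(z ω_i x)`
  set B : Matrix (Fin (2 * n)) (Fin (2 * n)) ℂ := Matrix.of fun j i => (z * ω i) ^ (j : ℕ) with hB
  set B' : Matrix (Fin (2 * n)) (Fin (2 * n)) ℂ :=
    Matrix.of fun i j => ((2 * n : ℕ) : ℂ)⁻¹ * ((z * ω i) ^ (j : ℕ))⁻¹ with hB'
  have hzω : ∀ i, (z * ω i) ^ (2 * n) = (-1) ^ n * μ := fun i => by
    rw [mul_pow, hω, hμ]; ring
  have hμ0 : (-1) ^ n * μ ≠ 0 := by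
    rw [← hzω ⟨0, by omega⟩]; exact pow_ne_zero _ (mul_ne_zero hz0 (hω0 _))
  have hB'B : B' * B = 1 := by
    ext i l
    rw [Matrix.mul_apply]
    simp only [hB, hB', Matrix.of_apply, mul_assoc, ← Finset.mul_sum]
    rw [sum_inv_mul_pow (by omega) (hzω i) (hzω l) hμ0, Matrix.one_apply]
    have : z * ω i = z * ω l ↔ i = l :=
      ⟨fun h => hωi (mul_left_cancel₀ hz0 h), fun h => by rw [h]⟩
    simp only [this]
    split_ifs
    · exact inv_mul_cancel₀ (by exact_mod_cast (by omega : 2 * n ≠ 0))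
    · simp
  have hBB' : B * B' = 1 := mul_eq_one_comm.1 hB'B
  set A : ℝ → Matrix (Fin (2 * n)) (Fin (2 * n)) ℂ :=
    fun t => companion n p t + μ • companionParam n with hA
  set AQ : ℝ → Matrix (Fin (2 * n)) (Fin (2 * n)) ℂ := fun t => Matrix.of fun i k =>
    if (i : ℕ) + 1 < 2 * n then 0 else -((-1) ^ n * lowerCoeff n p t k) with hAQ
  set R : ℝ → Matrix (Fin (2 * n)) (Fin (2 * n)) ℂ := fun t => B' * AQ t * B with hR
  set d : Fin (2 * n) → ℂ := fun j => z * ω j with hd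
  have hAB : ∀ t, A t * B = B * Matrix.diagonal d + AQ t * B := by
    intro t
    ext i l
    have h1 := companion_mulVec (p := p) hn t μ (fun k => (z * ω l) ^ k) i
    have h2 : (A t * B) i l =
        (companion n p t + μ • companionParam n).mulVec (fun k => (z * ω l) ^ (k : ℕ)) i := rfl
    rw [h2, h1, Matrix.add_apply, Matrix.mul_diagonal, Matrix.mul_apply]
    simp only [hB, hAQ, Matrix.of_apply]
    split_ifs with h
    · simp [hd, pow_succ]
    · have e : (z * ω l) ^ (i : ℕ) * d l = (-1) ^ n * μ := by
        rw [← hzω l, hd, ← pow_succ]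
        congr 1
        have := i.2
        omega
      rw [e, pow_zero, mul_one, mul_sub, sub_eq_add_neg, Finset.mul_sum, ← Finset.sum_neg_distrib]
      congr 1
      exact Finset.sum_congr rfl fun k _ => by ring
  have hAB' : ∀ t, B' * A t = (Matrix.diagonal d + R t) * B' := by
    intro t
    have h1 : B' * (A t * B) * B' = B' * A t := by
      rw [← mul_assoc, mul_assoc (B' * A t), hBB', mul_one]
    rw [← h1, hAB, mul_add, ← mul_assoc, hB'B, one_mul, hR]
    simp only [mul_assoc]
  -- the coefficients of `L` enter only the last equation of the system, and only with derivatives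
  -- of order at most `2n - 2`, so one power of `z` is left over
  have hlast : ∀ t i l, R t i l = ∑ k : Fin (2 * n), B' i ⟨2 * n - 1, by omega⟩ *
      (-((-1) ^ n * lowerCoeff n p t k)) * B k l := by
    intro t i l
    rw [hR]
    simp only [Matrix.mul_apply]
    refine Finset.sum_congr rfl fun k _ => ?_
    congr 1
    rw [Finset.sum_eq_single (⟨2 * n - 1, by omega⟩ : Fin (2 * n))]
    · simp only [hAQ, Matrix.of_apply]
      rw [if_neg (by omega)]
    · intro j _ hj
      have : (j : ℕ) ≠ 2 * n - 1 := fun h => hj (Fin.ext h)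
      have := j.2
      simp only [hAQ, Matrix.of_apply]
      rw [if_pos (by omega), mul_zero]
    · simp
  have hRi : LocInt R := by
    intro i l a b
    have e : (fun t => R t i l) = ∑ k : Fin (2 * n), fun t =>
        (B' i ⟨2 * n - 1, by omega⟩ * (-(-1) ^ n) * B k l) * lowerCoeff n p t k := by
      ext t
      rw [hlast, Finset.sum_apply]
      exact Finset.sum_congr rfl fun k _ => by ring
    rw [e]
    exact IntervalIntegrable.sum _ fun k _ => (intervalIntegrable_lowerCoeff hp k a b).const_mul _
  have hRb : ∀ t i l, ‖R t i l‖ ≤ ((2 * n : ℕ) : ℝ)⁻¹ * ‖z‖⁻¹ * Q t := by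
    intro t i l
    rw [hlast, hQ, Finset.mul_sum]
    refine norm_sum_le_of_le _ fun k _ => ?_
    rcases Nat.lt_or_ge (k : ℕ) (2 * n - 1) with hk | hk
    · simp only [hB, hB', Matrix.of_apply, norm_mul, norm_neg, norm_pow, norm_inv, norm_one, one_pow,
        one_mul, hω1, mul_one, Complex.norm_natCast]
      have h1 : (‖z‖ ^ (2 * n - 1))⁻¹ * ‖z‖ ^ (k : ℕ) ≤ ‖z‖⁻¹ := by
        have hzp : 0 < ‖z‖ := by linarith
        rw [inv_mul_le_iff₀ (by positivity)]
        obtain ⟨m, hm⟩ : ∃ m, 2 * n - 1 = m + 1 := ⟨2 * n - 2, by omega⟩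
        rw [hm, pow_succ, mul_assoc, mul_inv_cancel₀ hzp.ne', mul_one]
        exact pow_le_pow_right₀ hzn1 (by omega)
      calc _ = ((2 * n : ℕ) : ℝ)⁻¹ * ((‖z‖ ^ (2 * n - 1))⁻¹ * ‖z‖ ^ (k : ℕ)) *
            ‖lowerCoeff n p t k‖ := by ring
        _ ≤ _ := by gcongr
    · rw [lowerCoeff_eq_zero hk]; simp
  have hRs : ∀ t, entrySum (R t) ≤ 2 * n * ‖z‖⁻¹ * Q t := by
    intro t
    calc entrySum (R t) ≤ ∑ _i : Fin (2 * n), ∑ _j : Fin (2 * n),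
          ((2 * n : ℕ) : ℝ)⁻¹ * ‖z‖⁻¹ * Q t :=
          Finset.sum_le_sum fun i _ => Finset.sum_le_sum fun j _ => hRb t i j
      _ = _ := by
          have : (n : ℝ) ≠ 0 := by exact_mod_cast (by omega : n ≠ 0)
          simp only [Finset.sum_const, Finset.card_univ, Fintype.card_fin, nsmul_eq_mul]
          push_cast
          field_simp
  exact ⟨B, B', R, hB'B, hRi, hAB', hRs⟩

/-- Far out in a horizontal strip around the positive half-line, the monodromy matrix at
`μ = κ z^(2n)` is similar to a small multiplicative perturbation of `diag (e^(z ω_j π))`. -/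
theorem exists_charDet_eq_det (hn : 1 ≤ n) (hp : IsAdmissible n p) {κ : ℂ} (hκ : κ = 1 ∨ κ = -1)
    {ω : Fin (2 * n) → ℂ} (hωi : Function.Injective ω)
    (hω : ∀ k, ω k ^ (2 * n) = κ * (-1) ^ n) {δ : ℝ} (hδ : 0 < δ) :
    ∃ X : ℝ, 1 ≤ X ∧ ∀ z : ℂ, X ≤ z.re → |z.im| ≤ 1 →
      ∃ E : Matrix (Fin (2 * n)) (Fin (2 * n)) ℂ, (∀ i j, ‖E i j‖ ≤ δ) ∧
        ∀ ρ, charDet n p (κ * z ^ (2 * n)) ρ =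
          ((1 + E) * Matrix.diagonal (fun j => Complex.exp (z * ω j * Real.pi)) - ρ • 1).det := by
  obtain ⟨η, hη, hE⟩ := exists_small_quotient (ι := Fin (2 * n)) hδ
  obtain ⟨Φ, hΦ0, hΦ, -, hU⟩ := exists_fundamentalMatrix_companion hn hp
  have hω1 : ∀ k, ‖ω k‖ = 1 := fun k => norm_eq_one_of_pow_eq hn hκ (hω k)
  set Q : ℝ → ℝ := fun t => ∑ k : Fin (2 * n), ‖lowerCoeff n p t k‖ with hQ
  have hQi : IntervalIntegrable Q volume 0 Real.pi := by
    simpa only [hQ, Finset.sum_fn] using IntervalIntegrable.sum (μ := volume) (a := 0)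
      (b := Real.pi) Finset.univ (f := fun (k : Fin (2 * n)) t => ‖lowerCoeff n p t k‖)
      fun k _ => (intervalIntegrable_lowerCoeff hp k 0 Real.pi).norm
  have hQ0 : ∀ t, 0 ≤ Q t := fun t => Finset.sum_nonneg fun _ _ => norm_nonneg _
  have hIQ : 0 ≤ ∫ t in (0 : ℝ)..Real.pi, Q t :=
    intervalIntegral.integral_nonneg Real.pi_pos.le fun t _ => hQ0 t
  set C := Real.exp (2 * Real.pi) with hC
  have hC0 : 0 < C := Real.exp_pos _
  set K : ℝ := C * (2 * n * ∫ t in (0 : ℝ)..Real.pi, Q t) with hK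
  have hK0 : 0 ≤ K := by positivity
  refine ⟨max 1 (max (2 * K) (2 * K / η)), le_max_left _ _, fun z hzX hzi => ?_⟩
  have hz1 : 1 ≤ z.re := (le_max_left _ _).trans hzX
  have hzK : 2 * K ≤ z.re := ((le_max_left _ _).trans (le_max_right _ _)).trans hzX
  have hzη : 2 * K / η ≤ z.re := ((le_max_right _ _).trans (le_max_right _ _)).trans hzX
  have hznorm : z.re ≤ ‖z‖ := Complex.re_le_norm z
  have hzn1 : 1 ≤ ‖z‖ := hz1.trans hznorm
  set μ := κ * z ^ (2 * n) with hμ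
  obtain ⟨B, B', R, hB'B, hRi, hAB', hRs⟩ := exists_exponential_coordinates hn hp hκ hωi hω hzn1
  set d : Fin (2 * n) → ℂ := fun j => z * ω j with hd
  have hRint : C * ∫ t in (0 : ℝ)..Real.pi, entrySum (R t) ≤ K / ‖z‖ := by
    have h1 : ∫ t in (0 : ℝ)..Real.pi, entrySum (R t) ≤
        ∫ t in (0 : ℝ)..Real.pi, 2 * n * ‖z‖⁻¹ * Q t :=
      intervalIntegral.integral_mono Real.pi_pos.le (hRi.intervalIntegrable_entrySum _ _)
        (hQi.const_mul _) hRs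
    rw [intervalIntegral.integral_const_mul] at h1
    calc _ ≤ C * (2 * n * ‖z‖⁻¹ * ∫ t in (0 : ℝ)..Real.pi, Q t) :=
          mul_le_mul_of_nonneg_left h1 hC0.le
      _ = _ := by rw [hK]; ring
  have hzp : 0 < ‖z‖ := by linarith
  have hε1 : K / ‖z‖ ≤ 1 / 2 := by
    rw [div_le_iff₀ hzp]; linarith
  have hε2 : 2 * (K / ‖z‖) ≤ η := by
    rw [← mul_div_assoc, div_le_iff₀ hzp]
    rw [div_le_iff₀ hη] at hzη
    nlinarith
  -- the fundamental matrix in exponential coordinates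
  set Ψ : ℝ → Matrix (Fin (2 * n)) (Fin (2 * n)) ℂ := fun x => B' * Φ μ x * B with hΨ
  have hΨ0 : Ψ 0 = 1 := by
    rw [hΨ]; simp only [hΦ0, mul_one, hB'B]
  have hΨs : ∀ j, SolvesOn (fun t => Matrix.diagonal d + R t) 0 Real.pi (fun x i => Ψ x i j) := by
    intro j
    have h1 := (SolvesOn.mulVec_const (fun j => hΦ μ j 0 Real.pi) (fun i => B i j)).linear B' hAB'
    convert h1 using 1
    ext x i
    rw [Matrix.mulVec_mulVec]
    rfl
  obtain ⟨V₀, V₁, hV₀, hV₁, hV⟩ := exists_fundamentalMatrix_eq_mul_exp hRi Real.pi_pos.le hC0.le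
    (fun j k => norm_exp_dichotomy (hω1 j) (hω1 k) (by linarith) hzi) (hRint.trans hε1) hΨ0 hΨs
  have hsm : 2 * (C * ∫ t in (0 : ℝ)..Real.pi, entrySum (R t)) ≤ η := by linarith
  obtain ⟨E, hEb, hEe, hdet⟩ := hE V₀ V₁ (fun i j => (hV₀ i j).trans hsm)
    (fun i j => (hV₁ i j).trans hsm)
  refine ⟨E, hEb, fun ρ => ?_⟩
  have e1 : charDet n p μ ρ = (Ψ Real.pi - ρ • 1).det := by
    have e2 : monodromy n p μ - ρ • 1 = (Φ μ Real.pi - ρ • 1).transpose := by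
      rw [hU]; simp
    have e3 : Ψ Real.pi - ρ • 1 = B' * (Φ μ Real.pi - ρ • 1) * B := by
      rw [mul_sub, sub_mul, hΨ, Matrix.mul_smul, mul_one, Matrix.smul_mul, hB'B]
    rw [charDet, e2, Matrix.det_transpose, e3, Matrix.det_mul, Matrix.det_mul, mul_right_comm,
      ← Matrix.det_mul, hB'B, Matrix.det_one, one_mul]
  rw [e1]
  have e4 : (Ψ Real.pi - ρ • 1) * (1 + V₀) = (1 + V₀) *
      ((1 + E) * Matrix.diagonal (fun j => Complex.exp (z * ω j * Real.pi)) - ρ • 1) := by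
    rw [sub_mul, hV, mul_sub, ← mul_assoc, hEe, Matrix.smul_mul, Matrix.mul_smul, one_mul, mul_one]
  have e5 := congrArg Matrix.det e4
  rw [Matrix.det_mul, Matrix.det_mul, mul_comm] at e5
  exact mul_left_cancel₀ hdet e5

end Asymptotics

/-! ### Continuous selection of roots along a path of polynomials -/

section RootSelection

variable {ι : Type*} [Fintype ι]

theorem exists_perm_of_prod_sub_eq {r s : ι → ℂ} (h : ∀ x, ∏ k, (x - r k) = ∏ k, (x - s k)) :
    ∃ σ : Equiv.Perm ι, r = s ∘ σ := by
  have hp : (∏ k, (Polynomial.X - Polynomial.C (r k))) =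
      ∏ k, (Polynomial.X - Polynomial.C (s k)) :=
    Polynomial.funext fun x => by simpa [Polynomial.eval_prod] using h x
  have h2 := congrArg Polynomial.roots hp
  rw [Polynomial.roots_prod _ _ (Finset.prod_ne_zero_iff.2 fun k _ => Polynomial.X_sub_C_ne_zero _),
    Polynomial.roots_prod _ _
      (Finset.prod_ne_zero_iff.2 fun k _ => Polynomial.X_sub_C_ne_zero _)] at h2
  simp only [Polynomial.roots_X_sub_C, Multiset.bind_singleton] at h2
  classical
  have hcard : ∀ c, Fintype.card {k // r k = c} = Fintype.card {k // s k = c} := by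
    intro c
    have h3 := congrArg (Multiset.count c) h2
    rw [Multiset.count_map, Multiset.count_map] at h3
    rw [Fintype.card_subtype, Fintype.card_subtype]
    simp only [Finset.card, Finset.filter_val, eq_comm (b := c)]
    exact h3
  let σ : Equiv.Perm ι := Equiv.ofFiberEquiv fun c => Fintype.equivOfCardEq (hcard c)
  exact ⟨σ, funext fun k => (Equiv.ofFiberEquiv_map (g := s) _ k).symm⟩

theorem exists_map_univ_eq {α : Type*} (m : Multiset α) (hm : Multiset.card m = Fintype.card ι) :
    ∃ s : ι → α, Finset.univ.val.map s = m := by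
  have hlen : Fintype.card ι = m.toList.length := by rw [Multiset.length_toList, hm]
  let e : ι ≃ Fin m.toList.length := (Fintype.equivFin ι).trans (finCongr hlen)
  refine ⟨m.toList.get ∘ e, ?_⟩
  rw [← Multiset.map_map, Multiset.map_univ_val_equiv, Fin.univ_val_map, List.ofFn_get,
    Multiset.coe_toList]

/-- Near a given parameter, every enumeration of the roots is close to a rearrangement of a fixed
enumeration of the roots at that parameter. -/
theorem exists_perm_near {P : ℝ → ℂ → ℂ} (hP : ∀ x, Continuous fun t => P t x)
    (hb : ∀ T : ℝ, ∃ M : ℝ, ∀ t, |t| ≤ T → ∀ x, P t x = 0 → ‖x‖ ≤ M) {t₀ : ℝ} {s₀ : ι → ℂ}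
    (hs₀ : ∀ x, P t₀ x = ∏ k, (x - s₀ k)) {ε : ℝ} (hε : 0 < ε) :
    ∃ δ > 0, ∀ t, |t - t₀| < δ → ∀ s : ι → ℂ, (∀ x, P t x = ∏ k, (x - s k)) →
      ∃ σ : Equiv.Perm ι, ∀ k, ‖s k - s₀ (σ k)‖ < ε := by
  by_contra hcon
  push Not at hcon
  have hpos : ∀ m : ℕ, (0 : ℝ) < 1 / ((m : ℝ) + 1) := fun m => by positivity
  choose t ht s hs hno using fun m : ℕ => hcon (1 / ((m : ℝ) + 1)) (hpos m)
  have htt : Tendsto t atTop (𝓝 t₀) := by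
    rw [tendsto_iff_dist_tendsto_zero]
    exact squeeze_zero (fun _ => dist_nonneg) (fun m => (ht m).le)
      tendsto_one_div_add_atTop_nhds_zero_nat
  obtain ⟨M, hM⟩ := hb (|t₀| + 1)
  have hmem : ∀ m, s m ∈ Set.pi Set.univ fun _ : ι => Metric.closedBall (0 : ℂ) M := by
    intro m k _
    rw [mem_closedBall_zero_iff]
    refine hM (t m) ?_ _ ?_
    · have h1 : |t m - t₀| < 1 := (ht m).trans_le (by
        rw [div_le_one (by positivity)]
        linarith [Nat.cast_nonneg (α := ℝ) m])
      have := abs_sub_abs_le_abs_sub (t m) t₀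
      linarith
    · rw [hs]
      exact Finset.prod_eq_zero (Finset.mem_univ k) (sub_self _)
  obtain ⟨a, -, φ, hφ, hlim⟩ :=
    (isCompact_univ_pi fun _ : ι => isCompact_closedBall (0 : ℂ) M).tendsto_subseq hmem
  have ha : ∀ x, ∏ k, (x - a k) = ∏ k, (x - s₀ k) := by
    intro x
    rw [← hs₀]
    have h1 : Tendsto (fun m => P (t (φ m)) x) atTop (𝓝 (P t₀ x)) :=
      ((hP x).tendsto t₀).comp (htt.comp hφ.tendsto_atTop)
    have h2 : Tendsto (fun m => P (t (φ m)) x) atTop (𝓝 (∏ k, (x - a k))) := by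
      simp only [hs]
      exact tendsto_finsetProd _ fun k _ =>
        tendsto_const_nhds.sub ((tendsto_pi_nhds.1 hlim) k)
    exact tendsto_nhds_unique h2 h1
  obtain ⟨σ, hσ⟩ := exists_perm_of_prod_sub_eq ha
  obtain ⟨m, hm⟩ := (Metric.tendsto_atTop.1 hlim ε hε)
  obtain ⟨k, hk⟩ := hno (φ m) σ
  have h3 := hm m le_rfl
  rw [dist_eq_norm] at h3
  have h4 := (norm_le_pi_norm ((s ∘ φ) m - a) k).trans_lt h3
  rw [hσ] at h4
  exact absurd hk (not_le.2 h4)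

/-- Consecutive enumerations along a sequence of parameters, each matched optimally with its
predecessor. -/
theorem exists_matched_sequence (S : ℕ → ι → ℂ) :
    ∃ g : ℕ → ι → ℂ, (∀ i, ∃ σ : Equiv.Perm ι, g i = S i ∘ σ) ∧
      ∀ i, ∀ σ τ : Equiv.Perm ι, ‖g (i + 1) - g i‖ ≤ ‖S (i + 1) ∘ σ - S i ∘ τ‖ := by
  classical
  choose best hbest using fun a s : ι → ℂ =>
    Finite.exists_min fun σ : Equiv.Perm ι => ‖s ∘ σ - a‖
  let g : ℕ → ι → ℂ := fun i => Nat.rec (S 0) (fun i a => S (i + 1) ∘ best a (S (i + 1))) i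
  have hg : ∀ i, ∃ σ : Equiv.Perm ι, g i = S i ∘ σ := by
    intro i
    cases i with
    | zero => exact ⟨1, rfl⟩
    | succ i => exact ⟨_, rfl⟩
  refine ⟨g, hg, fun i σ τ => ?_⟩
  obtain ⟨π, hπ⟩ := hg i
  have h1 : ‖g (i + 1) - g i‖ ≤ ‖S (i + 1) ∘ (π.trans (τ.symm.trans σ)) - g i‖ :=
    hbest (g i) (S (i + 1)) _
  refine h1.trans ?_
  refine (pi_norm_le_iff_of_nonneg (norm_nonneg _)).2 fun k => ?_
  have h2 := norm_le_pi_norm (S (i + 1) ∘ σ - S i ∘ τ) (τ.symm (π k))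
  rw [hπ]
  simpa using h2

theorem exists_continuous_roots {P : ℝ → ℂ → ℂ} (hP : ∀ x, Continuous fun t => P t x)
    (hb : ∀ T : ℝ, ∃ M : ℝ, ∀ t, |t| ≤ T → ∀ x, P t x = 0 → ‖x‖ ≤ M)
    (hs : ∀ t, ∃ s : ι → ℂ, ∀ x, P t x = ∏ k, (x - s k)) :
    ∃ r : ι → ℝ → ℂ, (∀ k, Continuous (r k)) ∧ ∀ t x, P t x = ∏ k, (x - r k t) := by
  choose S hS using hs
  -- the grid of mesh `1 / (m + 1)` starting at `-(m + 1)`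
  let τ : ℕ → ℕ → ℝ := fun m i => -((m : ℝ) + 1) + i / ((m : ℝ) + 1)
  let idx : ℕ → ℝ → ℕ := fun m t => ⌊(t + ((m : ℝ) + 1)) * ((m : ℝ) + 1)⌋₊
  choose g hgσ hgm using fun m => exists_matched_sequence fun i => S (τ m i)
  have hτ : ∀ t : ℝ, ∀ m : ℕ, |t| ≤ m → |τ m (idx m t) - t| ≤ 1 / ((m : ℝ) + 1) := by
    intro t m hm
    have hm1 : (0 : ℝ) < (m : ℝ) + 1 := by positivity
    have h0 : 0 ≤ (t + ((m : ℝ) + 1)) * ((m : ℝ) + 1) :=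
      mul_nonneg (by linarith [neg_abs_le t]) hm1.le
    have h1 := Nat.floor_le h0
    have h2 := Nat.lt_floor_add_one ((t + ((m : ℝ) + 1)) * ((m : ℝ) + 1))
    have e : τ m (idx m t) - t =
        ((idx m t : ℝ) - (t + ((m : ℝ) + 1)) * ((m : ℝ) + 1)) / ((m : ℝ) + 1) := by
      simp only [τ]; field_simp; ring
    rw [e, abs_div, abs_of_pos hm1]
    gcongr
    rw [abs_le]
    exact ⟨by linarith, by linarith⟩
  have hidx : ∀ m, Monotone (idx m) := fun m a b hab =>
    Nat.floor_le_floor (by gcongr)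
  have hτm : ∀ m, Monotone (τ m) := fun m a b hab => by
    simp only [τ]; gcongr
  have hτlim : ∀ t, Tendsto (fun m => τ m (idx m t)) atTop (𝓝 t) := by
    intro t
    rw [tendsto_iff_dist_tendsto_zero]
    refine squeeze_zero' (Eventually.of_forall fun _ => dist_nonneg) ?_
      (tendsto_one_div_add_atTop_nhds_zero_nat (𝕜 := ℝ))
    obtain ⟨M, hM⟩ := exists_nat_ge |t|
    filter_upwards [eventually_ge_atTop M] with m hm
    exact hτ t m (hM.trans (by exact_mod_cast hm))
  have hgP : ∀ m i x, P (τ m i) x = ∏ k, (x - g m i k) := by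
    intro m i x
    obtain ⟨σ, hσ⟩ := hgσ m i
    rw [hS, hσ]
    exact (Equiv.prod_comp σ fun k => x - S (τ m i) k).symm
  -- the selection is a limit along a nonprincipal ultrafilter
  have hlim : ∀ t, ∃ a : ι → ℂ, Tendsto (fun m => g m (idx m t)) (hyperfilter ℕ : Filter ℕ) (𝓝 a) := by
    intro t
    obtain ⟨M, hM⟩ := hb (|t| + 1)
    have hK := isCompact_univ_pi fun _ : ι => isCompact_closedBall (0 : ℂ) M
    have hev : ∀ᶠ m in (hyperfilter ℕ : Filter ℕ),
        g m (idx m t) ∈ Set.pi Set.univ fun _ : ι => Metric.closedBall (0 : ℂ) M := by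
      have h1 : ∀ᶠ m in atTop, |τ m (idx m t) - t| < 1 := by
        have := (Metric.tendsto_nhds.1 (hτlim t)) 1 one_pos
        simpa [Real.dist_eq] using this
      have h2 : ∀ᶠ m in (hyperfilter ℕ : Filter ℕ), |τ m (idx m t) - t| < 1 :=
        Nat.hyperfilter_le_atTop h1
      refine h2.mono fun m hm k _ => ?_
      rw [mem_closedBall_zero_iff]
      refine hM (τ m (idx m t)) ?_ _ ?_
      · have := abs_sub_abs_le_abs_sub (τ m (idx m t)) t
        linarith
      · rw [hgP]
        exact Finset.prod_eq_zero (Finset.mem_univ k) (sub_self _)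
    obtain ⟨a, -, ha⟩ := hK.ultrafilter_le_nhds ((hyperfilter ℕ).map fun m => g m (idx m t))
      (le_principal_iff.2 hev)
    exact ⟨a, ha⟩
  choose r hr using hlim
  have hrP : ∀ t x, P t x = ∏ k, (x - r t k) := by
    intro t x
    have h1 : Tendsto (fun m => P (τ m (idx m t)) x) (hyperfilter ℕ : Filter ℕ) (𝓝 (P t x)) :=
      ((hP x).tendsto t).comp ((hτlim t).mono_left Nat.hyperfilter_le_atTop)
    have h2 : Tendsto (fun m => P (τ m (idx m t)) x) (hyperfilter ℕ : Filter ℕ)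
        (𝓝 (∏ k, (x - r t k))) := by
      simp only [hgP]
      exact tendsto_finsetProd _ fun k _ =>
        tendsto_const_nhds.sub ((tendsto_pi_nhds.1 (hr t)) k)
    exact tendsto_nhds_unique h1 h2
  refine ⟨fun k t => r t k, fun k => ?_, hrP⟩
  rw [continuous_iff_continuousAt]
  intro t₀
  rw [Metric.continuousAt_iff]
  intro ε hε
  -- below the gap between distinct roots at `t₀`, a chain of small steps cannot change the root
  obtain ⟨γ, hγ, hgap⟩ : ∃ γ > 0, ∀ i j, r t₀ i ≠ r t₀ j → γ ≤ ‖r t₀ i - r t₀ j‖ := by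
    by_cases hne : (Finset.univ.filter fun ij : ι × ι => r t₀ ij.1 ≠ r t₀ ij.2).Nonempty
    · obtain ⟨ij, hij, hmin⟩ := Finset.exists_min_image _ (fun ij : ι × ι => ‖r t₀ ij.1 - r t₀ ij.2‖) hne
      rw [Finset.mem_filter] at hij
      refine ⟨_, norm_pos_iff.2 (sub_ne_zero.2 hij.2), fun i j hij' => ?_⟩
      exact hmin (i, j) (Finset.mem_filter.2 ⟨Finset.mem_univ _, hij'⟩)
    · refine ⟨1, one_pos, fun i j hij => ?_⟩
      exact absurd ⟨(i, j), Finset.mem_filter.2 ⟨Finset.mem_univ _, hij⟩⟩ hne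
  set η := min (ε / 3) (γ / 5) with hηdef
  have hη : 0 < η := lt_min (by positivity) (by positivity)
  have hηε : 2 * η < ε := by linarith [min_le_left (ε / 3) (γ / 5)]
  have hηγ : 4 * η < γ := by linarith [min_le_right (ε / 3) (γ / 5)]
  obtain ⟨δ, hδ, hnear⟩ := exists_perm_near hP hb (hrP t₀) hη
  have hstep : ∀ m i, |τ m i - t₀| < δ → |τ m (i + 1) - t₀| < δ →
      ‖g m (i + 1) k - g m i k‖ < 2 * η := by
    intro m i h1 h2
    obtain ⟨σ₁, hσ₁⟩ := hnear _ h1 (S (τ m i)) (hS _)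
    obtain ⟨σ₂, hσ₂⟩ := hnear _ h2 (S (τ m (i + 1))) (hS _)
    refine (norm_le_pi_norm (g m (i + 1) - g m i) k).trans_lt
      ((hgm m i σ₂.symm σ₁.symm).trans_lt ?_)
    refine (pi_norm_lt_iff (by positivity)).2 fun l => ?_
    have h3 := hσ₁ (σ₁.symm l)
    have h4 := hσ₂ (σ₂.symm l)
    rw [Equiv.apply_symm_apply] at h3 h4
    have h5 := norm_sub_le (S (τ m (i + 1)) (σ₂.symm l) - r t₀ l) (S (τ m i) (σ₁.symm l) - r t₀ l)
    rw [sub_sub_sub_cancel_right] at h5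
    simp only [Pi.sub_apply, Function.comp_apply]
    linarith
  have hchain : ∀ m i₀ i₁, i₀ ≤ i₁ → (∀ i, i₀ ≤ i → i ≤ i₁ → |τ m i - t₀| < δ) →
      ‖g m i₁ k - g m i₀ k‖ < 2 * η := by
    intro m i₀ i₁ h01 hall
    have hclose : ∀ i, i₀ ≤ i → i ≤ i₁ → ∃ l, ‖g m i k - r t₀ l‖ < η := by
      intro i h1 h2
      obtain ⟨σ, hσ⟩ := hnear _ (hall i h1 h2) (g m i) (hgP m i)
      exact ⟨σ k, hσ k⟩
    obtain ⟨l₀, hl₀⟩ := hclose i₀ le_rfl h01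
    have hind : ∀ i, i₀ ≤ i → i ≤ i₁ → ‖g m i k - r t₀ l₀‖ < η := by
      intro i hi
      induction i, hi using Nat.le_induction with
      | base => intro _; exact hl₀
      | succ i hi ih =>
        intro hi1
        obtain ⟨l, hl⟩ := hclose (i + 1) (by omega) hi1
        have h1 := ih (by omega)
        have h2 := hstep m i (hall i hi (by omega)) (hall (i + 1) (by omega) hi1)
        have h3 : r t₀ l = r t₀ l₀ := by
          by_contra hne
          have h4 := hgap l l₀ hne
          have h5 : r t₀ l - r t₀ l₀ = (g m (i + 1) k - g m i k) + (g m i k - r t₀ l₀) -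
            (g m (i + 1) k - r t₀ l) := by ring
          have h6 := norm_sub_le ((g m (i + 1) k - g m i k) + (g m i k - r t₀ l₀))
            (g m (i + 1) k - r t₀ l)
          have h7 := norm_add_le (g m (i + 1) k - g m i k) (g m i k - r t₀ l₀)
          rw [← h5] at h6
          linarith
        rwa [← h3]
    have h1 := hind i₁ h01 le_rfl
    have h2 := norm_sub_le (g m i₁ k - r t₀ l₀) (g m i₀ k - r t₀ l₀)
    rw [sub_sub_sub_cancel_right] at h2
    linarith
  refine ⟨δ / 2, by positivity, fun {t} ht => ?_⟩
  rw [Real.dist_eq] at ht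
  rw [dist_eq_norm]
  have hev : ∀ᶠ m in atTop, ‖g m (idx m t) k - g m (idx m t₀) k‖ ≤ 2 * η := by
    have e1 : ∀ᶠ m in atTop, |τ m (idx m t) - t| < δ / 2 := by
      simpa [Real.dist_eq] using (Metric.tendsto_nhds.1 (hτlim t)) (δ / 2) (by positivity)
    have e2 : ∀ᶠ m in atTop, |τ m (idx m t₀) - t₀| < δ / 2 := by
      simpa [Real.dist_eq] using (Metric.tendsto_nhds.1 (hτlim t₀)) (δ / 2) (by positivity)
    filter_upwards [e1, e2] with m h1 h2
    rw [abs_lt] at h1 h2 ht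
    rcases le_total t t₀ with h | h
    · rw [norm_sub_rev]
      refine (hchain m _ _ (hidx m h) fun i hi hi' => ?_).le
      have := hτm m hi
      have := hτm m hi'
      rw [abs_lt]
      constructor <;> linarith
    · refine (hchain m _ _ (hidx m h) fun i hi hi' => ?_).le
      have := hτm m hi
      have := hτm m hi'
      rw [abs_lt]
      constructor <;> linarith
  have hl : Tendsto (fun m => ‖g m (idx m t) k - g m (idx m t₀) k‖) (hyperfilter ℕ : Filter ℕ)
      (𝓝 ‖r t k - r t₀ k‖) :=
    (((tendsto_pi_nhds.1 (hr t)) k).sub ((tendsto_pi_nhds.1 (hr t₀)) k)).norm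
  exact (le_of_tendsto hl (Nat.hyperfilter_le_atTop hev)).trans_lt hηε

open scoped Matrix.Norms.Operator in
/-- The eigenvalues of a continuous path of matrices can be enumerated continuously. -/
theorem exists_continuous_eigenvalues [DecidableEq ι] {A : ℝ → Matrix ι ι ℂ} (hA : Continuous A) :
    ∃ r : ι → ℝ → ℂ, (∀ k, Continuous (r k)) ∧ ∀ t x, (A t - x • 1).det = ∏ k, (r k t - x) := by
  have hsign : ∀ t x, (A t - x • 1).det = (-1) ^ Fintype.card ι * (A t).charpoly.eval x := by
    intro t x
    rw [Matrix.eval_charpoly, ← neg_sub, Matrix.det_neg, Matrix.scalar_apply,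
      Matrix.smul_one_eq_diagonal]
  obtain ⟨r, hr, h⟩ := exists_continuous_roots (ι := ι) (P := fun t x => (A t).charpoly.eval x)
    (fun x => by
      simp only [Matrix.eval_charpoly]
      exact (continuous_const.sub hA).matrix_det) (fun T => by
      obtain ⟨M, hM⟩ := (isCompact_Icc (a := -T) (b := T)).exists_bound_of_continuousOn
        hA.continuousOn
      refine ⟨M * ‖(1 : Matrix ι ι ℂ)‖, fun t ht x hx => ?_⟩
      have h1 : x ∈ spectrum ℂ (A t) := by
        rw [Matrix.mem_spectrum_iff_isRoot_charpoly]
        exact hx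
      exact (spectrum.norm_le_norm_mul_of_mem h1).trans
        (mul_le_mul_of_nonneg_right (hM t (abs_le.1 ht)) (norm_nonneg _))) (fun t => by
      have hsp := IsAlgClosed.splits (A t).charpoly
      have hcard : Multiset.card (A t).charpoly.roots = Fintype.card ι := by
        rw [← hsp.natDegree_eq_card_roots, Matrix.charpoly_natDegree_eq_dim]
      obtain ⟨s, hs⟩ := exists_map_univ_eq (ι := ι) _ hcard
      refine ⟨s, fun x => ?_⟩
      rw [hsp.eval_eq_prod_roots_of_monic (Matrix.charpoly_monic _), ← hs, Multiset.map_map]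
      rfl)
  refine ⟨r, hr, fun t x => ?_⟩
  rw [hsign, h, ← Finset.card_univ, ← Finset.prod_const, ← Finset.prod_mul_distrib]
  exact Finset.prod_congr rfl fun k _ => by ring

end RootSelection

/-! ### Eigenvalues of multiplicative perturbations of diagonal matrices -/

section MultiplicativePerturbation

variable {ι : Type*} [Fintype ι] [DecidableEq ι]

/-- A Gershgorin theorem in multiplicative form: the radii of the discs are relative to their
centres, however different in size the diagonal entries are. -/
theorem exists_norm_sub_le_of_det_eq_zero {d : ι → ℂ} (hd : ∀ j, d j ≠ 0) {E : Matrix ι ι ℂ} {δ : ℝ}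
    (hE : ∀ i, ∑ j, ‖E i j‖ ≤ δ) {ρ : ℂ} (h : ((1 + E) * Matrix.diagonal d - ρ • 1).det = 0) :
    ∃ j, ‖ρ - d j‖ ≤ δ * ‖d j‖ := by
  obtain ⟨v, hv, hMv⟩ := Matrix.exists_mulVec_eq_zero_iff.2 h
  have : Nonempty ι := by
    by_contra hne
    rw [not_nonempty_iff] at hne
    exact hv (Subsingleton.elim _ _)
  obtain ⟨i, hi⟩ := Finite.exists_max fun j => ‖d j * v j‖
  have hw : d i * v i ≠ 0 := by
    intro h0
    refine hv (funext fun j => ?_)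
    have h1 := hi j
    rw [h0, norm_zero, norm_le_zero_iff] at h1
    exact (mul_eq_zero.1 h1).resolve_left (hd j)
  refine ⟨i, ?_⟩
  have h2 := congrFun hMv i
  rw [Matrix.sub_mulVec, ← Matrix.mulVec_mulVec, Matrix.add_mulVec, Matrix.one_mulVec,
    Matrix.smul_mulVec, Matrix.one_mulVec] at h2
  simp only [Pi.sub_apply, Pi.add_apply, Pi.smul_apply, Pi.zero_apply, smul_eq_mul,
    Matrix.mulVec_diagonal] at h2
  have h3 : (ρ - d i) * v i = E.mulVec (fun j => d j * v j) i := by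
    have e : (Matrix.diagonal d).mulVec v = fun j => d j * v j :=
      funext fun j => Matrix.mulVec_diagonal d v j
    rw [e] at h2
    linear_combination -h2
  have h4 : ‖E.mulVec (fun j => d j * v j) i‖ ≤ δ * ‖d i * v i‖ := by
    rw [Matrix.mulVec, dotProduct]
    calc _ ≤ ∑ j, ‖E i j‖ * ‖d i * v i‖ := norm_sum_le_of_le _ fun j _ => by
            rw [norm_mul]
            exact mul_le_mul_of_nonneg_left (hi j) (norm_nonneg _)
      _ ≤ _ := by
            rw [← Finset.sum_mul]
            exact mul_le_mul_of_nonneg_right (hE i) (norm_nonneg _)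
  rw [← h3, norm_mul, norm_mul, ← mul_assoc] at h4
  exact le_of_mul_le_mul_right h4 (norm_pos_iff.2 (mul_ne_zero_iff.1 hw).2)

/-- The eigenvalues of `(1 + E) diag d` are counted by the discs which contain them: along the
homotopy `(1 + s E) diag d` none of them can leave a union of discs separated from the others. -/
theorem exists_eigenvalues_near {d : ι → ℂ} (hd : ∀ j, d j ≠ 0) {E : Matrix ι ι ℂ} {δ : ℝ}
    (hE : ∀ i, ∑ j, ‖E i j‖ ≤ δ) :
    ∃ r : ι → ℂ, (∀ ρ, ((1 + E) * Matrix.diagonal d - ρ • 1).det = ∏ k, (r k - ρ)) ∧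
      ∀ J : Set ι, (∀ i ∈ J, ∀ j ∉ J, ∀ x, ‖x - d i‖ ≤ δ * ‖d i‖ → ¬ ‖x - d j‖ ≤ δ * ‖d j‖) →
        ∀ k ∈ J, ∃ i ∈ J, ‖r k - d i‖ ≤ δ * ‖d i‖ := by
  let A : ℝ → Matrix ι ι ℂ := fun s => (1 + (s : ℂ) • E) * Matrix.diagonal d
  have hA : Continuous A := by
    refine Continuous.mul (continuous_const.add ?_) continuous_const
    exact Complex.continuous_ofReal.smul continuous_const
  obtain ⟨r, hrc, hr⟩ := exists_continuous_eigenvalues hA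
  have h0 : ∀ x, ∏ k, (x - r k 0) = ∏ k, (x - d k) := by
    intro x
    have h1 := hr 0 x
    have h2 : (A 0 - x • 1).det = ∏ k, (d k - x) := by
      simp only [A, Complex.ofReal_zero, zero_smul, add_zero, one_mul]
      rw [Matrix.smul_one_eq_diagonal, Matrix.diagonal_sub, Matrix.det_diagonal]
    rw [h2] at h1
    have h3 : ∀ a : ι → ℂ, ∏ k, (x - a k) = (-1) ^ (Finset.univ : Finset ι).card * ∏ k, (a k - x) := by
      intro a
      rw [← Finset.prod_const, ← Finset.prod_mul_distrib]
      exact Finset.prod_congr rfl fun k _ => by ring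
    rw [h3, h3, h1]
  obtain ⟨σ, hσ⟩ := exists_perm_of_prod_sub_eq h0
  refine ⟨fun k => r (σ.symm k) 1, fun ρ => ?_, fun J hJ k hk => ?_⟩
  · have h1 := hr 1 ρ
    simp only [A, Complex.ofReal_one, one_smul] at h1
    rw [h1]
    exact (Equiv.prod_comp σ.symm fun k => r k 1 - ρ).symm
  · set f : ℝ → ℂ := r (σ.symm k) with hf
    have hf0 : f 0 = d k := by
      have := congrFun hσ (σ.symm k)
      simpa using this
    have hmem : ∀ s ∈ Set.Icc (0 : ℝ) 1, ∃ j, ‖f s - d j‖ ≤ δ * ‖d j‖ := by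
      intro s hs
      refine exists_norm_sub_le_of_det_eq_zero hd (E := (s : ℂ) • E) (fun i => ?_) ?_
      · refine (Finset.sum_le_sum fun j _ => ?_).trans (hE i)
        rw [Matrix.smul_apply, smul_eq_mul, norm_mul, Complex.norm_real, Real.norm_of_nonneg hs.1]
        exact mul_le_of_le_one_left (norm_nonneg _) hs.2
      · have h1 := hr s (f s)
        rw [Finset.prod_eq_zero (Finset.mem_univ (σ.symm k)) (sub_self _)] at h1
        exact h1
    have hδ : 0 ≤ δ := (Finset.sum_nonneg fun j _ => norm_nonneg _).trans (hE k)
    have hcl : ∀ K : Set ι, IsClosed (⋃ j ∈ K, Metric.closedBall (d j) (δ * ‖d j‖)) := fun K =>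
      (Set.toFinite K).isClosed_biUnion fun j _ => Metric.isClosed_closedBall
    have hpre : IsPreconnected (f '' Set.Icc 0 1) :=
      isPreconnected_Icc.image f (hrc _).continuousOn
    by_contra hno
    push Not at hno
    have hcov : f '' Set.Icc 0 1 ⊆ (⋃ j ∈ J, Metric.closedBall (d j) (δ * ‖d j‖)) ∪
        ⋃ j ∈ Jᶜ, Metric.closedBall (d j) (δ * ‖d j‖) := by
      rintro _ ⟨s, hs, rfl⟩
      obtain ⟨j, hj⟩ := hmem s hs
      by_cases hjJ : j ∈ J
      · exact Or.inl (Set.mem_biUnion hjJ (mem_closedBall_iff_norm.2 hj))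
      · exact Or.inr (Set.mem_biUnion (s := Jᶜ) hjJ (mem_closedBall_iff_norm.2 hj))
    obtain ⟨x, -, hx1, hx2⟩ := isPreconnected_closed_iff.1 hpre _ _ (hcl J) (hcl Jᶜ) hcov
      ⟨f 0, ⟨0, by simp, rfl⟩, Set.mem_biUnion hk (by
        rw [hf0]
        exact Metric.mem_closedBall_self (by positivity))⟩
      (by
        obtain ⟨j, hj⟩ := hmem 1 (by simp)
        refine ⟨f 1, ⟨1, by simp, rfl⟩, Set.mem_biUnion (x := j) (fun hjJ => ?_)
          (mem_closedBall_iff_norm.2 hj)⟩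
        exact absurd hj (not_le.2 (hno j hjJ)))
    obtain ⟨i, hi, hxi⟩ := Set.mem_iUnion₂.1 hx1
    obtain ⟨j, hj, hxj⟩ := Set.mem_iUnion₂.1 hx2
    exact hJ i hi j hj x (mem_closedBall_iff_norm.1 hxi) (mem_closedBall_iff_norm.1 hxj)

end MultiplicativePerturbation

/-! ### Double roots of a perturbed quadratic family -/

section DoubleRoots

theorem norm_deriv_le_of_bounded {f : ℂ → ℂ} {a x : ℂ} {r₀ r₁ s C : ℝ}
    (hf : DifferentiableOn ℂ f (Metric.ball a r₀)) (hr : r₁ < r₀)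
    (hC : ∀ y ∈ Metric.closedBall a r₁, ‖f y‖ ≤ C) (hs : 0 < s) (hx : dist x a + s ≤ r₁) :
    ‖deriv f x‖ ≤ C / s := by
  have hsub : Metric.closedBall x s ⊆ Metric.closedBall a r₁ :=
    Metric.closedBall_subset_closedBall' (by linarith)
  refine Complex.norm_deriv_le_of_forall_mem_sphere_norm_le hs ?_ fun z hz =>
    hC z (hsub (Metric.sphere_subset_closedBall hz))
  refine DifferentiableOn.diffContOnCl (hf.mono ?_)
  rw [closure_ball x hs.ne']
  exact hsub.trans (Metric.closedBall_subset_ball hr)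

theorem norm_sub_le_of_deriv_le {f : ℂ → ℂ} {a : ℂ} {r₀ r₁ C : ℝ}
    (hf : DifferentiableOn ℂ f (Metric.ball a r₀)) (hr : r₁ < r₀)
    (hC : ∀ y ∈ Metric.closedBall a r₁, ‖deriv f y‖ ≤ C) {x y : ℂ}
    (hx : x ∈ Metric.closedBall a r₁) (hy : y ∈ Metric.closedBall a r₁) :
    ‖f y - f x‖ ≤ C * ‖y - x‖ :=
  (convex_closedBall a r₁).norm_image_sub_le_of_norm_deriv_le
    (fun _ hz => hf.differentiableAt
      (Metric.isOpen_ball.mem_nhds (Metric.closedBall_subset_ball hr hz))) hC hx hy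

theorem abs_cos_sub_cos_le {x y M : ℝ} (hx : |x| ≤ M) (hy : |y| ≤ M) :
    |Real.cos x - Real.cos y| ≤ M * |x - y| := by
  have h := (convex_Icc (-M) M).norm_image_sub_le_of_norm_deriv_le (f := Real.cos) (C := M)
    (fun z _ => Real.differentiable_cos z) (fun _ hz => by
      rw [Real.deriv_cos, norm_neg, Real.norm_eq_abs]
      exact Real.abs_sin_le_abs.trans (abs_le.2 hz)) (abs_le.1 hy) (abs_le.1 hx)
  simpa using h

/-- Two double roots of the perturbed family `σ² - 2 cos (b t) σ + 1 + g` near `(0, 1)`: the value at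
`(t₁, σ₂)` is of second order in `t₁ - t₂`, with a small constant. -/
theorem norm_le_sq_of_double_roots {b δ ε : ℝ} (hb : 0 < b) (hδ : δ ≤ 1 / 8) (hε : 64 * ε ≤ 1)
    {g : ℂ → ℂ → ℂ}
    (hg₁ : ∀ σ ∈ Metric.ball (1 : ℂ) (1 / 2),
      DifferentiableOn ℂ (fun t => g t σ) (Metric.ball 0 1))
    (hg₂ : ∀ t ∈ Metric.ball (0 : ℂ) 1, DifferentiableOn ℂ (g t) (Metric.ball 1 (1 / 2)))
    (hgε : ∀ t ∈ Metric.ball (0 : ℂ) 1, ∀ σ ∈ Metric.ball (1 : ℂ) (1 / 2), ‖g t σ‖ ≤ ε)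
    {t₁ t₂ : ℝ} {σ₁ σ₂ : ℂ} (ht₁ : |t₁| ≤ δ) (ht₂ : |t₂| ≤ δ) (hσ₁ : ‖σ₁ - 1‖ ≤ δ)
    (hσ₂ : ‖σ₂ - 1‖ ≤ δ)
    (h₁ : σ₁ ^ 2 - 2 * Real.cos (b * t₁) * σ₁ + 1 + g t₁ σ₁ = 0)
    (h₁' : 2 * σ₁ - 2 * Real.cos (b * t₁) + deriv (g t₁) σ₁ = 0)
    (h₂' : 2 * σ₂ - 2 * Real.cos (b * t₂) + deriv (g t₂) σ₂ = 0) :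
    ‖σ₂ ^ 2 - 2 * Real.cos (b * t₁) * σ₂ + 1 + g t₁ σ₂‖ ≤
      2 * (2 * b ^ 2 * δ + 32 * ε) ^ 2 * (t₁ - t₂) ^ 2 := by
  have hε0 : 0 ≤ ε := (norm_nonneg _).trans (hgε 0 (by simp) 1 (by simp))
  have htb : ∀ {t : ℝ}, |t| ≤ δ → ((t : ℂ) ∈ Metric.closedBall (0 : ℂ) (1 / 2)) := by
    intro t ht
    rw [mem_closedBall_zero_iff, Complex.norm_real, Real.norm_eq_abs]; linarith
  have htb1 : ∀ {t : ℝ}, |t| ≤ δ → ((t : ℂ) ∈ Metric.ball (0 : ℂ) 1) := fun ht =>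
    Metric.closedBall_subset_ball (by norm_num) (htb ht)
  have hσb : ∀ {σ : ℂ}, ‖σ - 1‖ ≤ δ → σ ∈ Metric.closedBall (1 : ℂ) (1 / 8) := fun h =>
    mem_closedBall_iff_norm.2 (h.trans hδ)
  -- Lipschitz bound in `t`
  have hLt : ∀ σ ∈ Metric.ball (1 : ℂ) (1 / 2), ‖g t₁ σ - g t₂ σ‖ ≤ 4 * ε * |t₁ - t₂| := by
    intro σ hσ
    have h := norm_sub_le_of_deriv_le (hg₁ σ hσ) (r₁ := 1 / 2) (by norm_num) (C := 4 * ε)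
      (fun t ht => by
        have := norm_deriv_le_of_bounded (hg₁ σ hσ) (r₁ := 3 / 4) (s := 1 / 4) (C := ε) (x := t)
          (by norm_num) (fun y hy => hgε y (Metric.closedBall_subset_ball (by norm_num) hy) σ hσ)
          (by norm_num) (by rw [Metric.mem_closedBall] at ht; linarith)
        linarith) (htb ht₂) (htb ht₁)
    rwa [← Complex.ofReal_sub, Complex.norm_real, Real.norm_eq_abs] at h
  -- Lipschitz bound in `t` of the derivative in `σ`
  have hLtσ : ‖deriv (g t₁) σ₂ - deriv (g t₂) σ₂‖ ≤ 32 * ε * |t₁ - t₂| := by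
    have hd : ∀ {t : ℝ}, |t| ≤ δ → DifferentiableAt ℂ (g t) σ₂ := fun ht =>
      (hg₂ _ (htb1 ht)).differentiableAt (Metric.isOpen_ball.mem_nhds
        (Metric.closedBall_subset_ball (by norm_num) (hσb hσ₂)))
    have h := norm_deriv_le_of_bounded (f := fun σ => g t₁ σ - g t₂ σ) (x := σ₂)
      ((hg₂ _ (htb1 ht₁)).sub (hg₂ _ (htb1 ht₂))) (r₁ := 1 / 4) (s := 1 / 8) (by norm_num)
      (fun σ hσ => hLt σ (Metric.closedBall_subset_ball (by norm_num) hσ)) (by norm_num)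
      (by have := Metric.mem_closedBall.1 (hσb hσ₂); linarith)
    rw [deriv_fun_sub (hd ht₁) (hd ht₂)] at h
    linarith
  -- Lipschitz bound in `σ` of the derivative in `σ`
  have hg₂d : DifferentiableOn ℂ (deriv (g t₁)) (Metric.ball 1 (1 / 2)) :=
    (hg₂ _ (htb1 ht₁)).deriv Metric.isOpen_ball
  have hd1 : ∀ σ ∈ Metric.closedBall (1 : ℂ) (1 / 4), ‖deriv (g t₁) σ‖ ≤ 8 * ε := by
    intro σ hσ
    have := norm_deriv_le_of_bounded (hg₂ _ (htb1 ht₁)) (r₁ := 3 / 8) (s := 1 / 8) (C := ε) (x := σ)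
      (by norm_num) (fun y hy => hgε _ (htb1 ht₁) y (Metric.closedBall_subset_ball (by norm_num) hy))
      (by norm_num) (by rw [Metric.mem_closedBall] at hσ; linarith)
    linarith
  have hd2 : ∀ σ ∈ Metric.closedBall (1 : ℂ) (1 / 8), ‖deriv (deriv (g t₁)) σ‖ ≤ 64 * ε := by
    intro σ hσ
    have := norm_deriv_le_of_bounded hg₂d (r₁ := 1 / 4) (s := 1 / 8) (C := 8 * ε) (x := σ)
      (by norm_num) hd1 (by norm_num) (by rw [Metric.mem_closedBall] at hσ; linarith)
    linarith
  have hLσ : ∀ σ ∈ Metric.closedBall (1 : ℂ) (1 / 8),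
      ‖deriv (g t₁) σ - deriv (g t₁) σ₁‖ ≤ 64 * ε * ‖σ - σ₁‖ := fun σ hσ =>
    norm_sub_le_of_deriv_le hg₂d (by norm_num) hd2 (hσb hσ₁) hσ
  -- first order Taylor remainder in `σ`
  have hTay : ‖g t₁ σ₂ - g t₁ σ₁ - deriv (g t₁) σ₁ * (σ₂ - σ₁)‖ ≤ 64 * ε * ‖σ₂ - σ₁‖ ^ 2 := by
    have hdσ : ∀ σ ∈ Metric.closedBall (1 : ℂ) (1 / 8), DifferentiableAt ℂ (g t₁) σ := fun σ hσ =>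
      (hg₂ _ (htb1 ht₁)).differentiableAt (Metric.isOpen_ball.mem_nhds
        (Metric.closedBall_subset_ball (by norm_num) hσ))
    have h := ((convex_closedBall (1 : ℂ) (1 / 8)).inter
      (convex_closedBall σ₁ ‖σ₂ - σ₁‖)).norm_image_sub_le_of_norm_hasDerivWithin_le
      (f := fun σ => g t₁ σ - deriv (g t₁) σ₁ * σ)
      (f' := fun σ => deriv (g t₁) σ - deriv (g t₁) σ₁ * 1)
      (C := 64 * ε * ‖σ₂ - σ₁‖) (x := σ₁) (y := σ₂)
      (fun σ hσ => ((hdσ σ hσ.1).hasDerivAt.sub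
        ((hasDerivAt_id σ).const_mul _)).hasDerivWithinAt)
      (fun σ hσ => by
        rw [mul_one]
        refine (hLσ σ hσ.1).trans ?_
        have := mem_closedBall_iff_norm.1 hσ.2
        gcongr)
      ⟨hσb hσ₁, by simp⟩ ⟨hσb hσ₂, by simp [dist_eq_norm]⟩
    calc _ = ‖g t₁ σ₂ - deriv (g t₁) σ₁ * σ₂ - (g t₁ σ₁ - deriv (g t₁) σ₁ * σ₁)‖ := by
          congr 1; ring
      _ ≤ _ := h
      _ = _ := by ring
  have hcos : |Real.cos (b * t₁) - Real.cos (b * t₂)| ≤ b ^ 2 * δ * |t₁ - t₂| := by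
    have h := abs_cos_sub_cos_le (x := b * t₁) (y := b * t₂) (M := b * δ)
      (by rw [abs_mul, abs_of_pos hb]; gcongr) (by rw [abs_mul, abs_of_pos hb]; gcongr)
    rw [← mul_sub, abs_mul, abs_of_pos hb] at h
    linarith
  -- comparing the two equations for the derivative: the root moves at most at a small rate in `t`
  set A := ‖σ₂ - σ₁‖ with hA
  set T := |t₁ - t₂| with hT
  have hA0 : 0 ≤ A := norm_nonneg _
  have hT0 : 0 ≤ T := abs_nonneg _
  have hAT : A ≤ (2 * b ^ 2 * δ + 32 * ε) * T := by
    have e : 2 * (σ₂ - σ₁) = -2 * ((Real.cos (b * t₁) - Real.cos (b * t₂) : ℝ) : ℂ) -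
        (deriv (g t₁) σ₂ - deriv (g t₁) σ₁) + (deriv (g t₁) σ₂ - deriv (g t₂) σ₂) := by
      rw [Complex.ofReal_sub]
      linear_combination h₂' - h₁'
    have e2 : 2 * A = ‖2 * (σ₂ - σ₁)‖ := by rw [norm_mul]; simp [hA]
    have h1 := norm_add_le (-2 * ((Real.cos (b * t₁) - Real.cos (b * t₂) : ℝ) : ℂ) -
        (deriv (g t₁) σ₂ - deriv (g t₁) σ₁)) (deriv (g t₁) σ₂ - deriv (g t₂) σ₂)
    have h2 := norm_sub_le (-2 * ((Real.cos (b * t₁) - Real.cos (b * t₂) : ℝ) : ℂ))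
        (deriv (g t₁) σ₂ - deriv (g t₁) σ₁)
    have h3 : ‖-2 * ((Real.cos (b * t₁) - Real.cos (b * t₂) : ℝ) : ℂ)‖ =
        2 * |Real.cos (b * t₁) - Real.cos (b * t₂)| := by
      rw [norm_mul, Complex.norm_real, Real.norm_eq_abs]; simp
    have h4 := hLσ σ₂ (hσb hσ₂)
    rw [e] at e2
    nlinarith
  have e : σ₂ ^ 2 - 2 * Real.cos (b * t₁) * σ₂ + 1 + g t₁ σ₂ = (σ₂ - σ₁) ^ 2 +
      (g t₁ σ₂ - g t₁ σ₁ - deriv (g t₁) σ₁ * (σ₂ - σ₁)) := by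
    linear_combination h₁ + (σ₂ - σ₁) * h₁'
  rw [e]
  calc _ ≤ A ^ 2 + 64 * ε * A ^ 2 := (norm_add_le _ _).trans (by rw [norm_pow]; linarith)
    _ ≤ 2 * A ^ 2 := by nlinarith [sq_nonneg A]
    _ ≤ 2 * ((2 * b ^ 2 * δ + 32 * ε) * T) ^ 2 := by gcongr
    _ = _ := by rw [mul_pow, hT, sq_abs]; ring

/-- A function with positive second derivative cannot vanish at a point and be nonpositive on both
sides of it. -/
theorem not_nonpos_both_sides {k k₁ k₂ : ℝ → ℝ} {a b c : ℝ} (hab : a < b) (hbc : b < c)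
    (h1 : ∀ x ∈ Set.Icc a c, HasDerivAt k (k₁ x) x)
    (h2 : ∀ x ∈ Set.Icc a c, HasDerivAt k₁ (k₂ x) x) (hpos : ∀ x ∈ Set.Icc a c, 0 < k₂ x)
    (ha : k a ≤ 0) (hb : k b = 0) (hc : k c ≤ 0) : False := by
  obtain ⟨x, hx, hx'⟩ := exists_hasDerivAt_eq_slope k k₁ hab
    (fun x hx => (h1 x ⟨hx.1, hx.2.trans hbc.le⟩).continuousAt.continuousWithinAt)
    (fun x hx => h1 x ⟨hx.1.le, hx.2.le.trans hbc.le⟩)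
  obtain ⟨y, hy, hy'⟩ := exists_hasDerivAt_eq_slope k k₁ hbc
    (fun x hx => (h1 x ⟨hab.le.trans hx.1, hx.2⟩).continuousAt.continuousWithinAt)
    (fun x hx => h1 x ⟨hab.le.trans hx.1.le, hx.2.le⟩)
  have hxy : x < y := hx.2.trans hy.1
  have hsub : ∀ u ∈ Set.Icc x y, u ∈ Set.Icc a c := fun u hu =>
    ⟨hx.1.le.trans hu.1, hu.2.trans hy.2.le⟩
  obtain ⟨u, hu, hu'⟩ := exists_hasDerivAt_eq_slope k₁ k₂ hxy
    (fun x hx => (h2 x (hsub x hx)).continuousAt.continuousWithinAt)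
    (fun x hx => h2 x (hsub x (Set.Ioo_subset_Icc_self hx)))
  have p1 : 0 ≤ k₁ x := by
    rw [hx', hb]; exact div_nonneg (by linarith) (by linarith)
  have p2 : k₁ y ≤ 0 := by
    rw [hy', hb]; exact div_nonpos_of_nonpos_of_nonneg (by linarith) (by linarith)
  have p3 := hpos u (hsub u (Set.Ioo_subset_Icc_self hu))
  rw [hu'] at p3
  have p4 : (k₁ y - k₁ x) / (y - x) ≤ 0 :=
    div_nonpos_of_nonpos_of_nonneg (by linarith) (by linarith)
  linarith

/-- Under a small holomorphic perturbation `g`, the family `σ² - 2 cos (b t) σ + 1` has a double root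
near `1` for at most two real parameters `t` near `0`. -/
theorem not_three_double_roots {b : ℝ} (hb : 0 < b) :
    ∃ δ > 0, δ ≤ 1 / 8 ∧ ∃ ε > 0, ∀ g : ℂ → ℂ → ℂ,
      (∀ σ ∈ Metric.ball (1 : ℂ) (1 / 2),
        DifferentiableOn ℂ (fun t => g t σ) (Metric.ball 0 1)) →
      (∀ t ∈ Metric.ball (0 : ℂ) 1, DifferentiableOn ℂ (g t) (Metric.ball 1 (1 / 2))) →
      (∀ t ∈ Metric.ball (0 : ℂ) 1, ∀ σ ∈ Metric.ball (1 : ℂ) (1 / 2), ‖g t σ‖ ≤ ε) →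
      ∀ (t : Fin 3 → ℝ) (σ : Fin 3 → ℂ), t 0 < t 1 → t 1 < t 2 →
        (∀ i, |t i| ≤ δ) → (∀ i, ‖σ i - 1‖ ≤ δ) →
        (∀ i, σ i ^ 2 - 2 * Real.cos (b * t i) * σ i + 1 + g (t i) (σ i) = 0) →
        (∀ i, 2 * σ i - 2 * Real.cos (b * t i) + deriv (g (t i)) (σ i) = 0) → False := by
  set δ := min (1 / 8) (1 / (16 * b)) with hδdef
  set ε := min (1 / 64) (min (b / 256) (b ^ 2 / 128)) with hεdef
  have hδ : 0 < δ := lt_min (by norm_num) (by positivity)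
  have hδ1 : δ ≤ 1 / 8 := min_le_left _ _
  have hδ2 : b * δ ≤ 1 / 16 := by
    have : δ ≤ 1 / (16 * b) := min_le_right _ _
    rw [le_div_iff₀ (by positivity)] at this
    linarith
  have hε : 0 < ε := lt_min (by norm_num) (lt_min (by positivity) (by positivity))
  have hε1 : ε ≤ 1 / 64 := min_le_left _ _
  have hε2 : ε ≤ b / 256 := (min_le_right _ _).trans (min_le_left _ _)
  have hε3 : ε ≤ b ^ 2 / 128 := (min_le_right _ _).trans (min_le_right _ _)
  refine ⟨δ, hδ, hδ1, ε, hε, fun g hg₁ hg₂ hgε t σ h01 h12 ht hσ h h' => ?_⟩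
  set K := 2 * b ^ 2 * δ + 32 * ε with hK
  have hK0 : 0 ≤ K := by positivity
  have hKb : K ≤ b / 4 := by nlinarith
  have hσ1 : σ 1 ∈ Metric.ball (1 : ℂ) (1 / 2) :=
    mem_ball_iff_norm.2 ((hσ 1).trans_lt (by linarith))
  -- with `σ` frozen at the middle double root, the value at the outer parameters is at most
  -- quadratic in the distance, with a constant smaller than the curvature `b²` of `-2 cos (b t)`;
  -- subtracting the quadratic leaves a function of `t` with positive second derivative
  have hre : ∀ i, i ≠ 1 → (σ 1 ^ 2 - 2 * Real.cos (b * t i) * σ 1 + 1 + g (t i) (σ 1)).re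
      - 2 * K ^ 2 * (t i - t 1) ^ 2 ≤ 0 := by
    intro i _
    have h1 := norm_le_sq_of_double_roots hb hδ1 (by linarith) hg₁ hg₂ hgε (ht i) (ht 1) (hσ i)
      (hσ 1) (h i) (h' i) (h' 1)
    have h2 := Complex.re_le_norm (σ 1 ^ 2 - 2 * Real.cos (b * t i) * σ 1 + 1 + g (t i) (σ 1))
    linarith
  set f : ℂ → ℂ := fun s => g s (σ 1) with hf
  have hfd : DifferentiableOn ℂ f (Metric.ball 0 1) := hg₁ _ hσ1
  have hfd' : DifferentiableOn ℂ (deriv f) (Metric.ball 0 1) := hfd.deriv Metric.isOpen_ball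
  have hmem : ∀ x ∈ Set.Icc (t 0) (t 2), |x| ≤ δ := fun x hx => by
    have h0 := abs_le.1 (ht 0)
    have h2 := abs_le.1 (ht 2)
    exact abs_le.2 ⟨h0.1.trans hx.1, hx.2.trans h2.2⟩
  have hnorm : ∀ x : ℝ, |x| ≤ δ → (x : ℂ) ∈ Metric.ball (0 : ℂ) 1 := fun x hx => by
    rw [mem_ball_zero_iff, Complex.norm_real, Real.norm_eq_abs]; linarith
  refine not_nonpos_both_sides h01 h12
    (k := fun x : ℝ => (σ 1 ^ 2 - 2 * Complex.cos (b * x) * σ 1 + 1 + f x).re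
      - 2 * K ^ 2 * (x - t 1) ^ 2)
    (k₁ := fun x : ℝ => (2 * b * Complex.sin (b * x) * σ 1 + deriv f x).re
      - 4 * K ^ 2 * (x - t 1))
    (k₂ := fun x : ℝ => (2 * b ^ 2 * Complex.cos (b * x) * σ 1 + deriv (deriv f) x).re
      - 4 * K ^ 2) (fun x hx => ?_) (fun x hx => ?_) (fun x hx => ?_) ?_ ?_ ?_
  · have hx' := hnorm x (hmem x hx)
    have d1 : HasDerivAt (fun s : ℂ => σ 1 ^ 2 - 2 * Complex.cos (b * s) * σ 1 + 1 + f s)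
        (2 * b * Complex.sin (b * x) * σ 1 + deriv f x) (x : ℂ) := by
      have c1 : HasDerivAt (fun s : ℂ => Complex.cos (b * s)) (-Complex.sin (b * x) * (b * 1)) x :=
        ((hasDerivAt_id (x : ℂ)).const_mul (b : ℂ)).ccos
      refine (((((c1.const_mul 2).mul_const (σ 1)).const_sub (σ 1 ^ 2)).add_const 1).add
        (hfd.differentiableAt (Metric.isOpen_ball.mem_nhds hx')).hasDerivAt).congr_deriv ?_
      ring
    have d2 : HasDerivAt (fun s : ℝ => 2 * K ^ 2 * (s - t 1) ^ 2) (4 * K ^ 2 * (x - t 1)) x := by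
      refine ((((hasDerivAt_id x).sub_const (t 1)).pow 2).const_mul (2 * K ^ 2)).congr_deriv ?_
      simp; ring
    exact d1.real_of_complex.sub d2
  · have hx' := hnorm x (hmem x hx)
    have d1 : HasDerivAt (fun s : ℂ => 2 * b * Complex.sin (b * s) * σ 1 + deriv f s)
        (2 * b ^ 2 * Complex.cos (b * x) * σ 1 + deriv (deriv f) x) (x : ℂ) := by
      have c1 : HasDerivAt (fun s : ℂ => Complex.sin (b * s)) (Complex.cos (b * x) * (b * 1)) x :=
        ((hasDerivAt_id (x : ℂ)).const_mul (b : ℂ)).csin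
      refine (((c1.const_mul (2 * (b : ℂ))).mul_const (σ 1)).add
        (hfd'.differentiableAt (Metric.isOpen_ball.mem_nhds hx')).hasDerivAt).congr_deriv ?_
      ring
    have d2 : HasDerivAt (fun s : ℝ => 4 * K ^ 2 * (s - t 1)) (4 * K ^ 2) x := by
      refine (((hasDerivAt_id x).sub_const (t 1)).const_mul (4 * K ^ 2)).congr_deriv ?_
      simp
    exact d1.real_of_complex.sub d2
  · have hxδ := hmem x hx
    have b1 : ∀ s ∈ Metric.closedBall (0 : ℂ) (1 / 2), ‖deriv f s‖ ≤ 4 * ε := fun s hs => by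
      have := norm_deriv_le_of_bounded hfd (r₁ := 3 / 4) (s := 1 / 4) (C := ε) (x := s)
        (by norm_num) (fun y hy => hgε y (Metric.closedBall_subset_ball (by norm_num) hy) _ hσ1)
        (by norm_num) (by rw [Metric.mem_closedBall] at hs; linarith)
      linarith
    have b2 : ‖deriv (deriv f) x‖ ≤ 16 * ε := by
      have := norm_deriv_le_of_bounded hfd' (r₁ := 1 / 2) (s := 1 / 4) (C := 4 * ε) (x := x)
        (by norm_num) b1 (by norm_num)
        (by rw [dist_zero_right, Complex.norm_real, Real.norm_eq_abs]; linarith)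
      linarith
    have b3 : -(16 * ε) ≤ (deriv (deriv f) x).re := by
      have := Complex.abs_re_le_norm (deriv (deriv f) x)
      linarith [neg_abs_le (deriv (deriv f) x).re]
    have b4 : 1 / 2 ≤ Real.cos (b * x) := by
      have h1 := Real.one_sub_sq_div_two_le_cos (x := b * x)
      have h2 : |b * x| ≤ 1 / 16 := by
        rw [abs_mul, abs_of_pos hb]
        nlinarith
      have h3 : (b * x) ^ 2 ≤ (1 / 16) ^ 2 := sq_le_sq' (by linarith [(abs_le.1 h2).1]) (abs_le.1 h2).2
      linarith
    have b5 : 1 / 2 ≤ (σ 1).re := by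
      have h1 := Complex.abs_re_le_norm (σ 1 - 1)
      have h2 := hσ 1
      rw [Complex.sub_re, Complex.one_re] at h1
      linarith [neg_abs_le ((σ 1).re - 1)]
    have b6 : (2 * b ^ 2 * Complex.cos (b * x) * σ 1 : ℂ).re =
        2 * b ^ 2 * Real.cos (b * x) * (σ 1).re := by
      rw [← Complex.ofReal_mul, ← Complex.ofReal_cos]
      have : (2 * (b : ℂ) ^ 2 * (Real.cos (b * x) : ℝ) : ℂ) =
          ((2 * b ^ 2 * Real.cos (b * x) : ℝ) : ℂ) := by push_cast; ring
      rw [this, Complex.re_ofReal_mul]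
    simp only [Complex.add_re]
    rw [b6]
    have b7 : 1 / 4 ≤ Real.cos (b * x) * (σ 1).re := by nlinarith
    have b8 : K ^ 2 ≤ b ^ 2 / 16 := by nlinarith
    have hb2 : 0 < b ^ 2 := by positivity
    nlinarith
  · have := hre 0 (by decide)
    simpa [hf] using this
  · have := h 1
    have h2 : σ 1 ^ 2 - 2 * Complex.cos (b * (t 1 : ℝ)) * σ 1 + 1 + f (t 1 : ℝ) = 0 := by
      rw [← this]; simp [hf]
    simp only [h2]
    simp
  · have := hre 2 (by decide)
    simpa [hf] using this

end DoubleRoots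

/-! ### The characteristic function near a resonance -/

section Resonance

theorem differentiable_monodromy {n : ℕ} (hn : 1 ≤ n) {p : Fin n → ℝ → ℝ} (hp : IsAdmissible n p)
    (i j : Fin (2 * n)) : Differentiable ℂ (fun μ => monodromy n p μ i j) := by
  obtain ⟨Φ, -, -, h, e⟩ := exists_fundamentalMatrix_companion hn hp
  simp only [e, Matrix.transpose_apply]
  exact h _ _ _

open scoped ContDiff in
theorem contDiff_charDet {n : ℕ} (hn : 1 ≤ n) {p : Fin n → ℝ → ℝ} (hp : IsAdmissible n p) :
    ContDiff ℂ ω (fun q : ℂ × ℂ => charDet n p q.1 q.2) := by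
  simp only [charDet, Matrix.det_apply, Matrix.sub_apply, Matrix.smul_apply]
  refine ContDiff.sum fun σ _ => ContDiff.const_smul _ (contDiff_prod fun i _ => ?_)
  exact ((differentiable_monodromy hn hp _ _).contDiff.comp contDiff_fst).sub
    (contDiff_snd.mul contDiff_const)

theorem differentiable_charDet {n : ℕ} (hn : 1 ≤ n) {p : Fin n → ℝ → ℝ} (hp : IsAdmissible n p) :
    Differentiable ℂ (fun q : ℂ × ℂ => charDet n p q.1 q.2) :=
  (contDiff_charDet hn hp).differentiable (by simp)

/-- The determinant is uniformly continuous on bounded sets of matrices. -/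
theorem exists_norm_det_sub_le {ι : Type*} [Fintype ι] [DecidableEq ι] (K : ℝ) {ε : ℝ} (hε : 0 < ε) :
    ∃ η > 0, ∀ A B : Matrix ι ι ℂ, (∀ i j, ‖A i j‖ ≤ K) → (∀ i j, ‖B i j - A i j‖ ≤ η) →
      ‖B.det - A.det‖ ≤ ε := by
  have hc : Continuous fun M : ι → ι → ℂ => (Matrix.of M).det :=
    Continuous.matrix_det (by fun_prop)
  have hu := (isCompact_closedBall (0 : ι → ι → ℂ) (|K| + 1)).uniformContinuousOn_of_continuous
    hc.continuousOn
  obtain ⟨η, hη, h⟩ := Metric.uniformContinuousOn_iff_le.1 hu ε hε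
  refine ⟨min η 1, by positivity, fun A B hA hB => ?_⟩
  have hA' : ∀ i j, ‖A i j‖ ≤ |K| + 1 := fun i j => by
    linarith [hA i j, le_abs_self K]
  have hB' : ∀ i j, ‖B i j‖ ≤ |K| + 1 := fun i j => by
    have h1 := norm_le_norm_add_norm_sub' (B i j) (A i j)
    linarith [hA i j, le_abs_self K, hB i j, min_le_right η 1]
  have hK : 0 ≤ |K| + 1 := by positivity
  have := h (fun i j => B i j) (mem_closedBall_zero_iff.2 ((pi_norm_le_iff_of_nonneg hK).2
    fun i => (pi_norm_le_iff_of_nonneg hK).2 fun j => hB' i j))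
    (fun i j => A i j) (mem_closedBall_zero_iff.2 ((pi_norm_le_iff_of_nonneg hK).2
    fun i => (pi_norm_le_iff_of_nonneg hK).2 fun j => hA' i j))
    ((dist_pi_le_iff hη.le).2 fun i => (dist_pi_le_iff hη.le).2 fun j =>
      (dist_eq_norm _ _).trans_le ((hB i j).trans (min_le_left _ _)))
  rwa [dist_eq_norm] at this

variable {n : ℕ}

/-- All roots `ω` of `ω^(2n) = ±1` lie on the unit circle, so each is determined up to conjugation
by its real part. -/
theorem eq_or_eq_conj_of_re_eq {w v : ℂ} (hw : ‖w‖ = 1) (hv : ‖v‖ = 1) (h : w.re = v.re) :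
    w = v ∨ w = (starRingEnd ℂ) v := by
  have h1 : w.im ^ 2 = v.im ^ 2 := by
    have e1 := Complex.sq_norm w
    have e2 := Complex.sq_norm v
    rw [Complex.normSq_apply, hw] at e1
    rw [Complex.normSq_apply, hv, ← h] at e2
    linarith
  rcases sq_eq_sq_iff_eq_or_eq_neg.1 h1 with h2 | h2
  · exact Or.inl (Complex.ext h h2)
  · exact Or.inr (Complex.ext h h2)

/-- An injective family of `2n` roots of `w^(2n) = c` contains all of them. -/
theorem exists_eq_of_pow_eq (hn : 1 ≤ n) {c : ℂ} {ω : Fin (2 * n) → ℂ}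
    (hωi : Function.Injective ω) (hω : ∀ k, ω k ^ (2 * n) = c) {w : ℂ} (hw : w ^ (2 * n) = c) :
    ∃ k, ω k = w := by
  have hpos : 0 < 2 * n := by omega
  have hsub : Finset.univ.image ω ⊆ (Polynomial.nthRoots (2 * n) c).toFinset := fun x hx => by
    obtain ⟨k, -, rfl⟩ := Finset.mem_image.1 hx
    rw [Multiset.mem_toFinset, Polynomial.mem_nthRoots hpos]
    exact hω k
  have hcard : (Polynomial.nthRoots (2 * n) c).toFinset.card ≤ (Finset.univ.image ω).card := by
    rw [Finset.card_image_of_injective _ hωi, Finset.card_univ, Fintype.card_fin]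
    exact (Multiset.toFinset_card_le _).trans (Polynomial.card_nthRoots _ _)
  have heq := Finset.eq_of_subset_of_card_le hsub hcard
  have : w ∈ Finset.univ.image ω := by
    rw [heq, Multiset.mem_toFinset, Polynomial.mem_nthRoots hpos]
    exact hw
  obtain ⟨k, -, h⟩ := Finset.mem_image.1 this
  exact ⟨k, h⟩

theorem exists_conj_eq (hn : 1 ≤ n) {κ : ℂ} (hκ : κ = 1 ∨ κ = -1) {ω : Fin (2 * n) → ℂ}
    (hωi : Function.Injective ω) (hω : ∀ k, ω k ^ (2 * n) = κ * (-1) ^ n) (k : Fin (2 * n)) :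
    ∃ k', ω k' = (starRingEnd ℂ) (ω k) := by
  refine exists_eq_of_pow_eq hn hωi hω ?_
  rw [← map_pow, hω]
  rcases hκ with rfl | rfl <;> simp

/-- Normalizing factor of the `j`-th column of the matrix `(1 + E) diag d - ρ` of
`exists_charDet_eq_det`, for `ρ = σ c` with `c = (-1)^m e^{azπ}`: it is `1 / d_j`, `-1 / ρ` or `1 / c`
according as `d_j = e^{zω_jπ}` is much larger than `c`, much smaller, or of the same size. The
inverses of exponentials are written as exponentials. -/
noncomputable def columnScale (ω : Fin (2 * n) → ℂ) (a : ℝ) (m : ℕ) (z σ : ℂ) (j : Fin (2 * n)) : ℂ :=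
  if a < (ω j).re then Complex.exp (-(z * ω j * Real.pi))
  else if (ω j).re < a then -σ⁻¹ * ((-1) ^ m * Complex.exp (-(a * z * Real.pi)))
  else (-1) ^ m * Complex.exp (-(a * z * Real.pi))

theorem columnScale_differentiableAt_left (ω : Fin (2 * n) → ℂ) (a : ℝ) (m : ℕ) (z σ : ℂ)
    (j : Fin (2 * n)) : DifferentiableAt ℂ (fun z => columnScale ω a m z σ j) z := by
  unfold columnScale
  split_ifs <;> fun_prop

theorem columnScale_differentiableAt_right (ω : Fin (2 * n) → ℂ) (a : ℝ) (m : ℕ) (z : ℂ) {σ : ℂ}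
    (hσ : σ ≠ 0) (j : Fin (2 * n)) : DifferentiableAt ℂ (fun σ => columnScale ω a m z σ j) σ := by
  unfold columnScale
  split_ifs <;> fun_prop (disch := assumption)

theorem neg_one_pow_mul_exp_mul (m : ℕ) (x : ℂ) :
    ((-1) ^ m * Complex.exp x) * ((-1) ^ m * Complex.exp (-x)) = 1 := by
  rw [mul_mul_mul_comm, ← Complex.exp_add, ← mul_pow]
  simp

theorem norm_exp_mul_pi_le {w z : ℂ} {x : ℝ} (hw : |w.im| ≤ 1) (hz : |z.im| ≤ 1) (hx : x ≤ z.re)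
    (hre : w.re ≤ 0) : ‖Complex.exp (z * w * Real.pi)‖ ≤ Real.exp ((w.re * x + 1) * Real.pi) := by
  rw [Complex.norm_exp, Complex.re_mul_ofReal, Complex.mul_re]
  have h1 : |z.im * w.im| ≤ 1 := by
    rw [abs_mul]; exact mul_le_one₀ hz (abs_nonneg _) hw
  have h2 := neg_le_of_abs_le h1
  have := Real.pi_pos
  gcongr
  nlinarith

/-- After normalization, the characteristic function near the resonance of `ζ = ω k` is close to
`(e^{iβπt} - σ)(e^{-iβπt} - σ)`, where `β = Im ζ`: only the two exponentials `e^{zζπ}` and its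
partner for `conj ζ` are of the size of `ρ`, all others are much larger or much smaller. -/
theorem exists_norm_charDet_sub_le (hn : 1 ≤ n) {p : Fin n → ℝ → ℝ} (hp : IsAdmissible n p)
    {κ : ℂ} (hκ : κ = 1 ∨ κ = -1) {ω : Fin (2 * n) → ℂ} (hωi : Function.Injective ω)
    (hω : ∀ k, ω k ^ (2 * n) = κ * (-1) ^ n) {k : Fin (2 * n)} (hk : 0 < (ω k).im)
    {ε : ℝ} (hε : 0 < ε) :
    ∃ m₀ : ℕ, ∀ m ≥ m₀, ∀ t ∈ Metric.ball (0 : ℂ) 1, ∀ σ ∈ Metric.ball (1 : ℂ) (1 / 2),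
      ‖charDet n p (κ * (m / (ω k).im + t) ^ (2 * n))
          (σ * ((-1) ^ m * Complex.exp ((ω k).re * (m / (ω k).im + t) * Real.pi))) *
          ∏ j, columnScale ω (ω k).re m (m / (ω k).im + t) σ j -
        (σ ^ 2 - 2 * Complex.cos ((ω k).im * Real.pi * t) * σ + 1)‖ ≤ ε := by
  have hω1 : ∀ j, ‖ω j‖ = 1 := fun j => norm_eq_one_of_pow_eq hn hκ (hω j)
  obtain ⟨k', hk'⟩ := exists_conj_eq hn hκ hωi hω k
  have him : ∀ j, |(ω j).im| ≤ 1 := fun j => (Complex.abs_im_le_norm _).trans (hω1 j).le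
  set a := (ω k).re with ha
  set β := (ω k).im with hβ
  have hkk' : k ≠ k' := by
    rintro rfl
    have := congrArg Complex.im hk'
    rw [Complex.conj_im] at this
    linarith
  have hgrp : ∀ j, (ω j).re = a → j = k ∨ j = k' := fun j hj => by
    rcases eq_or_eq_conj_of_re_eq (hω1 j) (hω1 k) hj with h | h
    · exact Or.inl (hωi h)
    · exact Or.inr (hωi (h.trans hk'.symm))
  obtain ⟨η, hη, hdet⟩ := exists_norm_det_sub_le (ι := Fin (2 * n)) (Real.exp Real.pi + 2) hε
  have hpi := Real.exp_pos Real.pi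
  have hpi1 : 1 ≤ Real.exp Real.pi := Real.one_le_exp Real.pi_pos.le
  obtain ⟨X, hX1, hX⟩ := exists_charDet_eq_det hn hp hκ hωi hω
    (δ := min 1 (η / (2 * Real.exp Real.pi))) (by positivity)
  have hdecay : ∀ᶠ x : ℝ in atTop, ∀ j, (ω j).re ≠ a →
      4 * Real.exp ((-|(ω j).re - a| * x + 1) * Real.pi) ≤ η / 2 := by
    refine eventually_all.2 fun j => ?_
    by_cases hj : (ω j).re = a
    · exact Eventually.of_forall fun x h => absurd hj h
    have hpos : 0 < |(ω j).re - a| := abs_pos.2 (sub_ne_zero.2 hj)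
    have h1 : Tendsto (fun x : ℝ => (-|(ω j).re - a| * x + 1) * Real.pi) atTop atBot :=
      (tendsto_atBot_add_const_right _ _
        (tendsto_id.const_mul_atTop_of_neg (neg_lt_zero.2 hpos))).atBot_mul_const Real.pi_pos
    have h2 := (Real.tendsto_exp_atBot.comp h1).const_mul 4
    rw [mul_zero] at h2
    filter_upwards [h2.eventually (ge_mem_nhds (half_pos hη))] with x hx _ using hx
  have hx : Tendsto (fun m : ℕ => (m : ℝ) / β - 1) atTop atTop :=
    tendsto_atTop_add_const_right _ _ (tendsto_natCast_atTop_atTop.atTop_div_const hk)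
  obtain ⟨m₀, hm₀⟩ := eventually_atTop.1 (hx.eventually (hdecay.and (eventually_ge_atTop X)))
  refine ⟨m₀, fun m hm t ht σ hσ => ?_⟩
  obtain ⟨hd, hXm⟩ := hm₀ m hm
  rw [mem_ball_zero_iff] at ht
  rw [mem_ball_iff_norm] at hσ
  set z : ℂ := m / β + t with hz
  have hmβ : (m / β : ℂ) = ((m / β : ℝ) : ℂ) := by push_cast; rfl
  have hzre : (m : ℝ) / β - 1 ≤ z.re := by
    rw [hz, hmβ, Complex.add_re, Complex.ofReal_re]
    linarith [neg_abs_le t.re, Complex.abs_re_le_norm t]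
  have hzim : |z.im| ≤ 1 := by
    rw [hz, hmβ, Complex.add_im, Complex.ofReal_im, zero_add]
    exact (Complex.abs_im_le_norm t).trans ht.le
  obtain ⟨E, hE, hEdet⟩ := hX z (hXm.trans hzre) hzim
  have hE1 : ∀ i j, ‖E i j‖ ≤ 1 := fun i j => (hE i j).trans (min_le_left _ _)
  have hE2 : ∀ i j, ‖E i j‖ * Real.exp Real.pi ≤ η / 2 := fun i j => by
    have := (hE i j).trans (min_le_right _ _)
    rw [le_div_iff₀ (by positivity)] at this
    linarith
  have hσ0 : σ ≠ 0 := by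
    rintro rfl
    norm_num at hσ
  have hσ2 : ‖σ‖ ≤ 2 := by
    have := norm_le_norm_add_norm_sub' σ 1
    rw [norm_one] at this
    linarith
  have hσinv : ‖σ⁻¹‖ ≤ 2 := by
    have := norm_le_norm_add_norm_sub' 1 σ
    rw [norm_one, norm_sub_rev] at this
    rw [norm_inv]
    refine (inv_anti₀ (by norm_num) (by linarith : (1 / 2 : ℝ) ≤ ‖σ‖)).trans (by norm_num)
  set c : ℂ := (-1) ^ m * Complex.exp (a * z * Real.pi) with hc
  set c' : ℂ := (-1) ^ m * Complex.exp (-(a * z * Real.pi)) with hc'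
  have hcc' : c * c' = 1 := neg_one_pow_mul_exp_mul m _
  set s := columnScale ω a m z σ with hs
  set d : Fin (2 * n) → ℂ := fun j => Complex.exp (z * ω j * Real.pi) with hdd
  have hm1 : ‖(-1 : ℂ) ^ m‖ = 1 := by simp
  -- the columns of the growing exponentials
  have hbig : ∀ j, a < (ω j).re → d j * s j = 1 ∧
      ‖σ * c * s j‖ ≤ 2 * Real.exp ((-|(ω j).re - a| * ((m : ℝ) / β - 1) + 1) * Real.pi) := by
    intro j hj
    have e : s j = Complex.exp (-(z * ω j * Real.pi)) := if_pos hj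
    refine ⟨by rw [e, hdd, ← Complex.exp_add, add_neg_cancel, Complex.exp_zero], ?_⟩
    have e2 : σ * c * s j = σ * ((-1) ^ m * Complex.exp (z * (a - ω j) * Real.pi)) := by
      rw [e, hc, mul_assoc, mul_assoc ((-1) ^ m), ← Complex.exp_add]
      congr 3; ring
    rw [e2, norm_mul, norm_mul, hm1, one_mul]
    have h := norm_exp_mul_pi_le (w := a - ω j) (z := z) (x := (m : ℝ) / β - 1)
      (by simpa using him j) hzim hzre (by simp; linarith)
    rw [abs_of_pos (sub_pos.2 hj), neg_sub]
    rw [Complex.sub_re, Complex.ofReal_re] at h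
    gcongr
  -- the columns of the decaying exponentials
  have hsmall : ∀ j, (ω j).re < a → σ * c * s j = -1 ∧
      ‖d j * s j‖ ≤ 2 * Real.exp ((-|(ω j).re - a| * ((m : ℝ) / β - 1) + 1) * Real.pi) := by
    intro j hj
    have e : s j = -σ⁻¹ * c' := by rw [hs, columnScale, if_neg hj.not_gt, if_pos hj]
    refine ⟨?_, ?_⟩
    · rw [e]
      calc σ * c * (-σ⁻¹ * c') = -(σ * σ⁻¹) * (c * c') := by ring
        _ = -1 := by rw [mul_inv_cancel₀ hσ0, hcc', mul_one]
    have e2 : d j * s j = -σ⁻¹ * ((-1) ^ m * Complex.exp (z * (ω j - a) * Real.pi)) := by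
      rw [e, hc', hdd, mul_left_comm, mul_left_comm _ ((-1) ^ m), ← Complex.exp_add]
      congr 3; ring
    rw [e2, norm_mul, norm_mul, hm1, one_mul, norm_neg]
    have h := norm_exp_mul_pi_le (w := ω j - a) (z := z) (x := (m : ℝ) / β - 1)
      (by simpa using him j) hzim hzre (by simp; linarith)
    rw [abs_of_neg (sub_neg.2 hj), neg_neg]
    rw [Complex.sub_re, Complex.ofReal_re] at h
    gcongr
  -- the two resonant columns
  have hmid : ∀ j, (ω j).re = a → σ * c * s j = σ ∧
      d j * s j = Complex.exp ((ω j).im * Real.pi * t * Complex.I) := by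
    intro j hj
    have e : s j = c' := by rw [hs, columnScale, if_neg (by rw [hj]; exact lt_irrefl _),
      if_neg (by rw [hj]; exact lt_irrefl _)]
    refine ⟨by rw [e, mul_assoc, hcc', mul_one], ?_⟩
    have hβ0 : (β : ℂ) ≠ 0 := by exact_mod_cast hk.ne'
    have hq : (-1 : ℂ) ^ m * Complex.exp (m / β * (ω j).im * Real.pi * Complex.I) = 1 := by
      rcases hgrp j hj with rfl | rfl
      · rw [← hβ, div_mul_cancel₀ _ hβ0, mul_assoc, Complex.exp_nat_mul, Complex.exp_pi_mul_I,
          ← mul_pow]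
        simp
      · rw [hk', Complex.conj_im, ← hβ, Complex.ofReal_neg, mul_neg, div_mul_cancel₀ _ hβ0, neg_mul,
          neg_mul, Complex.exp_neg, mul_assoc, Complex.exp_nat_mul, Complex.exp_pi_mul_I, ← inv_pow,
          ← mul_pow]
        simp
    rw [e, hc', hdd, mul_left_comm, ← Complex.exp_add]
    have : z * ω j * Real.pi + -(a * z * Real.pi) =
        m / β * (ω j).im * Real.pi * Complex.I + (ω j).im * Real.pi * t * Complex.I := by
      conv_lhs => rw [← Complex.re_add_im (ω j), hj]
      rw [hz]; ring
    rw [this, Complex.exp_add, ← mul_assoc, hq, one_mul]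
  have hexp : ∀ j, ‖Complex.exp ((ω j).im * Real.pi * t * Complex.I)‖ ≤ Real.exp Real.pi := by
    intro j
    refine (Complex.norm_exp_le_exp_norm _).trans (Real.exp_le_exp.2 ?_)
    rw [norm_mul, norm_mul, norm_mul, Complex.norm_I, Complex.norm_real, Complex.norm_real,
      Real.norm_eq_abs, Real.norm_eq_abs, abs_of_pos Real.pi_pos, mul_one]
    have := him j
    calc |(ω j).im| * Real.pi * ‖t‖ ≤ 1 * Real.pi * 1 := by gcongr
      _ = Real.pi := by ring
  set f : Fin (2 * n) → ℂ := fun j =>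
    if (ω j).re = a then Complex.exp ((ω j).im * Real.pi * t * Complex.I) - σ else 1 with hf
  have hfdet : (Matrix.diagonal f).det =
      σ ^ 2 - 2 * Complex.cos (β * Real.pi * t) * σ + 1 := by
    rw [Matrix.det_diagonal, Finset.prod_eq_mul k k' hkk'
      (fun j _ hj => if_neg fun h => (hgrp j h).elim hj.1 hj.2) (by simp) (by simp)]
    have h1 : f k = Complex.exp (β * Real.pi * t * Complex.I) - σ := if_pos rfl
    have h2 : f k' = Complex.exp (-(β * Real.pi * t) * Complex.I) - σ := by
      have : f k' = Complex.exp ((ω k').im * Real.pi * t * Complex.I) - σ :=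
        if_pos (by rw [hk', Complex.conj_re])
      rw [this, hk', Complex.conj_im, ← hβ, Complex.ofReal_neg, neg_mul, neg_mul]
    refine (congrArg₂ (· * ·) h1 h2).trans ?_
    rw [Complex.two_cos]
    have : Complex.exp (β * Real.pi * t * Complex.I) *
        Complex.exp (-(β * Real.pi * t) * Complex.I) = 1 := by
      rw [← Complex.exp_add, neg_mul, add_neg_cancel, Complex.exp_zero]
    linear_combination this
  have hmat : charDet n p (κ * z ^ (2 * n)) (σ * c) * ∏ j, s j =
      (Matrix.of fun i j => (if i = j then d j * s j - σ * c * s j else 0) +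
        E i j * (d j * s j)).det := by
    rw [hEdet, ← Matrix.det_diagonal, ← Matrix.det_mul]
    congr 1
    ext i j
    rw [Matrix.mul_diagonal, Matrix.sub_apply, Matrix.mul_diagonal, Matrix.add_apply,
      Matrix.smul_apply, Matrix.of_apply, Matrix.one_apply]
    split_ifs <;> simp [hdd] <;> ring
  rw [hmat, ← hfdet]
  refine hdet _ _ (fun i j => ?_) (fun i j => ?_)
  · rw [Matrix.diagonal_apply]
    split_ifs with hij
    · simp only [hf]
      split_ifs
      · exact (norm_sub_le _ _).trans (add_le_add (hexp i) hσ2)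
      · rw [norm_one]; linarith
    · rw [norm_zero]; positivity
  · rw [Matrix.of_apply, Matrix.diagonal_apply]
    have hE1' := hE1 i j
    have hE2' := hE2 i j
    have hEη : ‖E i j‖ ≤ η / 2 := by nlinarith [norm_nonneg (E i j)]
    rcases lt_trichotomy (ω j).re a with hj | hj | hj
    · obtain ⟨h1, h2⟩ := hsmall j hj
      have h3 := hd j hj.ne
      set q := d j * s j with hq
      have : (if i = j then q - σ * c * s j else 0) + E i j * q - (if i = j then f i else 0) =
          (if i = j then q else 0) + E i j * q := by
        split_ifs with hij
        · have : f i = 1 := by rw [hij]; exact if_neg hj.ne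
          rw [h1, this]; ring
        · ring
      rw [this]
      have h4 : ‖(if i = j then q else 0 : ℂ)‖ ≤ ‖q‖ := by
        split_ifs
        · exact le_rfl
        · rw [norm_zero]; exact norm_nonneg _
      have h5 : ‖E i j * q‖ ≤ ‖q‖ := by
        rw [norm_mul]; exact mul_le_of_le_one_left (norm_nonneg _) hE1'
      linarith [norm_add_le (if i = j then q else 0 : ℂ) (E i j * q)]
    · obtain ⟨h1, h2⟩ := hmid j hj
      have : (if i = j then d j * s j - σ * c * s j else 0) + E i j * (d j * s j) -
          (if i = j then f i else 0) = E i j * (d j * s j) := by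
        split_ifs with hij
        · have : f i = Complex.exp ((ω j).im * Real.pi * t * Complex.I) - σ := by
            rw [hij]; exact if_pos hj
          rw [h1, h2, this]; ring
        · ring
      rw [this, norm_mul, h2]
      have := mul_le_mul_of_nonneg_left (hexp j) (norm_nonneg (E i j))
      linarith
    · obtain ⟨h1, h2⟩ := hbig j hj
      have h3 := hd j hj.ne'
      rw [h1, mul_one]
      set q := σ * c * s j with hq
      have : (if i = j then 1 - q else 0) + E i j - (if i = j then f i else 0) =
          E i j - (if i = j then q else 0) := by
        split_ifs with hij
        · have : f i = 1 := by rw [hij]; exact if_neg hj.ne'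
          rw [this]; ring
        · ring
      rw [this]
      have h4 : ‖(if i = j then q else 0 : ℂ)‖ ≤ ‖q‖ := by
        split_ifs
        · exact le_rfl
        · rw [norm_zero]; exact norm_nonneg _
      have := Real.exp_pos ((-|(ω j).re - a| * ((m : ℝ) / β - 1) + 1) * Real.pi)
      linarith [norm_sub_le (E i j) (if i = j then q else 0 : ℂ)]

/-- Near a point `λ = m / Im ζ` with `m` large, at most two real `λ` have a double multiplier close
to `(-1)^m e^{λπ Re ζ}`. -/
theorem exists_not_three_double_multipliers (hn : 1 ≤ n) {p : Fin n → ℝ → ℝ} (hp : IsAdmissible n p)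
    {κ : ℂ} (hκ : κ = 1 ∨ κ = -1) {ω : Fin (2 * n) → ℂ} (hωi : Function.Injective ω)
    (hω : ∀ k, ω k ^ (2 * n) = κ * (-1) ^ n) {k : Fin (2 * n)} (hk : 0 < (ω k).im) :
    ∃ δ > 0, ∃ m₀ : ℕ, ∀ m ≥ m₀, ∀ (l : Fin 3 → ℝ) (ρ : Fin 3 → ℂ), l 0 < l 1 → l 1 < l 2 →
      (∀ i, |l i - m / (ω k).im| ≤ δ) →
      (∀ i, ‖ρ i * ((-1) ^ m * Complex.exp (-((ω k).re * l i * Real.pi))) - 1‖ ≤ δ) →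
      (∀ i, charDet n p (κ * (l i : ℂ) ^ (2 * n)) (ρ i) = 0) →
      (∀ i, deriv (charDet n p (κ * (l i : ℂ) ^ (2 * n))) (ρ i) = 0) → False := by
  obtain ⟨δ, hδ, hδ1, ε, hε, h⟩ := not_three_double_roots (b := (ω k).im * Real.pi)
    (mul_pos hk Real.pi_pos)
  obtain ⟨m₀, hm₀⟩ := exists_norm_charDet_sub_le hn hp hκ hωi hω hk hε
  refine ⟨δ, hδ, m₀, fun m hm l ρ h01 h12 hl hρ h0 h0' => ?_⟩
  have hdc := differentiable_charDet hn hp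
  set β := (ω k).im with hβ
  set a := (ω k).re with ha
  set c : ℂ → ℂ := fun t => (-1) ^ m * Complex.exp (a * (m / β + t) * Real.pi) with hc
  set c' : ℂ → ℂ := fun t => (-1) ^ m * Complex.exp (-(a * (m / β + t) * Real.pi)) with hc'
  have hcc' : ∀ t, c t * c' t = 1 := fun t => neg_one_pow_mul_exp_mul m _
  set Δ : ℂ → ℂ → ℂ := fun t => charDet n p (κ * (m / β + t) ^ (2 * n)) with hΔ
  set S : ℂ → ℂ → ℂ := fun t σ => ∏ j, columnScale ω a m (m / β + t) σ j with hS
  have hSt : ∀ t σ, DifferentiableAt ℂ (fun t => S t σ) t := fun t σ =>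
    DifferentiableAt.fun_finsetProd fun j _ =>
      (columnScale_differentiableAt_left ω a m (m / β + t) σ j).comp t
        (by fun_prop : DifferentiableAt ℂ (fun t : ℂ => (m / β + t : ℂ)) t)
  have hSσ : ∀ t σ, σ ≠ 0 → DifferentiableAt ℂ (S t) σ := fun t σ hσ =>
    DifferentiableAt.fun_finsetProd fun j _ => columnScale_differentiableAt_right ω a m _ hσ j
  have hΔt : ∀ t σ, DifferentiableAt ℂ (fun t => Δ t (σ * c t)) t := fun t σ =>
    (hdc _).comp (f := fun t : ℂ => ((κ * (m / β + t) ^ (2 * n), σ * c t) : ℂ × ℂ)) t (by fun_prop)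
  have hΔρ : ∀ t, Differentiable ℂ (Δ t) := fun t ρ =>
    (hdc _).comp (f := fun ρ : ℂ => ((κ * (m / β + t) ^ (2 * n), ρ) : ℂ × ℂ)) ρ (by fun_prop)
  have hne : ∀ σ ∈ Metric.ball (1 : ℂ) (1 / 2), σ ≠ 0 := by
    rintro σ hσ rfl
    norm_num at hσ
  -- the double roots of `Δ` are those of the normalized function, a perturbation of the model
  set g : ℂ → ℂ → ℂ := fun t σ =>
    Δ t (σ * c t) * S t σ - (σ ^ 2 - 2 * Complex.cos (β * Real.pi * t) * σ + 1) with hg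
  set t : Fin 3 → ℝ := fun i => l i - m / β with ht
  have hlt : ∀ i, (l i : ℂ) = m / β + t i := fun i => by simp [ht]
  have hck : ∀ i, ((Real.cos (β * Real.pi * t i) : ℝ) : ℂ) = Complex.cos (β * Real.pi * t i) :=
    fun i => by push_cast; rfl
  set σ : Fin 3 → ℂ := fun i => ρ i * c' (t i) with hσ
  have hσc : ∀ i, σ i * c (t i) = ρ i := fun i => by
    rw [hσ]
    linear_combination ρ i * hcc' (t i)
  have hσ1 : ∀ i, ‖σ i - 1‖ ≤ δ := fun i => by
    have := hρ i
    rwa [hlt] at this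
  have hσ0 : ∀ i, σ i ≠ 0 := fun i => hne _ (mem_ball_iff_norm.2 ((hσ1 i).trans_lt (by linarith)))
  have hΔ0 : ∀ i, Δ (t i) (ρ i) = 0 := fun i => by
    have := h0 i
    rwa [hlt] at this
  have hΔ0' : ∀ i, deriv (Δ (t i)) (ρ i) = 0 := fun i => by
    have := h0' i
    rwa [hlt] at this
  refine h g (fun s _ t _ => ?_) (fun s _ x hx => ?_) (fun s hs x hx => hm₀ m hm s hs x hx) t σ
    (by simpa [ht] using h01) (by simpa [ht] using h12) hl hσ1 (fun i => ?_) (fun i => ?_)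
  · exact (((hΔt t s).mul (hSt t s)).sub (by fun_prop)).differentiableWithinAt
  · have h1 : DifferentiableAt ℂ (fun σ => Δ s (σ * c s)) x :=
      ((hΔρ s) _).comp x (by fun_prop : DifferentiableAt ℂ (fun σ => σ * c s) x)
    exact ((h1.mul (hSσ s x (hne x hx))).sub (by fun_prop)).differentiableWithinAt
  · rw [hck, hg]
    simp only [hσc, hΔ0]
    ring
  · have h1 : HasDerivAt (fun σ => Δ (t i) (σ * c (t i))) 0 (σ i) := by
      have e1 : HasDerivAt (Δ (t i)) 0 (σ i * c (t i)) := by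
        rw [hσc, ← hΔ0' i]
        exact (hΔρ _ _).hasDerivAt
      have := e1.comp (σ i) ((hasDerivAt_id (σ i)).mul_const (c (t i)))
      rw [zero_mul] at this
      exact this
    have h2 := h1.mul (hSσ (t i) (σ i) (hσ0 i)).hasDerivAt
    simp only [hσc, hΔ0, zero_mul, add_zero] at h2
    have h3 : HasDerivAt
        (fun σ : ℂ => σ ^ 2 - 2 * Complex.cos (β * Real.pi * t i) * σ + 1)
        (2 * σ i - 2 * Complex.cos (β * Real.pi * t i)) (σ i) := by
      refine ((((hasDerivAt_id (σ i)).pow 2).sub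
        ((hasDerivAt_id (σ i)).const_mul (2 * Complex.cos (β * Real.pi * t i)))).add_const
          1).congr_deriv ?_
      simp
    have h4 : deriv (g (t i)) (σ i) = 0 - (2 * σ i - 2 * Complex.cos (β * Real.pi * t i)) :=
      (h2.sub h3).deriv
    rw [h4, hck]
    ring

end Resonance

/-! ### Localization of the multipliers on the real axis -/

section MultiplierLocalization

variable {n : ℕ}

/-- For large `l`, a positive number is comparable with `e^{lπ Re ω_j}` for at most one value of
`Re ω_j`. -/
theorem exists_forall_re_eq {ι : Type*} [Finite ι] (ω : ι → ℂ) :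
    ∃ Λ : ℝ, ∀ l ≥ Λ, ∀ (x : ℝ) (i j : ι), |x / Real.exp ((ω i).re * l * Real.pi) - 1| ≤ 1 / 4 →
      |x / Real.exp ((ω j).re * l * Real.pi) - 1| ≤ 1 / 4 → (ω i).re = (ω j).re := by
  have h : ∀ᶠ l : ℝ in atTop, ∀ i j, (ω i).re < (ω j).re →
      2 < Real.exp (((ω j).re - (ω i).re) * l * Real.pi) := by
    refine eventually_all.2 fun i => eventually_all.2 fun j => ?_
    by_cases hij : (ω i).re < (ω j).re
    · have h1 : Tendsto (fun l : ℝ => ((ω j).re - (ω i).re) * l * Real.pi) atTop atTop :=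
        (tendsto_id.const_mul_atTop (sub_pos.2 hij)).atTop_mul_const Real.pi_pos
      filter_upwards [(Real.tendsto_exp_atTop.comp h1).eventually (eventually_gt_atTop 2)]
        with l hl _ using hl
    · exact Eventually.of_forall fun _ h => absurd h hij
  obtain ⟨Λ, hΛ⟩ := eventually_atTop.1 h
  refine ⟨Λ, fun l hl x => ?_⟩
  have key : ∀ i j, |x / Real.exp ((ω i).re * l * Real.pi) - 1| ≤ 1 / 4 →
      |x / Real.exp ((ω j).re * l * Real.pi) - 1| ≤ 1 / 4 → ¬ (ω i).re < (ω j).re := by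
    intro i j hi hj hij
    have h2 := hΛ l hl i j hij
    have e : Real.exp ((ω j).re * l * Real.pi) = Real.exp ((ω i).re * l * Real.pi) *
        Real.exp (((ω j).re - (ω i).re) * l * Real.pi) := by
      rw [← Real.exp_add]; congr 1; ring
    have p1 := Real.exp_pos ((ω i).re * l * Real.pi)
    have p2 := Real.exp_pos ((ω j).re * l * Real.pi)
    have h3 := (abs_le.1 hi).2
    have h4 := (abs_le.1 hj).1
    have h3' : x / Real.exp ((ω i).re * l * Real.pi) ≤ 5 / 4 := by linarith
    have h4' : 3 / 4 ≤ x / Real.exp ((ω j).re * l * Real.pi) := by linarith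
    rw [div_le_iff₀ p1] at h3'
    rw [le_div_iff₀ p2, e] at h4'
    nlinarith
  exact fun i j hi hj => le_antisymm (not_lt.1 (key j i hj hi)) (not_lt.1 (key i j hi hj))

theorem abs_div_exp_sub_one_le {x w : ℂ} {l δ : ℝ}
    (h : ‖x - Complex.exp (l * w * Real.pi)‖ ≤ δ * ‖Complex.exp (l * w * Real.pi)‖) :
    |‖x‖ / Real.exp (w.re * l * Real.pi) - 1| ≤ δ := by
  have e : ‖Complex.exp (l * w * Real.pi)‖ = Real.exp (w.re * l * Real.pi) := by
    rw [Complex.norm_exp, Complex.re_mul_ofReal, Complex.re_ofReal_mul, mul_comm l]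
  rw [e] at h
  have p := Real.exp_pos (w.re * l * Real.pi)
  rw [div_sub_one p.ne', abs_div, abs_of_pos p, div_le_iff₀ p, ← e]
  exact (abs_norm_sub_norm_le _ _).trans (h.trans_eq (by rw [e]))

/-- The two exponentials `e^{lwπ}` and `e^{l (conj w) π}` differ by the factor `2 |sin (lπ Im w)|`,
relative to their common modulus. -/
theorem norm_exp_sub_exp_conj (w : ℂ) (l : ℝ) :
    ‖Complex.exp (l * w * Real.pi) - Complex.exp (l * (starRingEnd ℂ) w * Real.pi)‖ =
      2 * |Real.sin (w.im * l * Real.pi)| * ‖Complex.exp (l * w * Real.pi)‖ := by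
  have e1 : l * w * Real.pi = ((w.re * l * Real.pi : ℝ) : ℂ) +
      ((w.im * l * Real.pi : ℝ) : ℂ) * Complex.I := by
    push_cast
    linear_combination -(l * Real.pi : ℂ) * Complex.re_add_im w
  have e2 : l * (starRingEnd ℂ) w * Real.pi = ((w.re * l * Real.pi : ℝ) : ℂ) +
      -((w.im * l * Real.pi : ℝ) : ℂ) * Complex.I := by
    have : (starRingEnd ℂ) w = w.re - w.im * Complex.I := Complex.ext (by simp) (by simp)
    rw [this]
    push_cast
    ring
  set y := w.im * l * Real.pi
  have e3 : Complex.exp ((y : ℂ) * Complex.I) - Complex.exp (-(y : ℂ) * Complex.I) =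
      2 * (Real.sin y : ℝ) * Complex.I := by
    rw [Complex.ofReal_sin, Complex.two_sin]
    linear_combination
      (Complex.exp ((y : ℂ) * Complex.I) - Complex.exp (-(y : ℂ) * Complex.I)) * Complex.I_mul_I
  rw [e1, e2, Complex.exp_add, Complex.exp_add, ← mul_sub, e3, norm_mul, norm_mul, norm_mul,
    norm_mul, Complex.norm_I, Complex.norm_exp_ofReal_mul_I, Complex.norm_real]
  simp; ring

/-- If `sin (πx)` is small, then `x` is close to an integer. -/
theorem two_mul_abs_sub_round_le (x : ℝ) : 2 * |x - round x| ≤ |Real.sin (x * Real.pi)| := by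
  have h1 := abs_sub_round x
  have h2 : |Real.sin (x * Real.pi)| = |Real.sin ((x - round x) * Real.pi)| := by
    rw [sub_mul, Real.sin_sub_int_mul_pi, abs_mul, abs_zpow, abs_neg, abs_one, one_zpow, one_mul]
  have h3 := Real.mul_abs_le_abs_sin (x := (x - round x) * Real.pi)
    (by rw [abs_mul, abs_of_pos Real.pi_pos]; nlinarith [Real.pi_pos])
  rw [h2]
  refine le_trans (le_of_eq ?_) h3
  rw [abs_mul, abs_of_pos Real.pi_pos]
  field_simp

/-- The exponential `e^{lwπ}` at a point `l` close to `m / Im w`, compared with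
`(-1)^m e^{lπ Re w}`. -/
theorem norm_mul_sub_one_le {x w : ℂ} {l δ : ℝ} (m : ℕ)
    (h : ‖x - Complex.exp (l * w * Real.pi)‖ ≤ 3 * δ * ‖Complex.exp (l * w * Real.pi)‖)
    (hm : 2 * |w.im * l - m| ≤ δ) :
    ‖x * ((-1) ^ m * Complex.exp (-(w.re * l * Real.pi))) - 1‖ ≤ 7 * δ := by
  set c : ℂ := (-1) ^ m * Complex.exp (-(w.re * l * Real.pi)) with hc
  have e : Complex.exp (l * w * Real.pi) * c =
      Complex.exp (((w.im * l - m) * Real.pi : ℝ) * Complex.I) := by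
    have e1 : ((-1 : ℂ)) ^ m = Complex.exp (-(m * (Real.pi * Complex.I))) := by
      rw [Complex.exp_neg, Complex.exp_nat_mul, Complex.exp_pi_mul_I, ← inv_pow]; norm_num
    rw [hc, e1, ← Complex.exp_add, ← Complex.exp_add]
    congr 1
    push_cast
    linear_combination -(l * Real.pi : ℂ) * Complex.re_add_im w
  have hcn : ‖Complex.exp (l * w * Real.pi)‖ * ‖c‖ = 1 := by
    rw [← norm_mul, e, Complex.norm_exp_ofReal_mul_I]
  have h1 : ‖(x - Complex.exp (l * w * Real.pi)) * c‖ ≤ 3 * δ := by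
    rw [norm_mul]
    calc _ ≤ 3 * δ * ‖Complex.exp (l * w * Real.pi)‖ * ‖c‖ := by gcongr
      _ = 3 * δ := by rw [mul_assoc, hcn, mul_one]
  have h2 : ‖Complex.exp (((w.im * l - m) * Real.pi : ℝ) * Complex.I) - 1‖ ≤ 2 * δ := by
    have := Real.norm_exp_I_mul_ofReal_sub_one_le (x := (w.im * l - m) * Real.pi)
    rw [mul_comm Complex.I, Real.norm_eq_abs, abs_mul, abs_of_pos Real.pi_pos] at this
    have h4 := Real.pi_le_four
    nlinarith [abs_nonneg (w.im * l - m)]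
  have : x * c - 1 = (x - Complex.exp (l * w * Real.pi)) * c +
      (Complex.exp (((w.im * l - m) * Real.pi : ℝ) * Complex.I) - 1) := by
    rw [← e]; ring
  rw [this]
  linarith [norm_add_le ((x - Complex.exp (l * w * Real.pi)) * c)
    (Complex.exp (((w.im * l - m) * Real.pi : ℝ) * Complex.I) - 1),
    (norm_nonneg _).trans h2]

/-- At real points `μ = κ l^(2n)` with `l` large the multipliers can be enumerated so that the `k`-th
one has modulus close to `e^{lπ Re ω_k}`. Two multipliers coincide only if, for some root `ω_i` in the
upper half-plane, `l` is close to a point `m / Im ω_i` and the common value is close to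
`(-1)^m e^{lπ Re ω_i}`. -/
theorem exists_multipliers_near (hn : 1 ≤ n) {p : Fin n → ℝ → ℝ} (hp : IsAdmissible n p)
    {κ : ℂ} (hκ : κ = 1 ∨ κ = -1) {ω : Fin (2 * n) → ℂ} (hωi : Function.Injective ω)
    (hω : ∀ k, ω k ^ (2 * n) = κ * (-1) ^ n) {ε : ℝ} (hε : 0 < ε) :
    ∃ Λ : ℝ, ∀ l : ℝ, Λ ≤ l → ∃ r : Fin (2 * n) → ℂ,
      (∀ ρ, charDet n p (κ * (l : ℂ) ^ (2 * n)) ρ = ∏ k, (r k - ρ)) ∧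
      (∀ k, |‖r k‖ / Real.exp ((ω k).re * l * Real.pi) - 1| ≤ ε) ∧
      ∀ j k, j ≠ k → r j = r k → ∃ (i : Fin (2 * n)) (m : ℕ), 0 < (ω i).im ∧
        |l - m / (ω i).im| ≤ ε ∧
        ‖r k * ((-1) ^ m * Complex.exp (-((ω i).re * l * Real.pi))) - 1‖ ≤ ε := by
  have hω1 : ∀ j, ‖ω j‖ = 1 := fun j => norm_eq_one_of_pow_eq hn hκ (hω j)
  obtain ⟨δ, hδ0, hδ, hδi⟩ : ∃ δ > 0, (δ ≤ 1 / 4 ∧ 7 * δ ≤ ε) ∧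
      ∀ i, 0 < (ω i).im → δ ≤ 2 * ((ω i).im * ε) := by
    have h : ∀ c : ℝ, 0 < c → ∀ᶠ δ : ℝ in 𝓝[>] 0, δ ≤ c := fun c hc =>
      (eventually_le_nhds hc).filter_mono nhdsWithin_le_nhds
    have h1 : ∀ᶠ δ : ℝ in 𝓝[>] 0, ∀ i, 0 < (ω i).im → δ ≤ 2 * ((ω i).im * ε) :=
      eventually_all.2 fun i => by
        by_cases hi : 0 < (ω i).im
        · filter_upwards [h (2 * ((ω i).im * ε)) (by positivity)] with δ hδ _ using hδ
        · exact Eventually.of_forall fun _ h => absurd h hi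
    obtain ⟨δ, ⟨⟨h2, h3⟩, h4⟩, h5⟩ := ((((h (1 / 4) (by norm_num)).and
      (h (ε / 7) (by positivity))).and h1).and self_mem_nhdsWithin).exists
    exact ⟨δ, h5, ⟨h2, by linarith⟩, h4⟩
  have hN : (0 : ℝ) < (2 * n : ℕ) := by
    exact_mod_cast (by omega : 0 < 2 * n)
  obtain ⟨X, hX1, hX⟩ := exists_charDet_eq_det hn hp hκ hωi hω (δ := δ / (2 * n : ℕ)) (by positivity)
  obtain ⟨Λ, hΛ⟩ := exists_forall_re_eq ω
  refine ⟨max X Λ, fun l hl => ?_⟩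
  have hlX : X ≤ l := (le_max_left _ _).trans hl
  have hlΛ := hΛ l ((le_max_right _ _).trans hl)
  obtain ⟨E, hE, hEdet⟩ := hX l (by simpa using hlX) (by simp)
  set d : Fin (2 * n) → ℂ := fun j => Complex.exp (l * ω j * Real.pi) with hd
  obtain ⟨r, hr, hrJ⟩ := exists_eigenvalues_near (d := d) (fun j => Complex.exp_ne_zero _) (E := E)
    (δ := δ) (fun i => by
      refine (Finset.sum_le_card_nsmul _ _ (δ / (2 * n : ℕ)) fun j _ => hE i j).trans_eq ?_
      rw [Finset.card_univ, Fintype.card_fin, nsmul_eq_mul]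
      field_simp)
  have hratio : ∀ x i, ‖x - d i‖ ≤ δ * ‖d i‖ →
      |‖x‖ / Real.exp ((ω i).re * l * Real.pi) - 1| ≤ δ := fun x i h => abs_div_exp_sub_one_le h
  have hdisj : ∀ x i j, ‖x - d i‖ ≤ δ * ‖d i‖ → ‖x - d j‖ ≤ δ * ‖d j‖ → (ω i).re = (ω j).re :=
    fun x i j hi hj =>
      hlΛ ‖x‖ i j ((hratio x i hi).trans hδ.1) ((hratio x j hj).trans hδ.1)
  -- each multiplier lies in a disc about an exponential of the expected modulus
  have hgrp : ∀ k, ∃ i, (ω i).re = (ω k).re ∧ ‖r k - d i‖ ≤ δ * ‖d i‖ := by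
    intro k
    obtain ⟨i, hi, h⟩ := hrJ {i | (ω i).re = (ω k).re} (fun i hi j hj x hxi hxj =>
      hj ((hdisj x i j hxi hxj).symm.trans hi)) k rfl
    exact ⟨i, hi, h⟩
  refine ⟨r, fun ρ => (hEdet ρ).trans (hr ρ), fun k => ?_, fun j k hjk hrjk => ?_⟩
  · obtain ⟨i, hi, h⟩ := hgrp k
    have := hratio _ _ h
    rw [hi] at this
    linarith
  obtain ⟨i, hik, hi⟩ := hgrp k
  obtain ⟨i', hij', hi'⟩ := hgrp j
  have hre : (ω j).re = (ω k).re := by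
    rw [← hik, ← hij']
    exact hdisj (r k) i' i (hrjk ▸ hi') hi
  have hconj : ω j = (starRingEnd ℂ) (ω k) :=
    (eq_or_eq_conj_of_re_eq (hω1 j) (hω1 k) hre).resolve_left fun h => hjk (hωi h)
  have hpair : ∀ i, (ω i).re = (ω k).re → i = j ∨ i = k := fun i hi => by
    rcases eq_or_eq_conj_of_re_eq (hω1 i) (hω1 k) hi with h | h
    · exact Or.inr (hωi h)
    · exact Or.inl (hωi (h.trans hconj.symm))
  have hdn : ‖d j‖ = ‖d k‖ := by
    simp only [hd, Complex.norm_exp, Complex.re_mul_ofReal, Complex.re_ofReal_mul, hre]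
  -- if the two discs were disjoint, each would contain its own multiplier
  obtain ⟨x, hxk, hxj⟩ : ∃ x, ‖x - d k‖ ≤ δ * ‖d k‖ ∧ ‖x - d j‖ ≤ δ * ‖d j‖ := by
    by_contra! hno
    have hk : ‖r k - d k‖ ≤ δ * ‖d k‖ := by
      obtain ⟨i, rfl, h⟩ := hrJ {k} (fun i hi i' hi' x hx hx' => by
        rw [Set.mem_singleton_iff] at hi hi'
        subst hi
        rcases hpair i' (hdisj x i i' hx hx').symm with rfl | rfl
        · exact (hno x hx).not_ge hx'
        · exact hi' rfl) k rfl
      exact h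
    have hj : ‖r j - d j‖ ≤ δ * ‖d j‖ := by
      obtain ⟨i, rfl, h⟩ := hrJ {j} (fun i hi i' hi' x hx hx' => by
        rw [Set.mem_singleton_iff] at hi hi'
        subst hi
        rcases hpair i' ((hdisj x i i' hx hx').symm.trans hre) with rfl | rfl
        · exact hi' rfl
        · exact (hno x hx').not_ge hx) j rfl
      exact h
    rw [hrjk] at hj
    exact (hno _ hk).not_ge hj
  have hdjk : ‖d k - d j‖ ≤ 2 * δ * ‖d k‖ := by
    have := norm_sub_le_norm_sub_add_norm_sub (d k) x (d j)
    rw [norm_sub_rev] at hxk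
    rw [hdn] at hxj
    linarith
  have hsin : |Real.sin ((ω k).im * l * Real.pi)| ≤ δ := by
    have h := norm_exp_sub_exp_conj (ω k) l
    rw [← hconj] at h
    have hp : 0 < ‖d k‖ := norm_pos_iff.2 (Complex.exp_ne_zero _)
    have : 2 * |Real.sin ((ω k).im * l * Real.pi)| * ‖d k‖ ≤ 2 * δ * ‖d k‖ := h.symm.trans_le hdjk
    linarith [le_of_mul_le_mul_right this hp]
  have him : (ω k).im ≠ 0 := fun h => hjk (hωi (by rw [hconj]; exact Complex.conj_eq_iff_im.2 h))
  have hclose : ∀ i', (i' = j ∨ i' = k) → ‖r k - d i'‖ ≤ 3 * δ * ‖d i'‖ := by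
    have hi2 : ‖r k - d i‖ ≤ δ * ‖d k‖ := by
      rcases hpair i hik with rfl | rfl
      · rwa [hdn] at hi
      · exact hi
    have hii : ∀ i', (i' = j ∨ i' = k) → ‖d i - d i'‖ ≤ 2 * δ * ‖d k‖ := by
      have h0 : 0 ≤ 2 * δ * ‖d k‖ := by positivity
      have hdjk' := hdjk
      rw [norm_sub_rev] at hdjk'
      rintro i' (rfl | rfl) <;> rcases hpair i hik with rfl | rfl <;> simpa
    intro i' hi'
    have h1 : ‖d i'‖ = ‖d k‖ := by rcases hi' with rfl | rfl <;> [exact hdn; rfl]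
    rw [h1]
    linarith [norm_sub_le_norm_sub_add_norm_sub (r k) (d i) (d i'), hii i' hi']
  obtain ⟨i', hi'jk, hi'pos, hi'sin⟩ : ∃ i', (i' = j ∨ i' = k) ∧ 0 < (ω i').im ∧
      |Real.sin ((ω i').im * l * Real.pi)| ≤ δ := by
    rcases lt_or_gt_of_ne him with h | h
    · refine ⟨j, Or.inl rfl, by rw [hconj, Complex.conj_im]; linarith, ?_⟩
      rw [hconj, Complex.conj_im, neg_mul, neg_mul, Real.sin_neg, abs_neg]
      exact hsin
    · exact ⟨k, Or.inr rfl, h, hsin⟩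
  -- replace the sine by the distance to the nearest integer `m`
  have hround := (two_mul_abs_sub_round_le ((ω i').im * l)).trans hi'sin
  have hnn : 0 ≤ round ((ω i').im * l) := by
    have h1 : 0 ≤ (ω i').im * l := mul_nonneg hi'pos.le (by linarith)
    have h4 := (abs_le.1 (abs_sub_round ((ω i').im * l))).2
    by_contra! hneg
    have : (round ((ω i').im * l) : ℝ) ≤ -1 := by exact_mod_cast Int.le_sub_one_of_lt hneg
    linarith
  obtain ⟨m, hm⟩ := Int.eq_ofNat_of_zero_le hnn
  rw [hm, Int.cast_natCast] at hround
  refine ⟨i', m, hi'pos, ?_, (norm_mul_sub_one_le m (hclose i' hi'jk) hround).trans hδ.2⟩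
  have e : l - m / (ω i').im = ((ω i').im * l - m) / (ω i').im := by field_simp
  rw [e, abs_div, abs_of_pos hi'pos, div_le_iff₀ hi'pos]
  linarith [hδi i' hi'pos]

end MultiplierLocalization

/-! ### Double multipliers and the discriminant -/

section Discriminant

/-- The discriminant of the characteristic polynomial is a polynomial in the entries of the matrix:
it is the resultant of the universal characteristic polynomial and its derivative. -/
theorem exists_discriminant (ι : Type*) [Fintype ι] [DecidableEq ι] [Nonempty ι] :
    ∃ P : MvPolynomial (ι × ι) ℂ, ∀ (M : Matrix ι ι ℂ) (r : ι → ℂ),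
      (∀ x, (M - x • 1).det = ∏ k, (r k - x)) →
      (MvPolynomial.eval (fun ij => M ij.1 ij.2) P = 0 ↔ ¬ Function.Injective r) := by
  set u := Matrix.charpoly.univ ℂ ι
  refine ⟨Polynomial.resultant u u.derivative (Fintype.card ι) (Fintype.card ι - 1),
    fun M r h => ?_⟩
  have hu : u.map (MvPolynomial.eval fun ij : ι × ι => M ij.1 ij.2) = M.charpoly := by
    have := Matrix.charpoly.univ_map_eval₂Hom ι (RingHom.id ℂ) (fun ij : ι × ι => M ij.1 ij.2)
    exact this
  have hM : M.charpoly = ∏ k, (Polynomial.X - Polynomial.C (r k)) := by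
    refine Polynomial.funext fun x => ?_
    rw [Matrix.eval_charpoly, Polynomial.eval_prod]
    have e : M - x • 1 = -(Matrix.scalar ι x - M) := by
      rw [Matrix.scalar_apply, ← Matrix.smul_one_eq_diagonal, neg_sub]
    have h1 := h x
    rw [e, Matrix.det_neg] at h1
    have h2 : ∏ k, (r k - x) = (-1) ^ Fintype.card ι * ∏ k, (x - r k) := by
      rw [← Finset.card_univ, ← Finset.prod_const, ← Finset.prod_mul_distrib]
      exact Finset.prod_congr rfl fun k _ => by ring
    rw [h2] at h1
    simpa using mul_left_cancel₀ (pow_ne_zero _ (by norm_num)) h1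
  have hdeg : M.charpoly.natDegree = Fintype.card ι := Matrix.charpoly_natDegree_eq_dim M
  have hdeg' : M.charpoly.derivative.natDegree = Fintype.card ι - 1 := by
    rw [Polynomial.natDegree_derivative, hdeg]
  rw [← Polynomial.resultant_map_map, ← Polynomial.derivative_map, hu, ← hdeg', ← hdeg,
    Polynomial.resultant_eq_zero_iff]
  have hne : M.charpoly ≠ 0 := (Matrix.charpoly_monic M).ne_zero
  rw [← Polynomial.separable_prod_X_sub_C_iff (f := r), ← hM, Polynomial.separable_def]
  simp [hne]

theorem differentiable_mvPolynomial_eval {σ : Type*} [Finite σ] {f : ℂ → σ → ℂ}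
    (hf : ∀ i, Differentiable ℂ fun z => f z i) (P : MvPolynomial σ ℂ) :
    Differentiable ℂ fun z => MvPolynomial.eval (f z) P := by
  induction P using MvPolynomial.induction_on with
  | C a => simp
  | add p q hp hq => simp only [map_add]; exact hp.add hq
  | mul_X p i hp => simp only [map_mul, MvPolynomial.eval_X]; exact hp.mul (hf i)

theorem prod_sub_eq_zero_of_double {ι : Type*} [Fintype ι] (r : ι → ℂ) {j k : ι} (hjk : j ≠ k) (h : r j = r k) :
    (∏ i, (r i - r k)) = 0 ∧ deriv (fun x => ∏ i, (r i - x)) (r k) = 0 := by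
  classical
  refine ⟨Finset.prod_eq_zero (Finset.mem_univ k) (sub_self _), ?_⟩
  have e : (fun x => ∏ i, (r i - x)) = fun x =>
      (r k - x) ^ 2 * ∏ i ∈ (Finset.univ.erase k).erase j, (r i - x) := by
    funext x
    rw [← Finset.mul_prod_erase _ _ (Finset.mem_univ k),
      ← Finset.mul_prod_erase _ _ (Finset.mem_erase.2 ⟨hjk, Finset.mem_univ j⟩), h, ← mul_assoc, sq]
  have hd : DifferentiableAt ℂ (fun x => ∏ i ∈ (Finset.univ.erase k).erase j, (r i - x)) (r k) :=
    DifferentiableAt.fun_finsetProd fun i _ => by fun_prop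
  have h2 : HasDerivAt (fun x : ℂ => (r k - x) ^ 2) 0 (r k) := by
    refine (((hasDerivAt_id (r k)).const_sub (r k)).pow 2).congr_deriv ?_
    simp
  rw [e, (h2.fun_mul hd.hasDerivAt).deriv]
  simp

theorem deriv_prod_sub_ne_zero {ι : Type*} [Fintype ι] {r : ι → ℂ} {k : ι}
    (hr : ∀ j, r j = r k → j = k) : deriv (fun x => ∏ i, (r i - x)) (r k) ≠ 0 := by
  classical
  have e : (fun x => ∏ i, (r i - x)) = fun x => (r k - x) * ∏ i ∈ Finset.univ.erase k, (r i - x) := by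
    funext x
    rw [← Finset.mul_prod_erase _ _ (Finset.mem_univ k)]
  have hd : DifferentiableAt ℂ (fun x => ∏ i ∈ Finset.univ.erase k, (r i - x)) (r k) :=
    DifferentiableAt.fun_finsetProd fun i _ => by fun_prop
  have h2 : HasDerivAt (fun x : ℂ => r k - x) (-1) (r k) := (hasDerivAt_id (r k)).const_sub (r k)
  rw [e, (h2.fun_mul hd.hasDerivAt).deriv]
  simp only [sub_self, zero_mul, add_zero, neg_mul, one_mul, neg_ne_zero]
  exact Finset.prod_ne_zero_iff.2 fun i hi => sub_ne_zero.2 fun h => (Finset.mem_erase.1 hi).1 (hr i h)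

open scoped ContDiff in
/-- A continuous choice of a simple zero of an entire function is analytic. -/
theorem analyticAt_of_simple_zero {F : ℂ × ℂ → ℂ} (hF : ContDiff ℂ ω F) {ρ : ℝ → ℂ} {μ : ℝ}
    (hρ : ContinuousAt ρ μ) (h0 : ∀ t : ℝ, F (t, ρ t) = 0)
    (h1 : deriv (fun x => F (μ, x)) (ρ μ) ≠ 0) : AnalyticAt ℝ ρ μ := by
  have hc : ContDiffAt ℂ ω F ((μ : ℂ), ρ μ) := hF.contDiffAt
  have hinv : (fderiv ℂ F ((μ : ℂ), ρ μ) ∘L .inr ℂ ℂ ℂ).IsInvertible := by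
    have e : fderiv ℂ F ((μ : ℂ), ρ μ) ∘L .inr ℂ ℂ ℂ =
        ContinuousLinearMap.toSpanSingleton ℂ (deriv (fun x => F (μ, x)) (ρ μ)) := by
      ext
      have h2 : HasDerivAt (fun x => F (μ, x)) (fderiv ℂ F ((μ : ℂ), ρ μ) (0, 1)) (ρ μ) :=
        (hF.differentiable (by simp) _).hasFDerivAt.comp_hasDerivAt (ρ μ)
          ((hasDerivAt_const (ρ μ) (μ : ℂ)).prodMk (hasDerivAt_id (ρ μ)))
      simp [h2.deriv]
    rw [e]
    exact ⟨ContinuousLinearEquiv.unitsEquivAut ℂ (Units.mk0 _ h1), by ext; simp⟩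
  have hω : (ω : WithTop ℕ∞) ≠ 0 := by simp
  have hψ : AnalyticAt ℂ (hc.implicitFunction hω hinv) (μ : ℂ) :=
    (hc.contDiffAt_implicitFunction hω hinv).analyticAt
  have hev := hc.eventually_apply_eq_iff_implicitFunction hω hinv
  have ht : Tendsto (fun t : ℝ => ((t : ℂ), ρ t)) (𝓝 μ) (𝓝 ((μ : ℂ), ρ μ)) :=
    (Complex.continuous_ofReal.continuousAt).prodMk_nhds hρ
  have heq : (fun t : ℝ => hc.implicitFunction hω hinv (t : ℂ)) =ᶠ[𝓝 μ] ρ := by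
    filter_upwards [ht.eventually hev] with t ht
    exact ht.1 (by rw [h0, h0])
  refine AnalyticAt.congr ?_ heq
  exact (hψ.restrictScalars (𝕜 := ℝ)).comp (Complex.ofRealCLM.analyticAt μ)

/-- `x` is a multiple root of the characteristic polynomial `Δ(μ, ·)`. -/
def IsDoubleMultiplier (n : ℕ) (p : Fin n → ℝ → ℝ) (μ x : ℂ) : Prop :=
  charDet n p μ x = 0 ∧ deriv (charDet n p μ) x = 0

theorem isDoubleMultiplier_iff {n : ℕ} {p : Fin n → ℝ → ℝ} {μ : ℂ} {r : Fin (2 * n) → ℂ}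
    (h : ∀ x, charDet n p μ x = ∏ k, (r k - x)) {x : ℂ} :
    IsDoubleMultiplier n p μ x ↔ ∃ j k, j ≠ k ∧ r j = r k ∧ r k = x := by
  have e : charDet n p μ = fun x => ∏ k, (r k - x) := funext h
  rw [IsDoubleMultiplier, e]
  constructor
  · rintro ⟨h0, h1⟩
    obtain ⟨k, -, hk⟩ := Finset.prod_eq_zero_iff.1 h0
    rw [sub_eq_zero] at hk
    subst hk
    by_contra! hno
    exact deriv_prod_sub_ne_zero (fun j hj => by_contra fun hjk => hno j k hjk hj rfl) h1
  · rintro ⟨j, k, hjk, hr, rfl⟩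
    exact prod_sub_eq_zero_of_double r hjk hr

theorem exists_isDoubleMultiplier_iff {n : ℕ} {p : Fin n → ℝ → ℝ} {μ : ℂ} {r : Fin (2 * n) → ℂ}
    (h : ∀ x, charDet n p μ x = ∏ k, (r k - x)) :
    (∃ x, IsDoubleMultiplier n p μ x) ↔ ¬ Function.Injective r := by
  simp only [isDoubleMultiplier_iff h, Function.Injective]
  push Not
  constructor
  · rintro ⟨_, j, k, hjk, hr, -⟩
    exact ⟨j, k, hr, hjk⟩
  · rintro ⟨j, k, hr, hjk⟩
    exact ⟨_, j, k, hjk, hr, rfl⟩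

/-- The real zeros of an entire function are isolated. -/
theorem finite_real_zeros_inter_Icc {f : ℂ → ℂ} (hf : Differentiable ℂ f)
    (hne : ∃ t : ℝ, f t ≠ 0) (c d : ℝ) : ({t : ℝ | f t = 0} ∩ Set.Icc c d).Finite := by
  by_contra hinf
  obtain ⟨x, -, hx⟩ := Set.Infinite.exists_accPt_of_subset_isCompact hinf isCompact_Icc
    Set.inter_subset_right
  have hfr : ∃ᶠ z in 𝓝[≠] (x : ℂ), f z = 0 := by
    have h1 : Tendsto (fun t : ℝ => (t : ℂ)) (𝓝[≠] x) (𝓝[≠] (x : ℂ)) :=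
      tendsto_nhdsWithin_iff.2 ⟨Complex.continuous_ofReal.continuousAt.mono_left nhdsWithin_le_nhds,
        eventually_nhdsWithin_of_forall fun t ht => by simpa using ht⟩
    exact h1.frequently ((accPt_iff_frequently_nhdsNE.1 hx).mono fun t ht => ht.1)
  have hall := AnalyticOnNhd.eqOn_zero_of_preconnected_of_frequently_eq_zero
    (fun z _ => hf.analyticAt z) isPreconnected_univ (Set.mem_univ (x : ℂ)) hfr
  obtain ⟨t, ht⟩ := hne
  exact ht (hall (Set.mem_univ _))

/-- Unless there is a double multiplier for every real `μ`, the `μ` with a double multiplier are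
isolated: they are the real zeros of an entire function, the discriminant of `Δ(μ, ·)`. -/
theorem finite_isDoubleMultiplier_inter_Icc {n : ℕ} (hn : 1 ≤ n) {p : Fin n → ℝ → ℝ}
    (hp : IsAdmissible n p) {r : Fin (2 * n) → ℝ → ℂ}
    (hr : ∀ (μ : ℝ) x, charDet n p μ x = ∏ k, (r k μ - x))
    (hne : ∃ μ : ℝ, ¬ ∃ x, IsDoubleMultiplier n p μ x) (c d : ℝ) :
    ({μ : ℝ | ∃ x, IsDoubleMultiplier n p μ x} ∩ Set.Icc c d).Finite := by
  have : Nonempty (Fin (2 * n)) := ⟨⟨0, by omega⟩⟩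
  obtain ⟨P, hP⟩ := exists_discriminant (Fin (2 * n))
  have hf0 : ∀ μ : ℝ, MvPolynomial.eval (fun ij => monodromy n p μ ij.1 ij.2) P = 0 ↔
      ∃ x, IsDoubleMultiplier n p μ x := fun μ =>
    (hP (monodromy n p μ) (fun k => r k μ) (hr μ)).trans (exists_isDoubleMultiplier_iff (hr μ)).symm
  have hfd := differentiable_mvPolynomial_eval
    (f := fun z (ij : Fin (2 * n) × Fin (2 * n)) => monodromy n p z ij.1 ij.2)
    (fun ij => differentiable_monodromy hn hp ij.1 ij.2) P
  simp only [← hf0] at hne ⊢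
  exact finite_real_zeros_inter_Icc hfd hne c d

end Discriminant

/-! ### Pairs of double multipliers -/

section Pairs

variable {n : ℕ}

theorem finite_resonances (hn : 1 ≤ n) : (resonances n).Finite := by
  have hpos : 0 < 2 * n * 2 := by omega
  refine ((Set.toFinite ({1, -1} : Set ℝ)).prod
    (Polynomial.nthRoots (2 * n * 2) (1 : ℂ)).toFinset.finite_toSet).subset ?_
  rintro ⟨s, ζ⟩ ⟨hs, hζ, -⟩
  refine ⟨hs, ?_⟩
  rw [Finset.mem_coe, Multiset.mem_toFinset, Polynomial.mem_nthRoots hpos]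
  dsimp only at hs hζ ⊢
  rw [pow_mul, hζ, mul_pow, ← pow_mul, mul_comm n 2, pow_mul]
  rcases hs with rfl | rfl <;> simp

/-- The roots of `w^(2n) = s (-1)^n`, which govern `μ → s ∞`, are a rotation of the `ω_k`. -/
theorem exists_enumeration (hn : 1 ≤ n) {ω : Fin (2 * n) → ℂ} (hωi : Function.Injective ω)
    (hω : ∀ k, ω k ^ (2 * n) = (-1) ^ n) {s : ℝ} (hs : s = 1 ∨ s = -1) :
    ∃ w : Fin (2 * n) → ℂ, Function.Injective w ∧ ∀ k, w k ^ (2 * n) = (s : ℂ) * (-1) ^ n := by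
  obtain ⟨θ, hθ⟩ := IsAlgClosed.exists_pow_nat_eq (s : ℂ) (by omega : 0 < 2 * n)
  have hθ0 : θ ≠ 0 := by
    rintro rfl
    rw [zero_pow (by omega)] at hθ
    rcases hs with rfl | rfl <;> norm_num at hθ
  refine ⟨fun k => θ * ω k, fun j k h => hωi (mul_left_cancel₀ hθ0 h), fun k => ?_⟩
  rw [mul_pow, hθ, hω]

theorem abs_norm_div_exp_sub_one_le {x : ℂ} {a l : ℝ} {m : ℕ} :
    |‖x‖ / Real.exp (a * l * Real.pi) - 1| ≤
      ‖x * ((-1) ^ m * Complex.exp (-(a * l * Real.pi))) - 1‖ := by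
  have h := abs_norm_sub_norm_le (x * ((-1) ^ m * Complex.exp (-(a * l * Real.pi)))) 1
  have e : ‖x * ((-1) ^ m * Complex.exp (-(a * l * Real.pi)))‖ =
      ‖x‖ / Real.exp (a * l * Real.pi) := by
    have : (-(a * l * Real.pi) : ℂ) = ((-(a * l * Real.pi) : ℝ) : ℂ) := by push_cast; ring
    rw [norm_mul, norm_mul, norm_pow, norm_neg, norm_one, one_pow, one_mul, this,
      Complex.norm_exp_ofReal, Real.exp_neg, div_eq_mul_inv]
  rwa [e, norm_one] at h

/-- A double multiplier at `μ = s l^(2n)` with `l` large belongs to a resonance `(s, ζ)` and an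
integer `m`: `l` is close to `m / Im ζ` and the multiplier is close to `(-1)^m e^{lπ Re ζ}`. -/
theorem exists_resonance_near (hn : 1 ≤ n) {p : Fin n → ℝ → ℝ} (hp : IsAdmissible n p)
    {w : Fin (2 * n) → ℂ} (hwi : Function.Injective w) {s : ℝ} (hs : s = 1 ∨ s = -1)
    (hw : ∀ k, w k ^ (2 * n) = (s : ℂ) * (-1) ^ n) {ε : ℝ} (hε : 0 < ε) :
    ∃ Λ : ℝ, ∀ l : ℝ, Λ ≤ l → ∀ x, IsDoubleMultiplier n p (s * (l : ℂ) ^ (2 * n)) x →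
      ∃ (ζ : ℂ) (m : ℕ), (s, ζ) ∈ resonances n ∧ |l - m / ζ.im| ≤ ε ∧
        ‖x * ((-1) ^ m * Complex.exp (-(ζ.re * l * Real.pi))) - 1‖ ≤ ε := by
  have hκ : (s : ℂ) = 1 ∨ (s : ℂ) = -1 := by rcases hs with rfl | rfl <;> simp
  obtain ⟨Λ, hΛ⟩ := exists_multipliers_near hn hp hκ hwi hw hε
  refine ⟨Λ, fun l hl x hx => ?_⟩
  obtain ⟨r, hr, -, h⟩ := hΛ l hl
  obtain ⟨j, k, hjk, hrjk, rfl⟩ := (isDoubleMultiplier_iff hr).1 hx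
  obtain ⟨i, m, hi, h1, h2⟩ := h j k hjk hrjk
  exact ⟨w i, m, ⟨hs, hw i, hi⟩, h1, h2⟩

/-- The resonance and the integer of a double multiplier are determined by a rough approximation
(the modulus gives `Re ζ`, hence `ζ`, and then `l` gives `m`), so the rough approximation is
automatically a good one. -/
theorem exists_resonance_close (hn : 1 ≤ n) {p : Fin n → ℝ → ℝ} (hp : IsAdmissible n p)
    {w : Fin (2 * n) → ℂ} (hwi : Function.Injective w) {s : ℝ} (hs : s = 1 ∨ s = -1)
    (hw : ∀ k, w k ^ (2 * n) = (s : ℂ) * (-1) ^ n) {ε : ℝ} (hε : 0 < ε) :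
    ∃ Λ : ℝ, ∀ l : ℝ, Λ ≤ l → ∀ x, IsDoubleMultiplier n p (s * (l : ℂ) ^ (2 * n)) x →
      ∀ (ζ : ℂ) (m : ℕ), (s, ζ) ∈ resonances n → |l - m / ζ.im| ≤ 1 / 4 →
        ‖x * ((-1) ^ m * Complex.exp (-(ζ.re * l * Real.pi))) - 1‖ ≤ 1 / 4 →
        |l - m / ζ.im| ≤ ε := by
  have hκ : (s : ℂ) = 1 ∨ (s : ℂ) = -1 := by rcases hs with rfl | rfl <;> simp
  obtain ⟨Λ₁, hΛ₁⟩ := exists_resonance_near hn hp hwi hs hw (lt_min hε (by norm_num : (0 : ℝ) < 1 / 4))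
  obtain ⟨Λ₂, hΛ₂⟩ := exists_forall_re_eq w
  refine ⟨max Λ₁ Λ₂, fun l hl x hx ζ m hζ hm hxm => ?_⟩
  obtain ⟨ζ', m', hζ', hm', hxm'⟩ := hΛ₁ l ((le_max_left _ _).trans hl) x hx
  obtain ⟨i, rfl⟩ := exists_eq_of_pow_eq hn hwi hw hζ.2.1
  obtain ⟨i', rfl⟩ := exists_eq_of_pow_eq hn hwi hw hζ'.2.1
  have hre : (w i).re = (w i').re := hΛ₂ l ((le_max_right _ _).trans hl) ‖x‖ i i'
    (abs_norm_div_exp_sub_one_le.trans hxm)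
    (abs_norm_div_exp_sub_one_le.trans (hxm'.trans (min_le_right _ _)))
  have hn1 : ∀ j, ‖w j‖ = 1 := fun j => norm_eq_one_of_pow_eq hn hκ (hw j)
  have hpos : 0 < (w i).im := hζ.2.2
  have hpos' : 0 < (w i').im := hζ'.2.2
  have heq : w i = w i' := (eq_or_eq_conj_of_re_eq (hn1 i) (hn1 i') hre).resolve_right fun h => by
    have := congrArg Complex.im h
    rw [Complex.conj_im] at this
    linarith
  rw [← heq] at hm'
  have him : (w i).im ≤ 1 := (le_abs_self _).trans ((Complex.abs_im_le_norm _).trans (hn1 i).le)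
  have hmm : m = m' := by
    have h1 : |(m : ℝ) / (w i).im - m' / (w i).im| ≤ 1 / 2 := by
      have := abs_sub_le ((m : ℝ) / (w i).im) l (m' / (w i).im)
      rw [abs_sub_comm _ l] at this
      linarith [min_le_right ε (1 / 4)]
    rw [← sub_div, abs_div, abs_of_pos hpos, div_le_iff₀ hpos] at h1
    have h2 : |((m : ℤ) - (m' : ℤ) : ℤ)| < 1 := by
      have : |(((m : ℤ) - (m' : ℤ) : ℤ) : ℝ)| < 1 := by push_cast; linarith
      exact_mod_cast this
    have := Int.abs_lt_one_iff.1 h2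
    omega
  subst hmm
  exact hm'.trans (min_le_left _ _)

theorem exists_eq_pair_of_not_three {S : Set ℝ} (hS : S.Nonempty)
    (h : ∀ x ∈ S, ∀ y ∈ S, ∀ z ∈ S, x < y → y < z → False) : ∃ a b, S = {a, b} := by
  obtain ⟨x, hx⟩ := hS
  by_cases h1 : ∃ y ∈ S, y ≠ x
  · obtain ⟨y, hy, hyx⟩ := h1
    refine ⟨x, y, Set.Subset.antisymm (fun z hz => ?_) ?_⟩
    · by_contra hne
      rw [Set.mem_insert_iff, Set.mem_singleton_iff, not_or] at hne
      rcases lt_or_gt_of_ne hyx with h1 | h1 <;> rcases lt_or_gt_of_ne hne.1 with h2 | h2 <;>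
        rcases lt_or_gt_of_ne hne.2 with h3 | h3
      · exact h z hz y hy x hx h3 h1
      · exact h y hy z hz x hx h3 h2
      · exact absurd (h2.trans h3) h1.not_gt
      · exact h y hy x hx z hz h1 h2
      · exact h z hz x hx y hy h2 h1
      · exact absurd (h3.trans h2) h1.not_gt
      · exact h x hx z hz y hy h2 h3
      · exact h x hx y hy z hz h1 h3
    · rintro z (rfl | rfl) <;> assumption
  · push Not at h1
    exact ⟨x, x, by
      rw [Set.pair_eq_singleton]
      exact Set.Subset.antisymm (fun z hz => h1 z hz) (by simpa using hx)⟩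

/-- Beyond some `Λ`, the points `l` such that `s l^(2n)` has a double multiplier are distributed over
sets `T (s, ζ) m` of at most two elements, which shrink to `m / Im ζ` as `m → ∞`. -/
theorem exists_pairs (hn : 1 ≤ n) {p : Fin n → ℝ → ℝ} (hp : IsAdmissible n p)
    {ω : Fin (2 * n) → ℂ} (hωi : Function.Injective ω) (hω : ∀ k, ω k ^ (2 * n) = (-1) ^ n) :
    ∃ Λ > 0, ∃ T : ℝ × ℂ → ℕ → Set ℝ,
      (∀ q ∈ resonances n, ∀ m, (T q m).Nonempty → 1 ≤ m ∧ ∃ a b, T q m = {a, b}) ∧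
      (∀ q ∈ resonances n, ∀ m, ∀ l ∈ T q m,
        Λ ≤ l ∧ ∃ x, IsDoubleMultiplier n p (q.1 * (l : ℂ) ^ (2 * n)) x) ∧
      (∀ s : ℝ, (s = 1 ∨ s = -1) → ∀ l : ℝ, Λ ≤ l → ∀ x,
        IsDoubleMultiplier n p (s * (l : ℂ) ^ (2 * n)) x → ∃ q ∈ resonances n, q.1 = s ∧
          ∃ m, l ∈ T q m) ∧
      ∀ q ∈ resonances n, ∀ ε > 0, ∀ᶠ m : ℕ in atTop, ∀ l ∈ T q m, |l - m / q.2.im| ≤ ε := by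
  have hfin := finite_resonances hn
  choose! w hwi hw using fun (s : ℝ) (hs : s = 1 ∨ s = -1) => exists_enumeration hn hωi hω hs
  -- a common radius `δ` and a common bound `m₀` for all resonances
  obtain ⟨δ, hδ0, hδ4, m₀, h3⟩ : ∃ δ > 0, δ ≤ 1 / 4 ∧ ∃ m₀ : ℕ, ∀ q ∈ resonances n, ∀ m ≥ m₀,
      ∀ (l : Fin 3 → ℝ) (x : Fin 3 → ℂ), l 0 < l 1 → l 1 < l 2 →
        (∀ i, |l i - m / q.2.im| ≤ δ) →
        (∀ i, ‖x i * ((-1) ^ m * Complex.exp (-(q.2.re * l i * Real.pi))) - 1‖ ≤ δ) →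
        (∀ i, IsDoubleMultiplier n p (q.1 * (l i : ℂ) ^ (2 * n)) (x i)) → False := by
    have h1 : ∀ q ∈ resonances n, ∃ δ > 0, ∃ m₀ : ℕ, ∀ m ≥ m₀,
        ∀ (l : Fin 3 → ℝ) (x : Fin 3 → ℂ), l 0 < l 1 → l 1 < l 2 →
          (∀ i, |l i - m / q.2.im| ≤ δ) →
          (∀ i, ‖x i * ((-1) ^ m * Complex.exp (-(q.2.re * l i * Real.pi))) - 1‖ ≤ δ) →
          (∀ i, IsDoubleMultiplier n p (q.1 * (l i : ℂ) ^ (2 * n)) (x i)) → False := by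
      rintro ⟨s, ζ⟩ ⟨hs, hζ, hpos⟩
      dsimp only at hs hζ hpos ⊢
      obtain ⟨k, rfl⟩ := exists_eq_of_pow_eq hn (hwi s hs) (hw s hs) hζ
      obtain ⟨δ, hδ, m₀, h⟩ := exists_not_three_double_multipliers hn hp
        (by rcases hs with rfl | rfl <;> simp) (hwi s hs) (hw s hs) hpos
      exact ⟨δ, hδ, m₀, fun m hm l x h01 h12 hl hx hd =>
        h m hm l x h01 h12 hl hx (fun i => (hd i).1) fun i => (hd i).2⟩
    choose! δ hδ m₀ h using h1
    have hev : ∀ᶠ d : ℝ in 𝓝[>] 0, ∀ q ∈ resonances n, d ≤ δ q :=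
      (eventually_all_finite hfin).2 fun q hq =>
        (eventually_le_nhds (hδ q hq)).filter_mono nhdsWithin_le_nhds
    obtain ⟨d, ⟨hd, hd4⟩, hd0⟩ := ((hev.and ((eventually_le_nhds
      (by norm_num : (0 : ℝ) < 1 / 4)).filter_mono nhdsWithin_le_nhds)).and
      self_mem_nhdsWithin).exists
    obtain ⟨M, hM⟩ := ((eventually_all_finite hfin).2 fun q _ => eventually_ge_atTop (m₀ q)).exists
    exact ⟨d, hd0, hd4, M, fun q hq m hm l x h01 h12 hl hx =>
      h q hq m ((hM q hq).trans hm) l x h01 h12 (fun i => (hl i).trans (hd q hq))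
        fun i => (hx i).trans (hd q hq)⟩
  obtain ⟨Λ, hΛ0, hΛm, hΛ⟩ : ∃ Λ > 0, (∀ l ≥ Λ, ∀ q ∈ resonances n, ∀ m : ℕ,
      |l - m / q.2.im| ≤ δ → max m₀ 1 ≤ m) ∧ ∀ s : ℝ, (s = 1 ∨ s = -1) → ∀ l : ℝ, Λ ≤ l → ∀ x,
        IsDoubleMultiplier n p (s * (l : ℂ) ^ (2 * n)) x → ∃ (ζ : ℂ) (m : ℕ),
          (s, ζ) ∈ resonances n ∧ |l - m / ζ.im| ≤ δ ∧
          ‖x * ((-1) ^ m * Complex.exp (-(ζ.re * l * Real.pi))) - 1‖ ≤ δ := by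
    choose! Λ hΛ using fun (s : ℝ) (hs : s = 1 ∨ s = -1) =>
      exists_resonance_near hn hp (hwi s hs) hs (hw s hs) hδ0
    obtain ⟨X, hX⟩ := ((eventually_all_finite hfin).2 fun q _ =>
      eventually_ge_atTop (((max m₀ 1 : ℕ) : ℝ) / q.2.im + δ)).exists
    refine ⟨max (max X 1) (max (Λ 1) (Λ (-1))), lt_max_of_lt_left (lt_max_of_lt_right one_pos),
      fun l hl q hq m hm => ?_, fun s hs l hl => ?_⟩
    · have h1 := (hX q hq).trans ((le_max_left _ _).trans ((le_max_left _ _).trans hl))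
      have h2 := (abs_le.1 hm).2
      have h4 : ((max m₀ 1 : ℕ) : ℝ) / q.2.im ≤ m / q.2.im := by linarith
      rw [div_le_div_iff_of_pos_right hq.2.2] at h4
      exact_mod_cast h4
    · refine hΛ s hs l (le_trans ?_ ((le_max_right _ _).trans hl))
      rcases hs with rfl | rfl
      · exact le_max_left _ _
      · exact le_max_right _ _
  refine ⟨Λ, hΛ0, fun q m => {l | (max m₀ 1 ≤ m ∧ Λ ≤ l ∧ |l - m / q.2.im| ≤ δ) ∧
    ∃ x, IsDoubleMultiplier n p (q.1 * (l : ℂ) ^ (2 * n)) x ∧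
      ‖x * ((-1) ^ m * Complex.exp (-(q.2.re * l * Real.pi))) - 1‖ ≤ δ}, fun q hq m hT => ?_,
    fun q _ m l hl => ⟨hl.1.2.1, hl.2.imp fun x hx => hx.1⟩, fun s hs l hl x hx => ?_,
    fun q hq ε hε => ?_⟩
  · have hm : max m₀ 1 ≤ m := hT.some_mem.1.1
    refine ⟨(le_max_right _ _).trans hm, exists_eq_pair_of_not_three hT ?_⟩
    rintro l₀ ⟨⟨-, -, a₀⟩, x₀, d₀, b₀⟩ l₁ ⟨⟨-, -, a₁⟩, x₁, d₁, b₁⟩ l₂ ⟨⟨-, -, a₂⟩, x₂, d₂, b₂⟩ h01 h12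
    refine h3 q hq m ((le_max_left _ _).trans hm) ![l₀, l₁, l₂] ![x₀, x₁, x₂] h01 h12 ?_ ?_ ?_ <;>
      intro i <;> fin_cases i <;> assumption
  · obtain ⟨ζ, m, hζ, h1, h2⟩ := hΛ s hs l hl x hx
    exact ⟨(s, ζ), hζ, rfl, m, ⟨hΛm l hl _ hζ m h1, hl, h1⟩, x, hx, h2⟩
  · obtain ⟨s, ζ⟩ := q
    have hs : s = 1 ∨ s = -1 := hq.1
    obtain ⟨Λ', hΛ'⟩ := exists_resonance_close hn hp (hwi s hs) hs (hw s hs) hε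
    have hx : Tendsto (fun m : ℕ => (m : ℝ) / ζ.im - δ) atTop atTop :=
      tendsto_atTop_add_const_right _ _ (tendsto_natCast_atTop_atTop.atTop_div_const hq.2.2)
    filter_upwards [hx.eventually (eventually_ge_atTop Λ')] with m hm l hl
    obtain ⟨⟨-, -, h1⟩, x, hd, h2⟩ := hl
    exact hΛ' l (by linarith [(abs_le.1 h1).1]) x hd ζ m hq (h1.trans hδ4) (h2.trans hδ4)

end Pairs

/-! ### Continuous branches of the multipliers -/

section Branches

variable {n : ℕ}

theorem exists_perm_of_prod_const_sub_eq {ι : Type*} [Fintype ι] {r s : ι → ℂ}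
    (h : ∀ x, ∏ k, (r k - x) = ∏ k, (s k - x)) : ∃ σ : Equiv.Perm ι, r = s ∘ σ := by
  refine exists_perm_of_prod_sub_eq fun x => ?_
  have e : ∀ r : ι → ℂ, ∏ k, (x - r k) = (-1) ^ Fintype.card ι * ∏ k, (r k - x) := fun r => by
    rw [← Finset.card_univ, ← Finset.prod_const, ← Finset.prod_mul_distrib]
    exact Finset.prod_congr rfl fun k _ => by ring
  rw [e, e, h]

/-- The multipliers are continuous functions of `μ ∈ ℝ`, and can be labelled by their growth as
`μ → +∞`: the annuli about the circles of radius `e^{lπ Re ω_j}` are disjoint for large `l`, so a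
continuous branch stays in one of them. -/
theorem exists_continuous_multipliers (hn : 1 ≤ n) {p : Fin n → ℝ → ℝ} (hp : IsAdmissible n p)
    {ω : Fin (2 * n) → ℂ} (hωi : Function.Injective ω) (hω : ∀ k, ω k ^ (2 * n) = (-1) ^ n) :
    ∃ ρ : Fin (2 * n) → ℝ → ℂ, (∀ (μ : ℝ) x, charDet n p μ x = ∏ k, (ρ k μ - x)) ∧
      (∀ k, Continuous (ρ k)) ∧
      ∀ k, Tendsto (fun t : ℝ => ‖ρ k (t ^ (2 * n))‖ / Real.exp ((ω k).re * t * Real.pi))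
        atTop (𝓝 1) := by
  have hA : Continuous fun μ : ℝ => monodromy n p μ := continuous_matrix fun i j =>
    (differentiable_monodromy hn hp i j).continuous.comp Complex.continuous_ofReal
  obtain ⟨r, hrc, hr⟩ := exists_continuous_eigenvalues hA
  have hnear : ∀ ε > 0, ∃ Λ : ℝ, ∀ l ≥ Λ, ∃ σ : Equiv.Perm (Fin (2 * n)), ∀ k,
      |‖r k (l ^ (2 * n))‖ / Real.exp ((ω (σ k)).re * l * Real.pi) - 1| ≤ ε := by
    intro ε hε
    obtain ⟨Λ, hΛ⟩ := exists_multipliers_near hn hp (Or.inl rfl) hωi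
      (fun k => (hω k).trans (one_mul _).symm) hε
    refine ⟨Λ, fun l hl => ?_⟩
    obtain ⟨s, hs, hs1, -⟩ := hΛ l hl
    obtain ⟨σ, hσ⟩ := exists_perm_of_prod_const_sub_eq (r := fun k => r k (l ^ (2 * n))) (s := s)
      fun x => by
        rw [← hs, ← hr, one_mul, ← Complex.ofReal_pow]
        rfl
    refine ⟨σ, fun k => ?_⟩
    have := congrFun hσ k
    dsimp only [Function.comp_apply] at this
    rw [this]
    exact hs1 (σ k)
  obtain ⟨Λ₁, hΛ₁⟩ := hnear (1 / 4) (by norm_num)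
  obtain ⟨Λ₂, hΛ₂⟩ := exists_forall_re_eq ω
  set Λ := max Λ₁ Λ₂
  -- the labels are read off at `Λ`
  obtain ⟨τ, hτ⟩ := hΛ₁ Λ (le_max_left _ _)
  have hcont : ∀ k j, Continuous fun l : ℝ =>
      |‖r k (l ^ (2 * n))‖ / Real.exp ((ω j).re * l * Real.pi) - 1| := fun k j => by
    have := hrc k
    exact (((this.comp (continuous_pow (2 * n))).norm.div (by fun_prop)
      fun l => (Real.exp_pos _).ne').sub continuous_const).abs
  -- by connectedness of `[Λ, ∞)` the modulus of a branch stays comparable with its exponential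
  have hstay : ∀ k, ∀ l ≥ Λ,
      |‖r k (l ^ (2 * n))‖ / Real.exp ((ω (τ k)).re * l * Real.pi) - 1| ≤ 1 / 4 := by
    intro k l hl
    have hcov : ∀ l ≥ Λ, |‖r k (l ^ (2 * n))‖ / Real.exp ((ω (τ k)).re * l * Real.pi) - 1| ≤ 1 / 4 ∨
        ∃ j, (ω j).re ≠ (ω (τ k)).re ∧
          |‖r k (l ^ (2 * n))‖ / Real.exp ((ω j).re * l * Real.pi) - 1| ≤ 1 / 4 := by
      intro l hl
      obtain ⟨σ, hσ⟩ := hΛ₁ l ((le_max_left _ _).trans hl)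
      by_cases hj : (ω (σ k)).re = (ω (τ k)).re
      · exact Or.inl (hj ▸ hσ k)
      · exact Or.inr ⟨σ k, hj, hσ k⟩
    by_contra hno
    have hcl : IsClosed (⋃ j ∈ {j | (ω j).re ≠ (ω (τ k)).re},
        {l : ℝ | |‖r k (l ^ (2 * n))‖ / Real.exp ((ω j).re * l * Real.pi) - 1| ≤ 1 / 4}) :=
      (Set.toFinite _).isClosed_biUnion fun j _ => isClosed_le (hcont k j) continuous_const
    obtain ⟨x, hx, hx1, hx2⟩ := isPreconnected_closed_iff.1 (isPreconnected_Ici (a := Λ))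
      {l | |‖r k (l ^ (2 * n))‖ / Real.exp ((ω (τ k)).re * l * Real.pi) - 1| ≤ 1 / 4} _
      (isClosed_le (hcont k (τ k)) continuous_const) hcl
      (fun l hl => (hcov l hl).imp id fun ⟨j, hj, h⟩ => Set.mem_biUnion hj h)
      ⟨Λ, Set.mem_Ici.2 le_rfl, hτ k⟩
      ⟨l, hl, by
        obtain ⟨j, hj, h⟩ := (hcov l hl).resolve_left hno
        exact Set.mem_biUnion hj h⟩
    obtain ⟨j, hj, h⟩ := Set.mem_iUnion₂.1 hx2
    exact hj (hΛ₂ x ((le_max_right _ _).trans hx) _ _ _ h hx1)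
  refine ⟨fun k => r (τ.symm k), fun μ x => ?_, fun k => hrc _, fun k => ?_⟩
  · rw [Equiv.prod_comp τ.symm fun k => r k μ - x]
    exact hr μ x
  · refine Metric.tendsto_atTop.2 fun ε hε => ?_
    obtain ⟨Λ₃, hΛ₃⟩ := hnear (min (ε / 2) (1 / 4)) (by positivity)
    refine ⟨max Λ Λ₃, fun l hl => ?_⟩
    have hlΛ := (le_max_left _ _).trans hl
    obtain ⟨σ, hσ⟩ := hΛ₃ l ((le_max_right _ _).trans hl)
    have h1 := hstay (τ.symm k) l hlΛ
    have h2 := hσ (τ.symm k)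
    have h3 := hΛ₂ l ((le_max_right _ _).trans hlΛ) _ _ _ h1 (h2.trans (min_le_right _ _))
    rw [Equiv.apply_symm_apply] at h3
    rw [← h3] at h2
    rw [Real.dist_eq]
    linarith [min_le_left (ε / 2) (1 / 4)]

theorem signedRoot_mul_pow (hn : 1 ≤ n) {s : ℝ} (hs : s = 1 ∨ s = -1) {l : ℝ} (hl : 0 ≤ l) :
    signedRoot n (s * l ^ (2 * n)) = s * l := by
  have h2 : (2 * n : ℝ) = ((2 * n : ℕ) : ℝ) := by push_cast; ring
  have hroot : |s * l ^ (2 * n)| ^ (1 / (2 * n : ℝ)) = l := by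
    have : |s| = 1 := by rcases hs with rfl | rfl <;> simp
    rw [abs_mul, this, one_mul, abs_of_nonneg (pow_nonneg hl _), h2, one_div]
    exact Real.pow_rpow_inv_natCast hl (by omega)
  rw [signedRoot, hroot]
  rcases hl.eq_or_lt with rfl | hl
  · simp
  · have hp : 0 < l ^ (2 * n) := pow_pos hl _
    rcases hs with rfl | rfl
    · rw [one_mul, Real.sign_of_pos hp]
    · rw [Real.sign_of_neg (by linarith)]

theorem signedRoot_modelPoint (hn : 1 ≤ n) {q : ℝ × ℂ} (hq : q ∈ resonances n) (m : ℕ) :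
    signedRoot n (modelPoint n q m) = q.1 * (m / q.2.im) := by
  rw [modelPoint, mul_div_assoc, ← div_pow]
  exact signedRoot_mul_pow hn hq.1 (div_nonneg (Nat.cast_nonneg m) hq.2.2.le)

theorem exists_eq_sign_mul_pow (hn : 1 ≤ n) {Λ μ : ℝ} (h : Λ ^ (2 * n) < |μ|) :
    ∃ s l : ℝ, (s = 1 ∨ s = -1) ∧ Λ ≤ l ∧ μ = s * l ^ (2 * n) := by
  have hpow : (|μ| ^ ((2 * n : ℕ) : ℝ)⁻¹) ^ (2 * n) = |μ| :=
    Real.rpow_inv_natCast_pow (abs_nonneg μ) (by omega)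
  have hl : Λ ≤ |μ| ^ ((2 * n : ℕ) : ℝ)⁻¹ := by
    refine le_of_pow_le_pow_left₀ (by omega : 2 * n ≠ 0) (by positivity) ?_
    rw [hpow]; exact h.le
  rcases le_total 0 μ with h0 | h0
  · exact ⟨1, _, Or.inl rfl, hl, by rw [hpow, abs_of_nonneg h0, one_mul]⟩
  · exact ⟨-1, _, Or.inr rfl, hl, by rw [hpow, abs_of_nonpos h0]; ring⟩

/-- The set of real `μ` with a double multiplier consists of pairs close to the model points; in
particular it is locally finite. -/
theorem inPairsCloseToModel_isDoubleMultiplier (hn : 1 ≤ n) {p : Fin n → ℝ → ℝ}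
    (hp : IsAdmissible n p) {ω : Fin (2 * n) → ℂ} (hωi : Function.Injective ω)
    (hω : ∀ k, ω k ^ (2 * n) = (-1) ^ n) {r : Fin (2 * n) → ℝ → ℂ}
    (hr : ∀ (μ : ℝ) x, charDet n p μ x = ∏ k, (r k μ - x)) :
    (∀ c d : ℝ, ({μ : ℝ | ∃ x, IsDoubleMultiplier n p μ x} ∩ Set.Icc c d).Finite) ∧
      InPairsCloseToModel n {μ : ℝ | ∃ x, IsDoubleMultiplier n p μ x} := by
  obtain ⟨Λ, hΛ0, T, hT1, hT2, hT3, hT4⟩ := exists_pairs hn hp hωi hω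
  set D := {μ : ℝ | ∃ x, IsDoubleMultiplier n p μ x} with hD
  have hfin := finite_resonances hn
  have hmem : ∀ s l : ℝ, s * l ^ (2 * n) ∈ D ↔
      ∃ x, IsDoubleMultiplier n p (s * (l : ℂ) ^ (2 * n)) x := fun s l => by
    rw [hD, Set.mem_ofPred_eq, Complex.ofReal_mul, Complex.ofReal_pow]
  have hlarge : ∀ μ ∈ D, Λ ^ (2 * n) < |μ| → ∃ q ∈ resonances n, ∃ m, ∃ l ∈ T q m,
      μ = q.1 * l ^ (2 * n) := by
    intro μ hμ hμΛ
    obtain ⟨s, l, hs, hl, rfl⟩ := exists_eq_sign_mul_pow hn hμΛ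
    obtain ⟨x, hx⟩ := (hmem s l).1 hμ
    obtain ⟨q, hq, rfl, m, hm⟩ := hT3 s hs l hl x hx
    exact ⟨q, hq, m, l, hm, rfl⟩
  have hTfin : ∀ q ∈ resonances n, ∀ m, (T q m).Finite := fun q hq m => by
    rcases (T q m).eq_empty_or_nonempty with h | h
    · rw [h]; exact Set.finite_empty
    · obtain ⟨-, a, b, h⟩ := hT1 q hq m h
      rw [h]; exact Set.toFinite _
  -- large points of `D` form a countable set, so `D` is not the whole line
  have hne : ∃ μ : ℝ, ¬ ∃ x, IsDoubleMultiplier n p μ x := by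
    by_contra! hall
    have hsub : Set.Ioi (Λ ^ (2 * n)) ⊆
        ⋃ q ∈ resonances n, ⋃ m : ℕ, (fun l : ℝ => q.1 * l ^ (2 * n)) '' T q m := by
      intro μ hμ
      obtain ⟨q, hq, m, l, hl, e⟩ := hlarge μ (hall μ) (lt_of_lt_of_le hμ (le_abs_self μ))
      exact Set.mem_biUnion hq (Set.mem_iUnion.2 ⟨m, l, hl, e.symm⟩)
    have hc : (⋃ q ∈ resonances n, ⋃ m : ℕ,
        (fun l : ℝ => q.1 * l ^ (2 * n)) '' T q m).Countable :=
      hfin.countable.biUnion fun q hq => Set.countable_iUnion fun m =>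
        ((hTfin q hq m).image _).countable
    have h0 := (hc.mono hsub).measure_zero volume
    rw [Real.volume_Ioi] at h0
    exact ENNReal.top_ne_zero h0
  have hDfin := finite_isDoubleMultiplier_inter_Icc hn hp hr hne
  refine ⟨hDfin, ?_⟩
  classical
  choose! hT1m a b hab using hT1
  -- an index whose set `T q m` is empty gets the model point itself and is left out of the union
  set A : ℝ × ℂ → ℕ → ℝ := fun q m =>
    if (T q m).Nonempty then q.1 * a q m ^ (2 * n) else modelPoint n q m with hA
  set B : ℝ × ℂ → ℕ → ℝ := fun q m =>
    if (T q m).Nonempty then q.1 * b q m ^ (2 * n) else modelPoint n q m with hB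
  -- both members of a pair converge to the model point
  have hlim : ∀ q ∈ resonances n, ∀ c : ℝ × ℂ → ℕ → ℝ, (∀ m, (T q m).Nonempty → c q m ∈ T q m) →
      Tendsto (fun m => signedRoot n
        (if (T q m).Nonempty then q.1 * c q m ^ (2 * n) else modelPoint n q m) -
        signedRoot n (modelPoint n q m)) atTop (𝓝 0) := by
    intro q hq c hc
    refine Metric.tendsto_nhds.2 fun ε hε => ?_
    filter_upwards [hT4 q hq (ε / 2) (half_pos hε)] with m hm
    rw [dist_zero_right, Real.norm_eq_abs]
    split_ifs with h
    · have hl := hc m h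
      have hs : |q.1| = 1 := by rcases hq.1 with h | h <;> rw [h] <;> simp
      rw [signedRoot_mul_pow hn hq.1 (hΛ0.le.trans (hT2 q hq m _ hl).1),
        signedRoot_modelPoint hn hq, ← mul_sub, abs_mul, hs, one_mul]
      linarith [hm _ hl]
    · rwa [sub_self, abs_zero]
  refine ⟨D ∩ Set.Icc (-Λ ^ (2 * n)) (Λ ^ (2 * n)),
    {i | i.1 ∈ resonances n ∧ (T i.1 i.2).Nonempty}, A, B, hDfin _ _,
    fun i hi => ⟨hi.1, hT1m _ hi.1 _ hi.2⟩, fun q hq => ⟨hlim q hq a fun m hm => ?_,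
      hlim q hq b fun m hm => ?_⟩, ?_⟩
  · rw [hab q hq m hm]; exact Set.mem_insert _ _
  · rw [hab q hq m hm]; exact Set.mem_insert_of_mem _ rfl
  · refine Set.Subset.antisymm (fun μ hμ => ?_) (Set.union_subset Set.inter_subset_left ?_)
    · rcases le_or_gt |μ| (Λ ^ (2 * n)) with h | h
      · exact Or.inl ⟨hμ, abs_le.1 h⟩
      · obtain ⟨q, hq, m, l, hl, rfl⟩ := hlarge μ hμ h
        refine Or.inr (Set.mem_biUnion (x := (q, m)) ⟨hq, ⟨l, hl⟩⟩ ?_)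
        have hne : (T q m).Nonempty := ⟨l, hl⟩
        rw [hab q hq m hne] at hl
        simp only [hA, hB, if_pos hne]
        rcases hl with rfl | rfl
        · exact Set.mem_insert _ _
        · exact Set.mem_insert_of_mem _ rfl
    · refine Set.iUnion₂_subset ?_
      rintro ⟨q, m⟩ ⟨hq, hne⟩ μ hμ
      dsimp only at hq hne hμ
      simp only [hA, hB, if_pos hne] at hμ
      rcases hμ with rfl | rfl
      · exact (hmem _ _).2 (hT2 q hq m _ (by rw [hab q hq m hne]; exact Set.mem_insert _ _)).2
      · exact (hmem _ _).2 (hT2 q hq m _ (by rw [hab q hq m hne]; exact Set.mem_insert_of_mem _ rfl)).2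

end Branches

end PeriodicOperator

theorem theorem6 (n : ℕ) (hn : 1 ≤ n) (p : Fin n → ℝ → ℝ)
    (hp : PeriodicOperator.IsAdmissible n p)
    (ω : Fin (2 * n) → ℂ) (hω_inj : Function.Injective ω)
    (hω : ∀ k, ω k ^ (2 * n) = (-1) ^ n) :
    ∃ ρ : Fin (2 * n) → ℝ → ℂ,
      (∀ k, ∀ μ : ℝ, PeriodicOperator.charDet n p (μ : ℂ) (ρ k μ) = 0) ∧
      (∀ k, Continuous (ρ k)) ∧
      (∀ k, Tendsto (fun t : ℝ => ‖ρ k (t ^ (2 * n))‖ / Real.exp ((ω k).re * t * Real.pi))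
        atTop (𝓝 1)) ∧
      ∃ D : Set ℝ,
        (∀ μ : ℝ, μ ∉ D → Function.Injective (fun k => ρ k μ) ∧ ∀ k, AnalyticAt ℝ (ρ k) μ) ∧
        (∀ μ : ℝ, μ ∈ D → ∃ j k, j ≠ k ∧ ρ j μ = ρ k μ) ∧
        (∀ c d : ℝ, (D ∩ Set.Icc c d).Finite) ∧
        PeriodicOperator.InPairsCloseToModel n D := by
  obtain ⟨ρ, hρ, hρc, hρl⟩ := PeriodicOperator.exists_continuous_multipliers hn hp hω_inj hω
  have h0 : ∀ k, ∀ μ : ℝ, PeriodicOperator.charDet n p (μ : ℂ) (ρ k μ) = 0 := fun k μ => by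
    rw [hρ]
    exact Finset.prod_eq_zero (Finset.mem_univ k) (sub_self _)
  obtain ⟨hfin, hpairs⟩ :=
    PeriodicOperator.inPairsCloseToModel_isDoubleMultiplier hn hp hω_inj hω hρ
  refine ⟨ρ, h0, hρc, hρl, {μ : ℝ | ∃ x, PeriodicOperator.IsDoubleMultiplier n p μ x},
    fun μ hμ => ⟨?_, fun k => ?_⟩, fun μ hμ => ?_, hfin, hpairs⟩
  · exact not_not.1 fun h => hμ ((PeriodicOperator.exists_isDoubleMultiplier_iff (hρ μ)).2 h)
  · exact PeriodicOperator.analyticAt_of_simple_zero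
      (F := fun q : ℂ × ℂ => PeriodicOperator.charDet n p q.1 q.2)
      (PeriodicOperator.contDiff_charDet hn hp) (hρc k).continuousAt (h0 k)
      fun h => hμ ⟨ρ k μ, h0 k μ, h⟩
  · obtain ⟨x, hx⟩ := hμ
    obtain ⟨j, k, hjk, h, -⟩ := (PeriodicOperator.isDoubleMultiplier_iff (hρ μ)).1 hx
    exact ⟨j, k, hjk, h⟩
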